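/- Let $g:\mathbb R\to\mathbb R$ be infinitely differentiable, with all derivatives (including $g$ itself) of at most polynomial growth, and such that $f=e^{-g}$ is a probability density all of whose moments are finite. Let $\kappa\ge 0$ and let $\lambda_{i,n}$ ($1\le i\le n$) satisfy $C_-i^{-\kappa}\le\lambda_{i,n}\le C_+i^{-\kappa}$ for some constants $C_-,C_+>0$ and all $n$ and $i$. Let $\tilde\pi_n$ be the law on $\mathbb R^n$ with density $\prod_{i=1}^n\lambda_{i,n}^{-1}f(x_i/\lambda_{i,n})$, and let $\phi_n:\mathbb R^n\to\mathbb R$ be measurable and such that $\frac{d\pi_n}{d\tilde\pi_n}=e^{-\phi_n}$ defines a probability measure $\pi_n$ on $\mathbb R^n$. Write $|x|_s=(\sum_{i=1}^n i^{2s}x_i^2)^{1/2}$ and assume the following. - (Condition 3) There is $M\in\mathbb R$ such that, for all sufficiently large $n$, $\phi_n(x)\ge M$ for all $x\in\mathbb R^n$. - (Condition 5) There are a locally bounded function $\delta:[0,\infty)^2\to[0,\infty)$ and constants $C>0$, $p>0$ and $s,s',s''<\kappa-\frac12$ such that, for all sufficiently large $n$ and all $x,y\in\mathbb R^n$, $|\phi_n(y)-\phi_n(x)|\le\delta(|x|_s,|y|_s)\,|y-x|_{s'}$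 and $|\phi_n(x)|\le C(1+|x|_{s''}^p)$. Let $l,\rho>0$ and let $\sigma_n>0$ with $\sigma_n^2=l^2n^{-\rho}$. Consider the Metropolis–Hastings chain with target $\pi_n$ and one of the proposals $$\text{P-RWM: } y_i=x_i+\sigma_n\lambda_{i,n}Z_i,\qquad \text{P-SLA: } y_i=x_i-\tfrac{\sigma_n^2\lambda_{i,n}}{2}\,g'(x_i/\lambda_{i,n})+\sigma_n\lambda_{i,n}Z_i,$$ where $Z\sim\mathcal N(0,I_n)$. Let $a_n(x,y)$ be the Metropolis–Hastings acceptance probability of the move from $x$ to $y$ and let $x'$ be the state after one step started from $x$; expectations are taken with $x\sim\pi_n$. For a fixed coordinate $i^*\ge 1$ put $S_n^P=E\big[\big((x'_{i^*}-x_{i^*})/\lambda_{i^*,n}\big)^2\big]$ for $n\ge i^*$. Set $I=1$ for P-RWM and $I=1/3$ for P-SLA. With $E_f$ the expectation under $f$ and $\Phi$ the standard normal distribution function, let $$K^{\rm RWM}=E_f[(g')^2],\quad K^{\rm SLA}=\tfrac1{48}E_f[3(g'')^3+5(g^{(3)})^2],$$ $$a^{\rm RWM}(l)=2\Phi\big(-\tfrac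 l2\sqrt{K^{\rm RWM}}\big),\quad a^{\rm SLA}(l)=2\Phi\big(-\tfrac{l^3}2\sqrt{K^{\rm SLA}}\big),$$ and let $a(l)$ be the one of the algorithm considered. Then $K^{\rm RWM},K^{\rm SLA}>0$, the expectations below are finite for all large $n$, and, as $n\to\infty$: (i) if $\rho=I$, then $E[a_n(x,y)]\to a(l)$ and $S_n^P=l^2a(l)\,n^{-I}+o(n^{-I})$ for every fixed $i^*$; (ii) if $\rho>I$, then $E[a_n(x,y)]\to1$ and $S_n^P=l^2n^{-\rho}+o(n^{-\rho})$ for every fixed $i^*$; (iii) if $0<\rho<I$, then, for every $p\ge0$, $E[a_n(x,y)]=\mathcal O(n^{-p})$ and $S_n^P=\mathcal O(n^{-p})$ for every fixed $i^*$. -/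

import Mathlib

open MeasureTheory ProbabilityTheory Filter Asymptotics
open scoped Topology ContDiff

noncomputable section

namespace PrecMCMC

/-- The two preconditioned algorithms: P-RWM and P-SLA. -/
inductive Algorithm
  | pRWM
  | pSLA

/-- The index `I`: `1` for random-walk Metropolis, `1/3` for the simplified Langevin algorithm. -/
def Algorithm.index : Algorithm → ℝ
  | .pRWM => 1
  | .pSLA => 1 / 3

/-- Standing assumption on `f = exp (-g)`: `f` is a probability density, `g` is smooth, all its
derivatives have a polynomial growth bound, and all moments of `f` are finite. -/
structure RegularPotential (g : ℝ → ℝ) : Prop where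
  smooth : ContDiff ℝ ∞ g
  growth : ∀ k : ℕ, ∃ (C : ℝ) (m : ℕ), ∀ u : ℝ, |iteratedDeriv k g u| ≤ C * (1 + |u| ^ m)
  moments : ∀ k : ℕ, Integrable (fun u : ℝ => |u| ^ k * Real.exp (-g u))
  mass_one : ∫ u : ℝ, Real.exp (-g u) = 1

/-- `C₋ i^{-κ} ≤ λ_{i,n} ≤ C₊ i^{-κ}` for all `n` and `1 ≤ i ≤ n`; the coordinate with the
one-based number `i` is the element `i - 1` of `Fin n`. -/
def ScalesLike (κ : ℝ) (lam : (n : ℕ) → Fin n → ℝ) : Prop :=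
  ∃ Cm Cp : ℝ, 0 < Cm ∧ 0 < Cp ∧ ∀ (n : ℕ) (i : Fin n),
    Cm * ((i : ℝ) + 1) ^ (-κ) ≤ lam n i ∧ lam n i ≤ Cp * ((i : ℝ) + 1) ^ (-κ)

/-- The weighted norm `|x|_s = (∑ i^{2s} x_i²)^{1/2}`. -/
def wnorm {n : ℕ} (s : ℝ) (x : Fin n → ℝ) : ℝ :=
  Real.sqrt (∑ i : Fin n, ((i : ℝ) + 1) ^ (2 * s) * x i ^ 2)

/-- `φ_n` is bounded below, uniformly in all large `n`. -/
def BoundedBelow (φ : (n : ℕ) → (Fin n → ℝ) → ℝ) : Prop :=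
  ∃ M : ℝ, ∀ᶠ n in atTop, ∀ x : Fin n → ℝ, M ≤ φ n x

/-- Local boundedness of `δ : [0, ∞) × [0, ∞) → [0, ∞)`; only values at nonnegative arguments
matter. -/
def LocallyBoundedOnQuadrant (δ : ℝ → ℝ → ℝ) : Prop :=
  ∀ r : ℝ, ∃ B : ℝ, ∀ a b : ℝ, 0 ≤ a → a ≤ r → 0 ≤ b → b ≤ r → δ a b ≤ B

/-- The local continuity and polynomial growth condition on `φ_n`, in weighted norms with
exponents below `κ - 1/2`. -/
def LocalControl (κ : ℝ) (φ : (n : ℕ) → (Fin n → ℝ) → ℝ) : Prop :=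
  ∃ (δ : ℝ → ℝ → ℝ) (C p s s' s'' : ℝ),
    (∀ a b : ℝ, 0 ≤ a → 0 ≤ b → 0 ≤ δ a b) ∧ LocallyBoundedOnQuadrant δ ∧
    0 < C ∧ 0 < p ∧ s < κ - 1 / 2 ∧ s' < κ - 1 / 2 ∧ s'' < κ - 1 / 2 ∧
    ∀ᶠ n in atTop,
      (∀ x y : Fin n → ℝ,
        |φ n y - φ n x| ≤ δ (wnorm s x) (wnorm s y) * wnorm s' (y - x)) ∧
      (∀ x : Fin n → ℝ, |φ n x| ≤ C * (1 + wnorm s'' x ^ p))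

/-- Lebesgue density of the reference product law `π̃_n`. -/
def refDensity (g : ℝ → ℝ) {n : ℕ} (lam : Fin n → ℝ) (x : Fin n → ℝ) : ℝ :=
  ∏ i, 1 / lam i * Real.exp (-g (x i / lam i))

/-- The reference product law `π̃_n`. -/
def refMeasure (g : ℝ → ℝ) {n : ℕ} (lam : Fin n → ℝ) : Measure (Fin n → ℝ) :=
  volume.withDensity fun x => ENNReal.ofReal (refDensity g lam x)

/-- The target law `π_n`, with `dπ_n / dπ̃_n = exp (-φ_n)`. -/
def target (g : ℝ → ℝ) {n : ℕ} (lam : Fin n → ℝ) (φ : (Fin n → ℝ) → ℝ) :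
    Measure (Fin n → ℝ) :=
  (refMeasure g lam).withDensity fun x => ENNReal.ofReal (Real.exp (-φ x))

/-- Lebesgue density of the target law `π_n`. -/
def targetDensity (g : ℝ → ℝ) {n : ℕ} (lam : Fin n → ℝ) (φ : (Fin n → ℝ) → ℝ)
    (x : Fin n → ℝ) : ℝ :=
  Real.exp (-φ x) * refDensity g lam x

/-- Mean of the `i`-th coordinate of the proposal from `x`: `x_i` for P-RWM and
`x_i + (σ² λ_i / 2) (-g' (x_i / λ_i))` for P-SLA. -/
def proposalMean (alg : Algorithm) (g : ℝ → ℝ) {n : ℕ} (lam : Fin n → ℝ) (σ : ℝ)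
    (x : Fin n → ℝ) (i : Fin n) : ℝ :=
  match alg with
  | .pRWM => x i
  | .pSLA => x i + σ ^ 2 * lam i / 2 * (-deriv g (x i / lam i))

/-- The proposal `y` from `x`, driven by the noise `z`; its step in coordinate `i` is `σ λ_i`. -/
def proposal (alg : Algorithm) (g : ℝ → ℝ) {n : ℕ} (lam : Fin n → ℝ) (σ : ℝ)
    (x z : Fin n → ℝ) : Fin n → ℝ :=
  fun i => proposalMean alg g lam σ x i + σ * lam i * z i

/-- Lebesgue density `q_n(x, y)` at `y` of the proposal from `x`, when `z` is standard normal. -/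
def proposalDensity (alg : Algorithm) (g : ℝ → ℝ) {n : ℕ} (lam : Fin n → ℝ) (σ : ℝ)
    (x y : Fin n → ℝ) : ℝ :=
  ∏ i, gaussianPDFReal (proposalMean alg g lam σ x i) (Real.toNNReal ((σ * lam i) ^ 2)) (y i)

open scoped Classical in
/-- The Metropolis–Hastings acceptance probability `a_n(x, y)`. -/
def acceptProb (alg : Algorithm) (g : ℝ → ℝ) {n : ℕ} (lam : Fin n → ℝ) (σ : ℝ)
    (φ : (Fin n → ℝ) → ℝ) (x y : Fin n → ℝ) : ℝ :=
  if 0 < targetDensity g lam φ x * proposalDensity alg g lam σ x y then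
    min 1 (targetDensity g lam φ y * proposalDensity alg g lam σ y x /
      (targetDensity g lam φ x * proposalDensity alg g lam σ x y))
  else 0

/-- Randomness of one step of the stationary chain: the current state `x`, the noise `z` of the
proposal, and the variable `u` that decides on acceptance. -/
abbrev StepSpace (n : ℕ) : Type := (Fin n → ℝ) × (Fin n → ℝ) × ℝ

/-- Joint law of `x ∼ π_n`, `z ∼ N(0, I_n)` and `u` uniform on `[0, 1]`, independent. -/
def stepLaw (g : ℝ → ℝ) {n : ℕ} (lam : Fin n → ℝ) (φ : (Fin n → ℝ) → ℝ) :
    Measure (StepSpace n) :=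
  (target g lam φ).prod
    ((Measure.pi fun _ : Fin n => gaussianReal 0 1).prod (volume.restrict (Set.Icc (0 : ℝ) 1)))

/-- The random variable `a_n(x, y)`, where `y` is the proposal from `x`. -/
def stepAccept (alg : Algorithm) (g : ℝ → ℝ) {n : ℕ} (lam : Fin n → ℝ) (σ : ℝ)
    (φ : (Fin n → ℝ) → ℝ) (w : StepSpace n) : ℝ :=
  acceptProb alg g lam σ φ w.1 (proposal alg g lam σ w.1 w.2.1)

open scoped Classical in
/-- The next state of the chain: the proposal `y` with probability `a_n(x, y)`, and `x`
otherwise. -/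
def nextState (alg : Algorithm) (g : ℝ → ℝ) {n : ℕ} (lam : Fin n → ℝ) (σ : ℝ)
    (φ : (Fin n → ℝ) → ℝ) (w : StepSpace n) : Fin n → ℝ :=
  if w.2.2 ≤ stepAccept alg g lam σ φ w then proposal alg g lam σ w.1 w.2.1 else w.1

/-- The squared jump of coordinate `i` in one step, rescaled by `λ_i`. -/
def sqJump (alg : Algorithm) (g : ℝ → ℝ) {n : ℕ} (lam : Fin n → ℝ) (σ : ℝ)
    (φ : (Fin n → ℝ) → ℝ) (i : Fin n) (w : StepSpace n) : ℝ :=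
  ((nextState alg g lam σ φ w i - w.1 i) / lam i) ^ 2

/-- The average acceptance probability `E[a_n(x, y)]` in stationarity. -/
def meanAccept (alg : Algorithm) (g : ℝ → ℝ) {n : ℕ} (lam : Fin n → ℝ) (σ : ℝ)
    (φ : (Fin n → ℝ) → ℝ) : ℝ :=
  ∫ w, stepAccept alg g lam σ φ w ∂(stepLaw g lam φ)

/-- The rescaled mean squared jump in stationarity, for the coordinate with zero-based number
`j`; it is meaningful for `j < n`, and set to `0` otherwise. -/
def meanSqJump (alg : Algorithm) (g : ℝ → ℝ) {n : ℕ} (lam : Fin n → ℝ) (σ : ℝ)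
    (φ : (Fin n → ℝ) → ℝ) (j : ℕ) : ℝ :=
  if h : j < n then ∫ w, sqJump alg g lam σ φ ⟨j, h⟩ w ∂(stepLaw g lam φ) else 0

/-- The constant `K` of the algorithm; it depends only on the density `f = exp (-g)`. -/
def roughness (alg : Algorithm) (g : ℝ → ℝ) : ℝ :=
  match alg with
  | .pRWM => ∫ u : ℝ, deriv g u ^ 2 * Real.exp (-g u)
  | .pSLA => (∫ u : ℝ, (3 * iteratedDeriv 2 g u ^ 3 + 5 * iteratedDeriv 3 g u ^ 2) *
      Real.exp (-g u)) / 48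

/-- The limiting acceptance probability: `2 Φ(-(l / 2) √(K / τ))` for random-walk Metropolis and
`2 Φ(-(l³ / 2) √(K / τ))` for the simplified Langevin algorithm. -/
def limitAccept (alg : Algorithm) (g : ℝ → ℝ) (τ l : ℝ) : ℝ :=
  match alg with
  | .pRWM => 2 * cdf (gaussianReal 0 1) (-(l / 2) * Real.sqrt (roughness .pRWM g / τ))
  | .pSLA => 2 * cdf (gaussianReal 0 1) (-(l ^ 3 / 2) * Real.sqrt (roughness .pSLA g / τ))

end PrecMCMC

end

/-! Put `x_i = λ_i u_i`. Under the reference law the `u_i` are i.i.d. with density `exp (-g)`, the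
proposal moves each `u_i` by the same mechanism with step `σ`, and the scales `λ_i` cancel from the
Metropolis–Hastings ratio except inside `φ`. The log ratio is `∑ R(u_i, z_i) + φ x - φ y` with `R =
σ^m V + O(σ^(m+1))`, where `m = 1` for P-RWM, `m = 3` for P-SLA, and `E[V^2] = K`. The relevant size
is therefore `n σ^(2m)`, of order `n^(1 - mρ)`; since `m I = 1`, it stays constant, vanishes or
diverges according to whether `ρ` equals, exceeds or is below `I`.

The mean of `R` comes from reversibility instead of a longer expansion. Exchanging the two ends of a
move gives `E[H(R)] = E[H(-R) e^R]` (`integral_logRatio`), and a suitable `H` yields `E[sin(tR)] =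
-E[sin(tR) tanh(R/2)]`, which is of second order in `R`. Hence the characteristic function of `R` is
determined by `V` alone up to the order that matters (`tendsto_integral_logRatio`,
`tendsto_charFun_logRatio`). If `n σ^(2m) → τ`, the sum converges to `N(-τK/2, τK)`, under which the
mean of `min 1 exp` is `2Φ(-√(τK)/2)` (`tendsto_integral_capExp`). The case `τ = 0` covers `ρ > I`.

To handle `φ`, all dimensions are realised on one space of infinite sequences. Weighted norms with
exponent below `κ - 1/2` are almost surely bounded uniformly in `n`, so `φ x - φ y → 0`, and `φ x`
depends up to a small error on the first `k` coordinates only. Finitely many coordinates do not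
influence the limit of the sum, so the weight `exp (-φ)` decouples from it
(`tendsto_integral_decouple`). The weight has mean one, so the limits are those of the product law.

For `ρ < I` the bound `min 1 (exp x) ≤ exp (x/2)` is combined with `E[exp (R/2)] ≤ 1 - c σ^(2m)`,
which produces a factor `exp (-c n^θ)` with `θ = 1 - mρ > 0`. The term from `φ` is at most of order
`n^(θ/2)` unless some coordinate exceeds a small power of `n`, and that event has probability below
every power of `1/n` because all moments are finite (`integral_seqAccept_isBigO`). -/

noncomputable section

namespace PrecMCMC

/-! ### Moments, growth bounds and Taylor estimates for the potential. -/

section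

/-- The law `exp (-g) du` of one rescaled coordinate. -/
def marginal (g : ℝ → ℝ) : Measure ℝ := volume.withDensity fun u => ENNReal.ofReal (Real.exp (-g u))

/-- The joint law of a rescaled coordinate and of the noise driving its proposal. -/
def pairLaw (g : ℝ → ℝ) : Measure (ℝ × ℝ) := (marginal g).prod (gaussianReal 0 1)

/-- The polynomial weight in which all errors are measured. -/
def weight (p : ℝ × ℝ) : ℝ := 1 + |p.1| + |p.2|

lemma one_le_weight (p : ℝ × ℝ) : 1 ≤ weight p := by
  unfold weight; have := abs_nonneg p.1; have := abs_nonneg p.2; linarith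

lemma measurable_weight : Measurable weight := by unfold weight; fun_prop

namespace RegularPotential

variable {g : ℝ → ℝ}

lemma continuous_iteratedDeriv (hg : RegularPotential g) (j : ℕ) :
    Continuous (iteratedDeriv j g) :=
  hg.smooth.continuous_iteratedDeriv j (by exact_mod_cast le_top)

lemma continuous (hg : RegularPotential g) : Continuous g := hg.smooth.continuous

lemma hasDerivAt_iteratedDeriv (hg : RegularPotential g) (j : ℕ) (u : ℝ) :
    HasDerivAt (iteratedDeriv j g) (iteratedDeriv (j + 1) g u) u := by
  rw [iteratedDeriv_succ]
  exact ((hg.smooth.differentiable_iteratedDeriv j (by exact_mod_cast ENat.natCast_lt_top j)) u).hasDerivAt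

lemma hasDerivAt (hg : RegularPotential g) (u : ℝ) : HasDerivAt g (iteratedDeriv 1 g u) u := by
  simpa using hg.hasDerivAt_iteratedDeriv 0 u

lemma integrable_exp (hg : RegularPotential g) : Integrable fun u => Real.exp (-g u) := by
  simpa using hg.moments 0

lemma isProbabilityMeasure_marginal (hg : RegularPotential g) :
    IsProbabilityMeasure (marginal g) := by
  constructor
  rw [marginal, withDensity_apply _ MeasurableSet.univ, setLIntegral_univ,
    ← ofReal_integral_eq_lintegral_ofReal hg.integrable_exp (ae_of_all _ fun _ => (Real.exp_pos _).le),
    hg.mass_one, ENNReal.ofReal_one]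

lemma integrable_marginal_iff (hg : RegularPotential g) (F : ℝ → ℝ) :
    Integrable F (marginal g) ↔ Integrable fun u => F u * Real.exp (-g u) := by
  have hm : Measurable fun u => (Real.exp (-g u)).toNNReal := by
    have := hg.continuous.measurable; fun_prop
  have : marginal g = volume.withDensity fun u => ((Real.exp (-g u)).toNNReal : ENNReal) := rfl
  rw [this, integrable_withDensity_iff_integrable_smul hm]
  refine integrable_congr (ae_of_all _ fun u => ?_)
  simp [NNReal.smul_def, Real.coe_toNNReal _ (Real.exp_pos _).le, mul_comm]

lemma integral_marginal (hg : RegularPotential g) (F : ℝ → ℝ) :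
    ∫ u, F u ∂(marginal g) = ∫ u, F u * Real.exp (-g u) := by
  have hm : Measurable fun u => (Real.exp (-g u)).toNNReal := by
    have := hg.continuous.measurable; fun_prop
  have : marginal g = volume.withDensity fun u => ((Real.exp (-g u)).toNNReal : ENNReal) := rfl
  rw [this, integral_withDensity_eq_integral_smul hm]
  refine integral_congr_ae (ae_of_all _ fun u => ?_)
  simp [NNReal.smul_def, Real.coe_toNNReal _ (Real.exp_pos _).le, mul_comm]

lemma isProbabilityMeasure_pairLaw (hg : RegularPotential g) :
    IsProbabilityMeasure (pairLaw g) := by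
  have := hg.isProbabilityMeasure_marginal
  unfold pairLaw; infer_instance

/-- All later domination arguments rest on this: the moment hypothesis covers the coordinate,
Gaussian moments cover the noise, and the weight is at most three times the largest of its three
terms. -/
lemma integrable_weight_pow (hg : RegularPotential g) (k : ℕ) :
    Integrable (fun p => weight p ^ k) (pairLaw g) := by
  have := hg.isProbabilityMeasure_marginal
  have h1 : Integrable (fun u : ℝ => |u| ^ k) (marginal g) :=
    (hg.integrable_marginal_iff _).2 (hg.moments k)
  have h2 : Integrable (fun u : ℝ => |u| ^ k) (gaussianReal 0 1) := by
    simpa using (memLp_id_gaussianReal (μ := 0) (v := 1) (k : NNReal)).integrable_norm_pow'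
  have h3 : Integrable (fun p : ℝ × ℝ => (3 : ℝ) ^ k * (1 + |p.1| ^ k + |p.2| ^ k)) (pairLaw g) :=
    (((integrable_const _).add (h1.comp_fst _)).add (h2.comp_snd _)).const_mul _
  refine h3.mono' (measurable_weight.pow_const k).aestronglyMeasurable (ae_of_all _ fun p => ?_)
  have hw := one_le_weight p
  rw [Real.norm_of_nonneg (by positivity)]
  have a0 := abs_nonneg p.1
  have b0 := abs_nonneg p.2
  have key : ∃ M, 0 ≤ M ∧ weight p ≤ 3 * M ∧ M ^ k ≤ 1 + |p.1| ^ k + |p.2| ^ k := by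
    have ha : 0 ≤ |p.1| ^ k := by positivity
    have hb : 0 ≤ |p.2| ^ k := by positivity
    unfold weight
    rcases le_total |p.1| |p.2| with h | h
    · rcases le_total 1 |p.2| with h' | h'
      · exact ⟨|p.2|, b0, by linarith, by linarith⟩
      · exact ⟨1, zero_le_one, by linarith, by simp; linarith⟩
    · rcases le_total 1 |p.1| with h' | h'
      · exact ⟨|p.1|, a0, by linarith, by linarith⟩
      · exact ⟨1, zero_le_one, by linarith, by simp; linarith⟩
  obtain ⟨M, hM0, hM1, hM2⟩ := key
  calc weight p ^ k ≤ (3 * M) ^ k := by gcongr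
    _ = 3 ^ k * M ^ k := mul_pow ..
    _ ≤ _ := by gcongr

lemma exists_growth_le (hg : RegularPotential g) (N : ℕ) :
    ∃ (C : ℝ) (m : ℕ), 1 ≤ C ∧ ∀ j ≤ N, ∀ u, |iteratedDeriv j g u| ≤ C * (1 + |u|) ^ m := by
  have one : ∀ j, ∃ (C : ℝ) (m : ℕ), 1 ≤ C ∧ ∀ u, |iteratedDeriv j g u| ≤ C * (1 + |u|) ^ m := by
    intro j
    obtain ⟨C, m, h⟩ := hg.growth j
    refine ⟨2 * |C| + 1, m, by have := abs_nonneg C; linarith, fun u => (h u).trans ?_⟩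
    have h0 := abs_nonneg u
    have h1 : 1 ≤ (1 + |u|) ^ m := one_le_pow₀ (by linarith)
    have h2 : |u| ^ m ≤ (1 + |u|) ^ m := by gcongr; linarith
    have h3 : 0 ≤ |u| ^ m := by positivity
    have := le_abs_self C
    have := abs_nonneg C
    calc C * (1 + |u| ^ m) ≤ |C| * (1 + |u| ^ m) := by gcongr
      _ ≤ |C| * (2 * (1 + |u|) ^ m) := by gcongr; linarith
      _ ≤ _ := by nlinarith
  induction N with
  | zero =>
    obtain ⟨C, m, h1, h⟩ := one 0
    exact ⟨C, m, h1, fun j hj u => by obtain rfl : j = 0 := by omega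
                                      exact h u⟩
  | succ N ih =>
    obtain ⟨C, m, h1, h⟩ := one (N + 1)
    obtain ⟨C', m', h1', h'⟩ := ih
    refine ⟨max C C', max m m', le_max_of_le_left h1, fun j hj u => ?_⟩
    have h0 := abs_nonneg u
    rcases Nat.lt_or_ge N j with hj' | hj'
    · obtain rfl : j = N + 1 := by omega
      refine (h u).trans ?_
      gcongr
      · exact le_max_left ..
      · linarith
      · exact le_max_left ..
    · refine (h' j hj' u).trans ?_
      gcongr
      · exact le_max_right ..
      · linarith
      · exact le_max_right ..

end RegularPotential

/-- The mean value inequality on the segment from `u` to `x`, where the bound on the derivative is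
largest at `x`. Each use raises the order of a Taylor remainder by one; factorials are given away.
-/
lemma abs_le_of_hasDerivAt_of_abs_le {F F' : ℝ → ℝ} {u v K : ℝ} {k : ℕ}
    (hF : ∀ x, HasDerivAt F (F' x) x) (h0 : F u = 0)
    (hb : ∀ x ∈ Set.uIcc u v, |F' x| ≤ K * |x - u| ^ k) :
    ∀ x ∈ Set.uIcc u v, |F x| ≤ K * |x - u| ^ (k + 1) := by
  intro x hx
  have hK : 0 ≤ K * |x - u| ^ k := (abs_nonneg _).trans (hb x hx)
  have := (convex_uIcc u x).norm_image_sub_le_of_norm_hasDerivWithin_le (f := F) (f' := F')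
    (C := K * |x - u| ^ k) (fun y _ => (hF y).hasDerivWithinAt) (fun y hy => ?_)
    Set.left_mem_uIcc Set.right_mem_uIcc
  · rw [h0, sub_zero, Real.norm_eq_abs, Real.norm_eq_abs] at this
    rwa [pow_succ, ← mul_assoc]
  · refine (hb y (Set.uIcc_subset_uIcc_left hx hy)).trans ?_
    -- The sign of `K` is only forced when `x ≠ u`; at `x = u` the segment is a single point.
    rcases eq_or_ne x u with rfl | hne
    · rw [Set.uIcc_self] at hy; rw [hy]
    have hK' : 0 ≤ K := by
      have : 0 < |x - u| ^ k := by have := abs_pos.2 (sub_ne_zero.2 hne); positivity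
      exact nonneg_of_mul_nonneg_left hK this
    have : |y - u| ≤ |x - u| := Set.abs_sub_left_of_mem_uIcc hy
    gcongr

/-- Taylor bounds for `g` and `g'` between two points, in terms of a bound on the derivatives. -/
lemma taylor_bounds {g : ℝ → ℝ} (hg : RegularPotential g) {u v L : ℝ}
    (hL : ∀ x ∈ Set.uIcc u v, ∀ j ≤ 4, |iteratedDeriv j g x| ≤ L) :
    |g v - g u - (v - u) * iteratedDeriv 1 g u| ≤ L * |v - u| ^ 2 ∧
    |iteratedDeriv 1 g v - iteratedDeriv 1 g u| ≤ L * |v - u| ∧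
    |iteratedDeriv 1 g v - iteratedDeriv 1 g u - (v - u) * iteratedDeriv 2 g u|
      ≤ L * |v - u| ^ 2 ∧
    |iteratedDeriv 1 g v - iteratedDeriv 1 g u - (v - u) * iteratedDeriv 2 g u
      - (v - u) ^ 2 / 2 * iteratedDeriv 3 g u| ≤ L * |v - u| ^ 3 ∧
    |g v - g u - (v - u) * iteratedDeriv 1 g u - (v - u) ^ 2 / 2 * iteratedDeriv 2 g u
      - (v - u) ^ 3 / 6 * iteratedDeriv 3 g u| ≤ L * |v - u| ^ 4 := by
  have D : ∀ (j : ℕ) (x : ℝ), HasDerivAt (iteratedDeriv j g) (iteratedDeriv (j + 1) g x) x :=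
    hg.hasDerivAt_iteratedDeriv
  have D0 : ∀ x, HasDerivAt g (iteratedDeriv 1 g x) x := hg.hasDerivAt
  have d1 : ∀ x, HasDerivAt (fun x => x - u) 1 x := fun x => (hasDerivAt_id x).sub_const u
  -- The remainders form a ladder: each vanishes at `u`, and its derivative is the remainder one
  -- order lower for the next derivative of `g`.
  have r1 : ∀ j, j + 1 ≤ 4 → ∀ x ∈ Set.uIcc u v,
      |iteratedDeriv j g x - iteratedDeriv j g u| ≤ L * |x - u| ^ (0 + 1) := fun j hj =>
    abs_le_of_hasDerivAt_of_abs_le (fun x => (D j x).sub_const _) (by simp)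
      (fun x hx => by simpa using hL x hx (j + 1) hj)
  have r2 : ∀ j, j + 2 ≤ 4 → ∀ x ∈ Set.uIcc u v,
      |iteratedDeriv j g x - iteratedDeriv j g u - (x - u) * iteratedDeriv (j + 1) g u|
        ≤ L * |x - u| ^ (0 + 1 + 1) := fun j hj =>
    abs_le_of_hasDerivAt_of_abs_le
      (F' := fun x => iteratedDeriv (j + 1) g x - iteratedDeriv (j + 1) g u)
      (fun x => by
        simpa using ((D j x).sub_const (iteratedDeriv j g u)).fun_sub
          ((d1 x).mul_const (iteratedDeriv (j + 1) g u))) (by simp)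
      (r1 (j + 1) hj)
  have r3 : ∀ j, j + 3 ≤ 4 → ∀ x ∈ Set.uIcc u v,
      |iteratedDeriv j g x - iteratedDeriv j g u - (x - u) * iteratedDeriv (j + 1) g u
        - (x - u) ^ 2 / 2 * iteratedDeriv (j + 2) g u| ≤ L * |x - u| ^ (0 + 1 + 1 + 1) :=
    fun j hj => abs_le_of_hasDerivAt_of_abs_le
      (F' := fun x => iteratedDeriv (j + 1) g x - iteratedDeriv (j + 1) g u
        - (x - u) * iteratedDeriv (j + 1 + 1) g u)
      (fun x => by
        have := (((D j x).sub_const (iteratedDeriv j g u)).fun_sub ((d1 x).mul_const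
          (iteratedDeriv (j + 1) g u))).fun_sub
          ((((d1 x).fun_pow 2).div_const 2).mul_const (iteratedDeriv (j + 2) g u))
        exact this.congr_deriv (by simp)) (by simp)
      (r2 (j + 1) hj)
  have r4 : ∀ x ∈ Set.uIcc u v,
      |g x - g u - (x - u) * iteratedDeriv 1 g u - (x - u) ^ 2 / 2 * iteratedDeriv 2 g u
        - (x - u) ^ 3 / 6 * iteratedDeriv 3 g u| ≤ L * |x - u| ^ (0 + 1 + 1 + 1 + 1) :=
    abs_le_of_hasDerivAt_of_abs_le
      (F' := fun x => iteratedDeriv 1 g x - iteratedDeriv 1 g u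
        - (x - u) * iteratedDeriv 2 g u - (x - u) ^ 2 / 2 * iteratedDeriv 3 g u)
      (fun x => by
        have := ((((D0 x).sub_const (g u)).fun_sub ((d1 x).mul_const
          (iteratedDeriv 1 g u))).fun_sub
          ((((d1 x).fun_pow 2).div_const 2).mul_const (iteratedDeriv 2 g u))).fun_sub
          ((((d1 x).fun_pow 3).div_const 6).mul_const (iteratedDeriv 3 g u))
        exact this.congr_deriv (by push_cast; ring)) (by simp)
      (r3 1 (by norm_num))
  have hv : v ∈ Set.uIcc u v := Set.right_mem_uIcc
  refine ⟨by simpa using r2 0 (by norm_num) v hv, by simpa using r1 1 (by norm_num) v hv,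
    by simpa using r2 1 (by norm_num) v hv, by simpa using r3 1 (by norm_num) v hv,
    by simpa using r4 v hv⟩

end

/-! ### Expansion of the log acceptance ratio of one coordinate. -/

section

/-- The order in `σ` of the log acceptance ratio of one coordinate. -/
def Algorithm.order : Algorithm → ℕ
  | .pRWM => 1
  | .pSLA => 3

/-- The drift of a proposal in rescaled coordinates, per unit of `σ ^ 2`. -/
def drift (alg : Algorithm) (g : ℝ → ℝ) (u : ℝ) : ℝ :=
  match alg with
  | .pRWM => 0
  | .pSLA => -iteratedDeriv 1 g u / 2

/-- The proposal in rescaled coordinates. -/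
def move (alg : Algorithm) (g : ℝ → ℝ) (σ : ℝ) (p : ℝ × ℝ) : ℝ :=
  p.1 + σ ^ 2 * drift alg g p.1 + σ * p.2

/-- The logarithm, up to a constant, of the density of moves from `u` to `v`. -/
def logKernel (alg : Algorithm) (g : ℝ → ℝ) (σ u v : ℝ) : ℝ :=
  -g u - (v - (u + σ ^ 2 * drift alg g u)) ^ 2 / (2 * σ ^ 2)

/-- The contribution of one coordinate to the log acceptance ratio. -/
def logRatio (alg : Algorithm) (g : ℝ → ℝ) (σ : ℝ) (p : ℝ × ℝ) : ℝ :=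
  logKernel alg g σ (move alg g σ p) p.1 - logKernel alg g σ p.1 (move alg g σ p)

/-- The leading coefficient of `logRatio` as `σ → 0`. -/
def lead (alg : Algorithm) (g : ℝ → ℝ) (p : ℝ × ℝ) : ℝ :=
  match alg with
  | .pRWM => -(p.2 * iteratedDeriv 1 g p.1)
  | .pSLA => p.2 ^ 3 * iteratedDeriv 3 g p.1 / 12
      - p.2 * (iteratedDeriv 1 g p.1 * iteratedDeriv 2 g p.1) / 4

variable {g : ℝ → ℝ} {alg : Algorithm}

lemma RegularPotential.continuous_drift (hg : RegularPotential g) : Continuous (drift alg g) := by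
  have := hg.continuous_iteratedDeriv 1
  cases alg <;> unfold drift <;> fun_prop

lemma RegularPotential.continuous_move (hg : RegularPotential g) (σ : ℝ) :
    Continuous (move alg g σ) := by
  have := hg.continuous_drift (alg := alg)
  unfold move; fun_prop

lemma RegularPotential.continuous_logKernel (hg : RegularPotential g) (σ : ℝ) :
    Continuous fun p : ℝ × ℝ => logKernel alg g σ p.1 p.2 := by
  have := hg.continuous_drift (alg := alg)
  have := hg.continuous
  unfold logKernel; fun_prop

lemma RegularPotential.continuous_logRatio (hg : RegularPotential g) (σ : ℝ) :
    Continuous (logRatio alg g σ) := by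
  have h := hg.continuous_logKernel (alg := alg) σ
  have h' := hg.continuous_move (alg := alg) σ
  unfold logRatio
  exact (h.comp (h'.prodMk continuous_fst)).sub (h.comp (continuous_fst.prodMk h'))

/-- The random-walk kernel is symmetric, so its quadratic terms cancel. -/
lemma logRatio_pRWM (σ : ℝ) (p : ℝ × ℝ) :
    logRatio .pRWM g σ p = g p.1 - g (move .pRWM g σ p) := by
  simp only [logRatio, logKernel, drift, mul_zero, add_zero]
  rw [← neg_sub (move .pRWM g σ p) p.1, neg_sq]
  ring

/-- This form explains the order three: the first line together with the second is the error of the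
trapezoidal rule for `∫ g'`, which is cubic in the step, and the last term is `σ^2` times a
difference that is itself of order `σ`. -/
lemma logRatio_pSLA {σ : ℝ} (hσ : σ ≠ 0) (p : ℝ × ℝ) :
    logRatio .pSLA g σ p = g p.1 - g (move .pSLA g σ p)
      + (move .pSLA g σ p - p.1) * (iteratedDeriv 1 g p.1 + iteratedDeriv 1 g (move .pSLA g σ p)) / 2
      + σ ^ 2 / 8 * (iteratedDeriv 1 g p.1 ^ 2 - iteratedDeriv 1 g (move .pSLA g σ p) ^ 2) := by
  simp only [logRatio, logKernel, drift]
  field_simp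
  ring

lemma abs_mul_le_mul {a b A B : ℝ} (ha : |a| ≤ A) (hb : |b| ≤ B) : |a * b| ≤ A * B := by
  rw [abs_mul]; exact mul_le_mul ha hb (abs_nonneg _) ((abs_nonneg _).trans ha)

lemma abs_logRatio_pRWM_sub_le (hg : RegularPotential g) {σ L : ℝ} {p : ℝ × ℝ} (hσ : 0 < σ)
    (hL : 1 ≤ L) (hz : |p.2| ≤ L)
    (hd : ∀ x ∈ Set.uIcc p.1 (move .pRWM g σ p), ∀ j ≤ 4, |iteratedDeriv j g x| ≤ L) :
    |logRatio .pRWM g σ p - σ ^ 1 * lead .pRWM g p| ≤ σ ^ 2 * L ^ 3 := by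
  obtain ⟨h, -⟩ := taylor_bounds hg hd
  have hm : move .pRWM g σ p - p.1 = σ * p.2 := by simp [move, drift]
  rw [hm] at h
  rw [logRatio_pRWM]
  calc |g p.1 - g (move .pRWM g σ p) - σ ^ 1 * lead .pRWM g p|
      = |g (move .pRWM g σ p) - g p.1 - σ * p.2 * iteratedDeriv 1 g p.1| := by
        rw [← abs_neg]; congr 1; simp only [lead]; ring
    _ ≤ L * |σ * p.2| ^ 2 := h
    _ = σ ^ 2 * (L * |p.2| ^ 2) := by rw [abs_mul, abs_of_pos hσ]; ring
    _ ≤ σ ^ 2 * (L * L ^ 2) := by gcongr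
    _ = _ := by ring

/-- The trapezoidal error contributes `d^3 g''' / 12` and the last term `-σ^2 d g' g'' / 4`, with `d
= σ z - σ^2 g' / 2`. Replacing `d` by `σ z` gives the leading coefficient; everything else is of
order `σ^4`. The constant 40 is not sharp. -/
lemma abs_logRatio_pSLA_sub_le (hg : RegularPotential g) {σ L : ℝ} {p : ℝ × ℝ} (hσ : 0 < σ)
    (hσ1 : σ ≤ 1) (hL : 1 ≤ L) (hz : |p.2| ≤ L)
    (hd : ∀ x ∈ Set.uIcc p.1 (move .pSLA g σ p), ∀ j ≤ 4, |iteratedDeriv j g x| ≤ L) :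
    |logRatio .pSLA g σ p - σ ^ 3 * lead .pSLA g p| ≤ σ ^ 4 * (40 * L ^ 5) := by
  obtain ⟨-, h1, h2, h3, h4⟩ := taylor_bounds hg hd
  rw [logRatio_pSLA hσ.ne']
  have hu := fun j hj => hd p.1 Set.left_mem_uIcc j hj
  have hm : move .pSLA g σ p - p.1 = σ * p.2 + σ ^ 2 * (-iteratedDeriv 1 g p.1 / 2) := by
    simp only [move, drift]; ring
  set v := move .pSLA g σ p
  have hlead : lead .pSLA g p = p.2 ^ 3 * iteratedDeriv 3 g p.1 / 12
      - p.2 * (iteratedDeriv 1 g p.1 * iteratedDeriv 2 g p.1) / 4 := rfl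
  rw [hlead]
  obtain ⟨u, z⟩ := p
  simp only at *
  have b1 : |iteratedDeriv 1 g u| ≤ L := hu 1 (by norm_num)
  have b2 : |iteratedDeriv 2 g u| ≤ L := hu 2 (by norm_num)
  have b3 : |iteratedDeriv 3 g u| ≤ L := hu 3 (by norm_num)
  set g1 := iteratedDeriv 1 g u
  set g2 := iteratedDeriv 2 g u
  set g3 := iteratedDeriv 3 g u
  set w1 := iteratedDeriv 1 g v
  have bc : |-g1 / 2| ≤ L := by
    rw [abs_div, abs_neg, abs_two]; have := abs_nonneg g1; linarith
  set c := -g1 / 2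
  have bd : |v - u| ≤ σ * (2 * L) := by
    rw [hm]
    calc |σ * z + σ ^ 2 * c| ≤ |σ * z| + |σ ^ 2 * c| := abs_add_le _ _
      _ = σ * |z| + σ ^ 2 * |c| := by rw [abs_mul, abs_mul, abs_of_pos hσ, abs_of_pos (pow_pos hσ 2)]
      _ ≤ σ * L + σ * L := by
        gcongr
        nlinarith
      _ = _ := by ring
  set d := v - u
  -- The Taylor remainders become opaque variables, so that the error is an explicit polynomial in
  -- them and in quantities bounded by `L`.
  obtain ⟨e0, he0⟩ : ∃ e0, e0 = g v - g u - d * g1 - d ^ 2 / 2 * g2 - d ^ 3 / 6 * g3 := ⟨_, rfl⟩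
  obtain ⟨e1, he1⟩ : ∃ e1, e1 = w1 - g1 - d * g2 - d ^ 2 / 2 * g3 := ⟨_, rfl⟩
  obtain ⟨f1, hf1⟩ : ∃ f1, f1 = w1 - g1 - d * g2 := ⟨_, rfl⟩
  obtain ⟨k1, hk1⟩ : ∃ k1, k1 = w1 - g1 := ⟨_, rfl⟩
  rw [← he0] at h4
  rw [← he1] at h3
  rw [← hf1] at h2
  rw [← hk1] at h1
  have L0 : 0 < L := by linarith
  have bd0 := abs_nonneg d
  have B4 : |e0| ≤ σ ^ 4 * (16 * L ^ 5) := h4.trans <| by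
    calc L * |d| ^ 4 ≤ L * (σ * (2 * L)) ^ 4 := by gcongr
      _ = _ := by ring
  have B3 : |d * e1| ≤ σ ^ 4 * (16 * L ^ 5) := (abs_mul_le_mul bd h3).trans <| by
    calc σ * (2 * L) * (L * |d| ^ 3) ≤ σ * (2 * L) * (L * (σ * (2 * L)) ^ 3) := by gcongr
      _ = _ := by ring
  have B2 : |g1 * f1| ≤ σ ^ 2 * (4 * L ^ 4) := (abs_mul_le_mul b1 h2).trans <| by
    calc L * (L * |d| ^ 2) ≤ L * (L * (σ * (2 * L)) ^ 2) := by gcongr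
      _ = _ := by ring
  have B1 : |k1 * k1| ≤ σ ^ 2 * (4 * L ^ 4) := (abs_mul_le_mul h1 h1).trans <| by
    calc L * |d| * (L * |d|) ≤ L * (σ * (2 * L)) * (L * (σ * (2 * L))) := by gcongr
      _ = _ := by ring
  have B0 : |c * g1 * g2| ≤ L ^ 3 := (abs_mul_le_mul (abs_mul_le_mul bc b1) b2).trans_eq (by ring)
  have L45 : L ^ 4 ≤ L ^ 5 := pow_le_pow_right₀ hL (by norm_num)
  have L35 : L ^ 3 ≤ L ^ 5 := pow_le_pow_right₀ hL (by norm_num)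
  have C1 : |z * z * c * g3| ≤ L ^ 5 :=
    ((abs_mul_le_mul (abs_mul_le_mul (abs_mul_le_mul hz hz) bc) b3).trans_eq
      (by ring : L * L * L * L = L ^ 4)).trans L45
  have C2 : |σ * (z * c * c * g3)| ≤ L ^ 5 := by
    have := (abs_mul_le_mul (abs_of_pos hσ).le
      (abs_mul_le_mul (abs_mul_le_mul (abs_mul_le_mul hz bc) bc) b3))
    refine this.trans (le_trans ?_ L45)
    calc σ * (L * L * L * L) ≤ 1 * (L * L * L * L) := by gcongr
      _ = _ := by ring
  have C3 : |σ ^ 2 * (c * c * c * g3)| ≤ L ^ 5 := by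
    have := (abs_mul_le_mul (abs_of_pos (pow_pos hσ 2)).le
      (abs_mul_le_mul (abs_mul_le_mul (abs_mul_le_mul bc bc) bc) b3))
    refine this.trans (le_trans ?_ L45)
    calc σ ^ 2 * (L * L * L * L) ≤ 1 * (L * L * L * L) := by
          gcongr; exact pow_le_one₀ hσ.le hσ1
      _ = _ := by ring
  have key : g u - g v + d * (g1 + w1) / 2 + σ ^ 2 / 8 * (g1 ^ 2 - w1 ^ 2)
      - σ ^ 3 * (z ^ 3 * g3 / 12 - z * (g1 * g2) / 4) =
      σ ^ 4 * (3 * (z * z * c * g3) + 3 * (σ * (z * c * c * g3)) + σ ^ 2 * (c * c * c * g3)) / 12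
        - σ ^ 4 * (c * g1 * g2) / 4 - e0 + (d * e1) / 2
        - σ ^ 2 / 8 * (2 * (g1 * f1) + k1 * k1) := by
    rw [he0, he1, hf1, hk1, hm]; ring
  rw [key]
  have s4 : 0 < σ ^ 4 := by positivity
  have s2 : 0 < σ ^ 2 := by positivity
  have T1 : |σ ^ 4 * (3 * (z * z * c * g3) + 3 * (σ * (z * c * c * g3))
      + σ ^ 2 * (c * c * c * g3)) / 12| ≤ σ ^ 4 * L ^ 5 := by
    rw [abs_div, abs_mul, abs_of_pos s4, abs_of_pos (by norm_num : (0 : ℝ) < 12), div_le_iff₀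
      (by norm_num), mul_assoc (σ ^ 4) (L ^ 5)]
    refine mul_le_mul_of_nonneg_left ?_ s4.le
    clear h1 h2 h3 h4 b1 b2 b3 bc B0 B1 B2 B3 B4 bd hu hd hz
    rw [abs_le] at *
    constructor <;> linarith
  have T2 : |σ ^ 4 * (c * g1 * g2) / 4| ≤ σ ^ 4 * L ^ 5 := by
    rw [abs_div, abs_mul, abs_of_pos s4, abs_of_pos (by norm_num : (0 : ℝ) < 4), div_le_iff₀
      (by norm_num), mul_assoc (σ ^ 4) (L ^ 5)]
    refine mul_le_mul_of_nonneg_left ?_ s4.le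
    have : 0 ≤ L ^ 5 := by positivity
    linarith
  have T3 : |σ ^ 2 / 8 * (2 * (g1 * f1) + k1 * k1)| ≤ σ ^ 4 * (2 * L ^ 5) := by
    rw [abs_mul, abs_of_pos (by positivity : 0 < σ ^ 2 / 8)]
    have : |2 * (g1 * f1) + k1 * k1| ≤ σ ^ 2 * (12 * L ^ 5) := by
      have : σ ^ 2 * (4 * L ^ 4) ≤ σ ^ 2 * (4 * L ^ 5) := by gcongr
      rw [abs_le] at *
      constructor <;> linarith
    calc σ ^ 2 / 8 * |2 * (g1 * f1) + k1 * k1| ≤ σ ^ 2 / 8 * (σ ^ 2 * (12 * L ^ 5)) := by gcongr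
      _ ≤ _ := by have : 0 ≤ σ ^ 4 * L ^ 5 := by positivity
                  linarith
  have : 0 ≤ σ ^ 4 * L ^ 5 := by positivity
  clear h1 h2 h3 h4 b1 b2 b3 bc B0 B1 B2 C1 C2 C3 bd hu hd hz
  rw [abs_le] at *
  constructor <;> linarith

/-- A polynomial weight controlling one coordinate of the chain, uniformly for `σ ≤ 1`. -/
lemma exists_dominating_weight (hg : RegularPotential g) (alg : Algorithm) :
    ∃ (C : ℝ) (k : ℕ), 1 ≤ C ∧ ∀ p : ℝ × ℝ,
      |p.1| ≤ C * weight p ^ k ∧ |p.2| ≤ C * weight p ^ k ∧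
      |drift alg g p.1| ≤ C * weight p ^ k ∧ |lead alg g p| ≤ C * weight p ^ k ∧
      ∀ σ, 0 < σ → σ ≤ 1 → |logRatio alg g σ p - σ ^ alg.order * lead alg g p|
        ≤ σ ^ (alg.order + 1) * (C * weight p ^ k) := by
  obtain ⟨C, m, hC, hb⟩ := hg.exists_growth_le 4
  have C0 : 0 < C := by linarith
  have hlow : ∀ p : ℝ × ℝ, weight p ≤ 3 * C * weight p ^ (m + 1) := fun p => by
    have := one_le_weight p
    calc weight p = 1 * weight p ^ 1 := by ring
      _ ≤ 3 * C * weight p ^ (m + 1) := by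
        gcongr
        · linarith
        · omega
  have hu : ∀ p : ℝ × ℝ, |iteratedDeriv 1 g p.1| ≤ C * weight p ^ m := fun p => by
    refine (hb 1 (by norm_num) p.1).trans ?_
    have := abs_nonneg p.1
    have h2 := abs_nonneg p.2
    unfold weight
    have : 1 + |p.1| ≤ 1 + |p.1| + |p.2| := by linarith
    gcongr
  have hdr : ∀ p : ℝ × ℝ, |drift alg g p.1| ≤ C * weight p ^ m := fun p => by
    have h := hu p
    have h' := (abs_nonneg _).trans h
    have := abs_nonneg (iteratedDeriv 1 g p.1)
    cases alg
    · simpa [drift] using h'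
    · simp only [drift]
      rw [abs_div, abs_neg, abs_two]; linarith
  -- The whole segment travelled stays in a region of polynomial size in the weight, uniformly in `σ
  -- ≤ 1`; hence the derivatives along it are polynomially bounded as well.
  have hmove : ∀ (p : ℝ × ℝ) σ, 0 < σ → σ ≤ 1 → ∀ x ∈ Set.uIcc p.1 (move alg g σ p),
      1 + |x| ≤ 3 * C * weight p ^ (m + 1) := by
    intro p σ h0 h1 x hx
    have w1 := one_le_weight p
    have e1 : |x - p.1| ≤ |move alg g σ p - p.1| := Set.abs_sub_left_of_mem_uIcc hx
    have e2 : |move alg g σ p - p.1| ≤ C * weight p ^ m + |p.2| := by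
      have : move alg g σ p - p.1 = σ ^ 2 * drift alg g p.1 + σ * p.2 := by unfold move; ring
      rw [this]
      refine (abs_add_le _ _).trans (add_le_add ?_ ?_)
      · rw [abs_mul, abs_of_pos (pow_pos h0 2)]
        calc σ ^ 2 * |drift alg g p.1| ≤ 1 * (C * weight p ^ m) := by
              gcongr
              · exact pow_le_one₀ h0.le h1
              · exact hdr p
          _ = _ := one_mul _
      · rw [abs_mul, abs_of_pos h0]
        exact mul_le_of_le_one_left (abs_nonneg _) h1
    have e3 : |x| ≤ |p.1| + |x - p.1| := by
      calc |x| = |p.1 + (x - p.1)| := by ring_nf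
        _ ≤ _ := abs_add_le _ _
    have e4 : 1 + |p.1| + |p.2| = weight p := rfl
    have e5 : weight p ≤ C * weight p ^ (m + 1) := by
      calc weight p = 1 * weight p ^ 1 := by ring
        _ ≤ C * weight p ^ (m + 1) := by
          gcongr
          omega
    have e6 : C * weight p ^ m ≤ C * weight p ^ (m + 1) := by
      gcongr
      · omega
    have : 0 ≤ C * weight p ^ (m + 1) := by positivity
    linarith
  set L : ℝ × ℝ → ℝ := fun p => C * (3 * C * weight p ^ (m + 1)) ^ (m + 1) with hLdef
  have hL3 : ∀ p, 1 ≤ 3 * C * weight p ^ (m + 1) := fun p => (one_le_weight p).trans (hlow p)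
  have hLw : ∀ p, weight p ≤ L p := fun p => by
    have h3 := hL3 p
    calc weight p ≤ 3 * C * weight p ^ (m + 1) := hlow p
      _ = 1 * (3 * C * weight p ^ (m + 1)) ^ 1 := by ring
      _ ≤ _ := by
        simp only [hLdef]
        gcongr
        omega
  have hL1 : ∀ p, 1 ≤ L p := fun p => (one_le_weight p).trans (hLw p)
  have hz : ∀ p : ℝ × ℝ, |p.2| ≤ L p := fun p => by
    refine le_trans ?_ (hLw p)
    have := abs_nonneg p.1
    unfold weight; linarith
  have hu' : ∀ p : ℝ × ℝ, |p.1| ≤ L p := fun p => by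
    refine le_trans ?_ (hLw p)
    have := abs_nonneg p.2
    unfold weight; linarith
  have hdL : ∀ p σ, 0 < σ → σ ≤ 1 → ∀ x ∈ Set.uIcc p.1 (move alg g σ p), ∀ j ≤ 4,
      |iteratedDeriv j g x| ≤ L p := fun p σ h0 h1 x hx j hj => by
    refine (hb j hj x).trans ?_
    have := hmove p σ h0 h1 x hx
    have h3 := hL3 p
    have := abs_nonneg x
    calc C * (1 + |x|) ^ m ≤ C * (3 * C * weight p ^ (m + 1)) ^ m := by gcongr
      _ ≤ _ := by
        simp only [hLdef]
        gcongr
        omega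
  have hdu : ∀ p : ℝ × ℝ, ∀ j ≤ 4, |iteratedDeriv j g p.1| ≤ L p := fun p =>
    hdL p 1 one_pos le_rfl _ Set.left_mem_uIcc
  -- The final weight is `40 L^5`, the largest factor that occurs, namely the one in the P-SLA
  -- remainder; it is rewritten as a constant times a power of the weight.
  have h5 : ∀ p, 40 * L p ^ 5 =
      40 * (C * (3 * C) ^ (m + 1)) ^ 5 * weight p ^ ((m + 1) * (m + 1) * 5) := fun p => by
    simp only [hLdef]
    rw [mul_pow (3 * C), ← mul_assoc C, mul_pow, ← pow_mul, ← pow_mul]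
    ring
  have hfin : ∀ p, L p ≤ 40 * L p ^ 5 := fun p => by
    have : L p ^ 1 ≤ L p ^ 5 := pow_le_pow_right₀ (hL1 p) (by norm_num)
    have := hL1 p
    linarith [pow_one (L p)]
  refine ⟨40 * (C * (3 * C) ^ (m + 1)) ^ 5, (m + 1) * (m + 1) * 5, ?_, fun p => ?_⟩
  · have : 1 ≤ C * (3 * C) ^ (m + 1) :=
      one_le_mul_of_one_le_of_one_le hC (one_le_pow₀ (by linarith))
    have := one_le_pow₀ this (n := 5)
    linarith
  rw [← h5]
  have L0 : 0 < L p := by linarith [hL1 p]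
  have L1 := hL1 p
  refine ⟨(hu' p).trans (hfin p), (hz p).trans (hfin p), ?_, ?_, fun σ h0 h1 => ?_⟩
  · refine le_trans ?_ (hfin p)
    cases alg
    · simpa [drift] using L0.le
    · have h := hdu p 1 (by norm_num)
      have := abs_nonneg (iteratedDeriv 1 g p.1)
      simp only [drift]
      rw [abs_div, abs_neg, abs_two]; linarith
  · have b1 := hdu p 1 (by norm_num)
    have b2 := hdu p 2 (by norm_num)
    have b3 := hdu p 3 (by norm_num)
    have q2 : L p ^ 2 ≤ L p ^ 5 := pow_le_pow_right₀ L1 (by norm_num)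
    have q3 : L p ^ 3 ≤ L p ^ 5 := pow_le_pow_right₀ L1 (by norm_num)
    have q4 : L p ^ 4 ≤ L p ^ 5 := pow_le_pow_right₀ L1 (by norm_num)
    have q0 : 0 < L p ^ 5 := by positivity
    cases alg
    · simp only [lead, abs_neg]
      refine (abs_mul_le_mul (hz p) b1).trans ?_
      nlinarith
    · simp only [lead]
      have c1 : |p.2 ^ 3 * iteratedDeriv 3 g p.1| ≤ L p ^ 5 := by
        refine le_trans (abs_mul_le_mul (A := L p ^ 3) ?_ b3) (le_trans (by ring_nf; rfl) q4)
        rw [abs_pow]; gcongr; exact hz p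
      have c2 : |p.2 * (iteratedDeriv 1 g p.1 * iteratedDeriv 2 g p.1)| ≤ L p ^ 5 :=
        (abs_mul_le_mul (hz p) (abs_mul_le_mul b1 b2)).trans (le_trans (by ring_nf; rfl) q3)
      rw [abs_le] at c1 c2 ⊢
      constructor <;> linarith
  · cases alg
    · refine (abs_logRatio_pRWM_sub_le hg h0 L1 (hz p) (hdL p σ h0 h1)).trans ?_
      simp only [Algorithm.order]
      have q3 : L p ^ 3 ≤ L p ^ 5 := pow_le_pow_right₀ L1 (by norm_num)
      have q0 : 0 < L p ^ 5 := by positivity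
      gcongr
      linarith
    · exact abs_logRatio_pSLA_sub_le hg h0 h1 L1 (hz p) (hdL p σ h0 h1)

end

/-! ### The constant `K`: second moment of the leading coefficient, and its positivity. -/

section

lemma integrable_pow_gaussianReal (k : ℕ) : Integrable (fun z : ℝ => z ^ k) (gaussianReal 0 1) := by
  have h2 : Integrable (fun u : ℝ => ‖u‖ ^ k) (gaussianReal 0 1) := by
    simpa using (memLp_id_gaussianReal (μ := 0) (v := 1) (k : NNReal)).integrable_norm_pow'
  exact h2.mono' (by fun_prop) (ae_of_all _ fun z => by simp)

lemma integrable_gaussianPDFReal_mul_pow (k : ℕ) :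
    Integrable fun z : ℝ => gaussianPDFReal 0 1 z * z ^ k := by
  have h := integrable_pow_gaussianReal k
  rw [gaussianReal_of_var_ne_zero 0 one_ne_zero, integrable_withDensity_iff
    (measurable_gaussianPDF 0 1) (ae_of_all _ fun _ => gaussianPDF_lt_top)] at h
  refine h.congr (ae_of_all _ fun z => ?_)
  simp only [toReal_gaussianPDF]; ring

/-- The recursion for the moments of the standard normal law. -/
lemma integral_pow_add_two_gaussianReal (k : ℕ) :
    ∫ z : ℝ, z ^ (k + 2) ∂(gaussianReal 0 1) = (k + 1) * ∫ z : ℝ, z ^ k ∂(gaussianReal 0 1) := by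
  -- Gaussian integration by parts: the integral of this derivative over the line vanishes.
  have hd : ∀ z : ℝ, HasDerivAt (fun z => gaussianPDFReal 0 1 z * z ^ (k + 1))
      ((k + 1) * (gaussianPDFReal 0 1 z * z ^ k) - gaussianPDFReal 0 1 z * z ^ (k + 2)) z := by
    intro z
    have h1 : HasDerivAt (gaussianPDFReal 0 1) (-z * gaussianPDFReal 0 1 z) z := by
      have h : HasDerivAt (fun x : ℝ => -(x - 0) ^ 2 / (2 * ((1 : NNReal) : ℝ))) (-z) z := by
        have := ((((hasDerivAt_id z).sub_const (0 : ℝ)).fun_pow 2).fun_neg).div_const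
          (2 * ((1 : NNReal) : ℝ))
        exact this.congr_deriv (by simp; ring)
      have := (h.exp).const_mul (√(2 * Real.pi * ((1 : NNReal) : ℝ)))⁻¹
      exact this.congr_deriv (by simp only [gaussianPDFReal]; ring)
    exact (h1.fun_mul (hasDerivAt_pow (k + 1) z)).congr_deriv
      (by simp only [Nat.add_sub_cancel]; push_cast; ring)
  have hi := integrable_gaussianPDFReal_mul_pow
  have h0 := integral_eq_zero_of_hasDerivAt_of_integrable hd
    (((hi k).const_mul _).sub (hi (k + 2))) (hi (k + 1))
  rw [integral_sub ((hi k).const_mul _) (hi (k + 2)), integral_const_mul] at h0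
  simp only [integral_gaussianReal_eq_integral_smul one_ne_zero, smul_eq_mul]
  linarith

lemma integral_sq_gaussianReal : ∫ z : ℝ, z ^ 2 ∂(gaussianReal 0 1) = 1 := by
  simpa using integral_pow_add_two_gaussianReal 0

lemma integral_pow_four_gaussianReal : ∫ z : ℝ, z ^ 4 ∂(gaussianReal 0 1) = 3 := by
  rw [integral_pow_add_two_gaussianReal 2, integral_sq_gaussianReal]; norm_num

lemma integral_pow_six_gaussianReal : ∫ z : ℝ, z ^ 6 ∂(gaussianReal 0 1) = 15 := by
  rw [integral_pow_add_two_gaussianReal 4, integral_pow_four_gaussianReal]; norm_num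

/-- Continuous functions of polynomial growth. -/
def PolyGrowth (F : ℝ → ℝ) : Prop :=
  Continuous F ∧ ∃ (C : ℝ) (m : ℕ), ∀ u, |F u| ≤ C * (1 + |u|) ^ m

lemma PolyGrowth.mul {F G : ℝ → ℝ} (hF : PolyGrowth F) (hG : PolyGrowth G) :
    PolyGrowth fun u => F u * G u := by
  obtain ⟨cF, C, m, h⟩ := hF
  obtain ⟨cG, C', m', h'⟩ := hG
  refine ⟨cF.mul cG, C * C', m + m', fun u => (abs_mul_le_mul (h u) (h' u)).trans_eq ?_⟩
  ring

lemma PolyGrowth.pow {F : ℝ → ℝ} (hF : PolyGrowth F) (k : ℕ) : PolyGrowth fun u => F u ^ k := by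
  obtain ⟨cF, C, m, h⟩ := hF
  refine ⟨cF.pow k, C ^ k, m * k, fun u => ?_⟩
  rw [abs_pow, pow_mul, ← mul_pow]
  gcongr; exact h u

namespace RegularPotential

variable {g : ℝ → ℝ} {alg : Algorithm}

lemma polyGrowth_iteratedDeriv (hg : RegularPotential g) (j : ℕ) :
    PolyGrowth (iteratedDeriv j g) := by
  obtain ⟨C, m, -, h⟩ := hg.exists_growth_le j
  exact ⟨hg.continuous_iteratedDeriv j, C, m, h j le_rfl⟩

lemma integrable_of_polyGrowth (hg : RegularPotential g) {F : ℝ → ℝ} (hF : PolyGrowth F) :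
    Integrable F (marginal g) := by
  obtain ⟨cF, C, m, h⟩ := hF
  have hp := hg.integrable_weight_pow m
  have := hg.isProbabilityMeasure_marginal
  have h2 : Integrable (fun p : ℝ × ℝ => F p.1) (pairLaw g) := by
    refine (hp.const_mul |C|).mono' (cF.comp continuous_fst).aestronglyMeasurable
      (ae_of_all _ fun p => (h p.1).trans ?_)
    have h2 := abs_nonneg p.2
    have h1 := abs_nonneg p.1
    have : 1 + |p.1| ≤ weight p := by unfold weight; linarith
    have := le_abs_self C
    have := abs_nonneg C
    gcongr
  have h3 : (pairLaw g).map Prod.fst = marginal g := by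
    unfold pairLaw; rw [Measure.map_fst_prod]; simp
  rw [← h3, integrable_map_measure cF.aestronglyMeasurable measurable_fst.aemeasurable]
  exact h2

end RegularPotential

/-- The mean of `lead ^ 2` over the noise. -/
def leadSq (alg : Algorithm) (g : ℝ → ℝ) (u : ℝ) : ℝ :=
  match alg with
  | .pRWM => iteratedDeriv 1 g u ^ 2
  | .pSLA => 15 / 144 * iteratedDeriv 3 g u ^ 2
      - 1 / 8 * (iteratedDeriv 1 g u * (iteratedDeriv 2 g u * iteratedDeriv 3 g u))
      + 1 / 16 * (iteratedDeriv 1 g u ^ 2 * iteratedDeriv 2 g u ^ 2)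

namespace RegularPotential

variable {g : ℝ → ℝ} {alg : Algorithm}

/-- Noise and coordinate are independent, so the square is expanded and the Gaussian moments 1, 3,
15 of orders 2, 4, 6 are inserted. -/
lemma integral_lead_sq_eq (hg : RegularPotential g) :
    ∫ p, lead alg g p ^ 2 ∂(pairLaw g) = ∫ u, leadSq alg g u ∂(marginal g) := by
  have := hg.isProbabilityMeasure_marginal
  have P := hg.polyGrowth_iteratedDeriv
  have prod : ∀ (F : ℝ → ℝ) (k : ℕ), ∫ p : ℝ × ℝ, F p.1 * p.2 ^ k ∂(pairLaw g)
      = (∫ u, F u ∂(marginal g)) * ∫ z : ℝ, z ^ k ∂(gaussianReal 0 1) := fun F k =>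
    integral_prod_mul F (fun z => z ^ k)
  have iprod : ∀ (F : ℝ → ℝ) (k : ℕ), PolyGrowth F →
      Integrable (fun p : ℝ × ℝ => F p.1 * p.2 ^ k) (pairLaw g) := fun F k hF =>
    (hg.integrable_of_polyGrowth hF).mul_prod (integrable_pow_gaussianReal k)
  cases alg
  · have : ∀ p : ℝ × ℝ, lead .pRWM g p ^ 2 = iteratedDeriv 1 g p.1 ^ 2 * p.2 ^ 2 := fun p => by
      simp only [lead]; ring
    simp_rw [this, leadSq]
    rw [prod (fun u => iteratedDeriv 1 g u ^ 2), integral_sq_gaussianReal, mul_one]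
  · have : ∀ p : ℝ × ℝ, lead .pSLA g p ^ 2 =
        1 / 144 * (iteratedDeriv 3 g p.1 ^ 2 * p.2 ^ 6)
        - 1 / 24 * (iteratedDeriv 1 g p.1 * (iteratedDeriv 2 g p.1 * iteratedDeriv 3 g p.1)
          * p.2 ^ 4)
        + 1 / 16 * (iteratedDeriv 1 g p.1 ^ 2 * iteratedDeriv 2 g p.1 ^ 2 * p.2 ^ 2) := fun p => by
      simp only [lead]; ring
    simp_rw [this, leadSq]
    have a1 := iprod _ 6 ((P 3).pow 2)
    have a2 := iprod _ 4 ((P 1).mul ((P 2).mul (P 3)))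
    have a3 := iprod _ 2 (((P 1).pow 2).mul ((P 2).pow 2))
    rw [integral_add ((a1.const_mul _).sub' (a2.const_mul _)) (a3.const_mul _),
      integral_sub (a1.const_mul _) (a2.const_mul _), integral_const_mul, integral_const_mul,
      integral_const_mul, prod (fun u => iteratedDeriv 3 g u ^ 2),
      prod (fun u => iteratedDeriv 1 g u * (iteratedDeriv 2 g u * iteratedDeriv 3 g u)),
      prod (fun u => iteratedDeriv 1 g u ^ 2 * iteratedDeriv 2 g u ^ 2), integral_sq_gaussianReal,
      integral_pow_four_gaussianReal, integral_pow_six_gaussianReal]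
    have b1 := hg.integrable_of_polyGrowth ((P 3).pow 2)
    have b2 := hg.integrable_of_polyGrowth ((P 1).mul ((P 2).mul (P 3)))
    have b3 := hg.integrable_of_polyGrowth (((P 1).pow 2).mul ((P 2).pow 2))
    rw [integral_add ((b1.const_mul _).sub' (b2.const_mul _)) (b3.const_mul _),
      integral_sub (b1.const_mul _) (b2.const_mul _), integral_const_mul, integral_const_mul,
      integral_const_mul]
    ring

/-- For P-SLA the two expressions differ by an integration by parts: the derivative of `g' (g'')^2
exp (-g)` has integral zero, and one sixteenth of this relation trades the terms with `g'` for
`(g'')^3 / 16`. -/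
lemma roughness_eq (hg : RegularPotential g) :
    roughness alg g = ∫ u, leadSq alg g u ∂(marginal g) := by
  have P := hg.polyGrowth_iteratedDeriv
  cases alg
  · simp only [roughness, leadSq, hg.integral_marginal, iteratedDeriv_one]
  · have i1 := hg.integrable_of_polyGrowth ((P 3).pow 2)
    have i2 := hg.integrable_of_polyGrowth ((P 1).mul ((P 2).mul (P 3)))
    have i3 := hg.integrable_of_polyGrowth (((P 1).pow 2).mul ((P 2).pow 2))
    have i4 := hg.integrable_of_polyGrowth ((P 2).pow 3)
    have i5 := hg.integrable_of_polyGrowth ((P 1).mul ((P 2).pow 2))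
    have parts : ∫ u, (iteratedDeriv 2 g u ^ 3
        + 2 * (iteratedDeriv 1 g u * (iteratedDeriv 2 g u * iteratedDeriv 3 g u))
        - iteratedDeriv 1 g u ^ 2 * iteratedDeriv 2 g u ^ 2) ∂(marginal g) = 0 := by
      rw [hg.integral_marginal]
      refine integral_eq_zero_of_hasDerivAt_of_integrable
        (f := fun u => iteratedDeriv 1 g u * iteratedDeriv 2 g u ^ 2 * Real.exp (-g u))
        (fun u => ?_) ((hg.integrable_marginal_iff _).1 ((i4.fun_add (i2.const_mul 2)).sub i3))
        ((hg.integrable_marginal_iff _).1 i5)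
      have := ((hg.hasDerivAt_iteratedDeriv 1 u).fun_mul
        ((hg.hasDerivAt_iteratedDeriv 2 u).fun_pow 2)).fun_mul ((hg.hasDerivAt u).fun_neg.exp)
      exact this.congr_deriv (by push_cast; ring)
    rw [integral_sub (i4.fun_add (i2.const_mul 2)) i3, integral_add i4 (i2.const_mul 2),
      integral_const_mul] at parts
    simp only [roughness, leadSq]
    rw [← hg.integral_marginal fun u => 3 * iteratedDeriv 2 g u ^ 3 + 5 * iteratedDeriv 3 g u ^ 2,
      integral_add (i4.const_mul _) (i1.const_mul _),
      integral_add ((i1.const_mul _).sub' (i2.const_mul _)) (i3.const_mul _),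
      integral_sub (i1.const_mul _) (i2.const_mul _)]
    simp only [integral_const_mul]
    linarith

lemma integral_lead_sq (hg : RegularPotential g) :
    ∫ p, lead alg g p ^ 2 ∂(pairLaw g) = roughness alg g :=
  hg.integral_lead_sq_eq.trans hg.roughness_eq.symm

/-- The potential of a probability density on the line is not affine. -/
lemma not_deriv_const (hg : RegularPotential g) (b : ℝ) : ¬ ∀ u, iteratedDeriv 1 g u = b := by
  intro h
  have hlin : ∀ u, g u = g 0 + b * u := by
    intro u
    have hd : ∀ x, HasDerivAt (fun x => g x - b * x) 0 x := fun x => by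
      have := (hg.hasDerivAt x).fun_sub ((hasDerivAt_id x).const_mul b)
      exact this.congr_deriv (by rw [h x]; ring)
    have := is_const_of_deriv_eq_zero (fun x => (hd x).differentiableAt) (fun x => (hd x).deriv) u 0
    simp only [mul_zero, sub_zero] at this
    linarith
  -- An affine potential is at most `g 0` on a half-line, which has infinite measure, against the
  -- integrability of `exp (-g)`.
  have hfin := hg.integrable_exp.measure_ge_lt_top (ε := Real.exp (-g 0)) (Real.exp_pos _)
  rcases le_total 0 b with hb | hb
  · have : (⊤ : ENNReal) ≤ volume {u : ℝ | Real.exp (-g 0) ≤ Real.exp (-g u)} := by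
      rw [← Real.volume_Iic (a := 0)]
      refine measure_mono fun u hu => ?_
      simp only [Set.mem_Iic] at hu
      simp only [Set.mem_ofPred_eq, Real.exp_le_exp, hlin u]
      nlinarith
    exact absurd hfin (not_lt.2 this)
  · have : (⊤ : ENNReal) ≤ volume {u : ℝ | Real.exp (-g 0) ≤ Real.exp (-g u)} := by
      rw [← Real.volume_Ici (a := 0)]
      refine measure_mono fun u hu => ?_
      simp only [Set.mem_Ici] at hu
      simp only [Set.mem_ofPred_eq, Real.exp_le_exp, hlin u]
      nlinarith
    exact absurd hfin (not_lt.2 this)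

/-- For P-SLA this is a positive definite quadratic form in `g'''` and `g' g''`. The integrand
defining `K` shows no such sign, because `(g'')^3` may be negative. -/
lemma leadSq_nonneg (u : ℝ) : 0 ≤ leadSq alg g u := by
  cases alg
  · exact sq_nonneg _
  · simp only [leadSq]
    nlinarith [sq_nonneg (iteratedDeriv 3 g u * (15 / 9)
      - iteratedDeriv 1 g u * iteratedDeriv 2 g u), sq_nonneg (iteratedDeriv 3 g u),
      sq_nonneg (iteratedDeriv 1 g u * iteratedDeriv 2 g u)]

/-- If `K` vanished, the continuous nonnegative integrand would vanish identically. That forces `g'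
= 0` for P-RWM, and `g''' = 0` together with `g' g'' = 0` for P-SLA; in either case `g'` is
constant, which no probability density allows. -/
lemma roughness_pos (hg : RegularPotential g) : 0 < roughness alg g := by
  have P := hg.polyGrowth_iteratedDeriv
  rw [hg.roughness_eq]
  have c1 := hg.continuous_iteratedDeriv 1
  have c2 := hg.continuous_iteratedDeriv 2
  have c3 := hg.continuous_iteratedDeriv 3
  have hc : Continuous (leadSq alg g) := by
    cases alg <;> unfold leadSq <;> fun_prop
  have hi : Integrable (leadSq alg g) (marginal g) := by
    cases alg
    · exact hg.integrable_of_polyGrowth ((P 1).pow 2)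
    · have i1 := hg.integrable_of_polyGrowth ((P 3).pow 2)
      have i2 := hg.integrable_of_polyGrowth ((P 1).mul ((P 2).mul (P 3)))
      have i3 := hg.integrable_of_polyGrowth (((P 1).pow 2).mul ((P 2).pow 2))
      exact ((i1.const_mul _).sub (i2.const_mul _)).add (i3.const_mul _)
  rw [hg.integrable_marginal_iff] at hi
  rw [hg.integral_marginal]
  have hnn : ∀ u, 0 ≤ leadSq alg g u * Real.exp (-g u) := fun u =>
    mul_nonneg (leadSq_nonneg u) (Real.exp_pos _).le
  refine lt_of_le_of_ne (integral_nonneg hnn) fun h0 => ?_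
  have hz := (integral_eq_zero_iff_of_nonneg hnn hi).1 h0.symm
  have hgc := hg.continuous
  have hz' : (fun u => leadSq alg g u * Real.exp (-g u)) = 0 :=
    (Continuous.ae_eq_iff_eq volume (hc.mul (by fun_prop)) continuous_zero).1 hz
  have hzero : ∀ u, leadSq alg g u = 0 := fun u => by
    have := congr_fun hz' u
    simpa [(Real.exp_pos _).ne'] using this
  cases alg
  · exact hg.not_deriv_const 0 fun u => by simpa [leadSq] using hzero u
  · have h3 : ∀ u, iteratedDeriv 3 g u = 0 := fun u => by
      have := hzero u
      simp only [leadSq] at this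
      have : iteratedDeriv 3 g u ^ 2 ≤ 0 := by
        nlinarith [sq_nonneg (iteratedDeriv 3 g u - iteratedDeriv 1 g u * iteratedDeriv 2 g u)]
      exact pow_eq_zero_iff (two_ne_zero) |>.1 (le_antisymm this (sq_nonneg _))
    have h12 : ∀ u, iteratedDeriv 1 g u * iteratedDeriv 2 g u = 0 := fun u => by
      have := hzero u
      simp only [leadSq, h3] at this
      have : (iteratedDeriv 1 g u * iteratedDeriv 2 g u) ^ 2 = 0 := by linarith
      exact pow_eq_zero_iff (two_ne_zero) |>.1 this
    have h2 : ∀ u, iteratedDeriv 2 g u = iteratedDeriv 2 g 0 := fun u =>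
      is_const_of_deriv_eq_zero (fun x => (hg.hasDerivAt_iteratedDeriv 2 x).differentiableAt)
        (fun x => (hg.hasDerivAt_iteratedDeriv 2 x).deriv.trans (h3 x)) u 0
    by_cases hc0 : iteratedDeriv 2 g 0 = 0
    · refine hg.not_deriv_const (iteratedDeriv 1 g 0) fun u =>
        is_const_of_deriv_eq_zero (fun x => (hg.hasDerivAt_iteratedDeriv 1 x).differentiableAt)
          (fun x => (hg.hasDerivAt_iteratedDeriv 1 x).deriv.trans ((h2 x).trans hc0)) u 0
    · refine hg.not_deriv_const 0 fun u => ?_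
      have := h12 u
      rw [h2 u] at this
      exact (mul_eq_zero.1 this).resolve_right hc0

end RegularPotential

end

/-! ### Reversibility, and second order asymptotics for one coordinate. -/

section

variable {g : ℝ → ℝ} {alg : Algorithm}

/-- Expectations under one proposal step, as integrals against the joint Lebesgue density. -/
lemma RegularPotential.lintegral_move (hg : RegularPotential g) {σ : ℝ} (hσ : 0 < σ)
    {F : ℝ → ℝ → ENNReal} (hF : Measurable (Function.uncurry F)) :
    ∫⁻ p, F p.1 (move alg g σ p) ∂(pairLaw g) =
      ENNReal.ofReal (√(2 * Real.pi * σ ^ 2))⁻¹ *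
        ∫⁻ u, ∫⁻ v, F u v * ENNReal.ofReal (Real.exp (logKernel alg g σ u v)) := by
  have hm := (hg.continuous_move (alg := alg) σ).measurable
  have hgm := hg.continuous.measurable
  have hFm : Measurable fun p : ℝ × ℝ => F p.1 (move alg g σ p) :=
    hF.comp (measurable_fst.prodMk hm)
  have hkm : Measurable fun p : ℝ × ℝ =>
      F p.1 p.2 * ENNReal.ofReal (Real.exp (logKernel alg g σ p.1 p.2)) := by
    have := (hg.continuous_logKernel (alg := alg) σ).measurable
    exact hF.mul (by fun_prop)
  have hke : ∀ u, Measurable fun v => ENNReal.ofReal (Real.exp (logKernel alg g σ u v)) :=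
    fun u => ((hg.continuous_logKernel (alg := alg) σ).measurable.comp
      measurable_prodMk_left).exp.ennreal_ofReal
  have hFk : ∀ u, Measurable fun v => F u v * ENNReal.ofReal (Real.exp (logKernel alg g σ u v)) :=
    fun u => (hF.comp measurable_prodMk_left).mul (hke u)
  have hv : Real.toNNReal (σ ^ 2) ≠ 0 := by
    simp [Real.toNNReal_eq_zero, hσ.ne']
  have hvc : (Real.toNNReal (σ ^ 2) : ℝ) = σ ^ 2 := Real.coe_toNNReal _ (by positivity)
  unfold pairLaw marginal
  rw [lintegral_prod _ hFm.aemeasurable,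
    lintegral_withDensity_eq_lintegral_mul _ (by fun_prop) hFm.lintegral_prod_right',
    ← lintegral_const_mul _ hkm.lintegral_prod_right']
  refine lintegral_congr fun u => ?_
  have hmap : gaussianReal (u + σ ^ 2 * drift alg g u) (Real.toNNReal (σ ^ 2)) =
      (gaussianReal 0 1).map fun z => move alg g σ (u, z) := by
    have : (fun z => move alg g σ (u, z)) =
        (fun x => (u + σ ^ 2 * drift alg g u) + x) ∘ fun z => σ * z := rfl
    rw [this, ← Measure.map_map (by fun_prop) (by fun_prop), gaussianReal_map_const_mul,
      gaussianReal_map_const_add, mul_zero, zero_add, mul_one]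
    congr 1
    ext; simp [hvc]
  have hFu : Measurable (F u) := hF.comp (measurable_const.prodMk measurable_id)
  have e1 : ∫⁻ z, F u (move alg g σ (u, z)) ∂(gaussianReal 0 1) =
      ∫⁻ v, F u v ∂(gaussianReal (u + σ ^ 2 * drift alg g u) (Real.toNNReal (σ ^ 2))) := by
    have hmu : Measurable fun z => move alg g σ (u, z) := hm.comp measurable_prodMk_left
    rw [hmap, lintegral_map hFu hmu]
  simp only [Pi.mul_apply]
  rw [e1, gaussianReal_of_var_ne_zero _ hv,
    lintegral_withDensity_eq_lintegral_mul _ (measurable_gaussianPDF _ _) hFu,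
    ← lintegral_const_mul _ (by fun_prop), ← lintegral_const_mul _
      (hFk u)]
  refine lintegral_congr fun v => ?_
  simp only [Pi.mul_apply, gaussianPDF, gaussianPDFReal, hvc, logKernel]
  rw [sub_eq_add_neg (-g u), Real.exp_add, ENNReal.ofReal_mul (by positivity),
    ENNReal.ofReal_mul (by positivity), neg_div]
  ring

/-- Reversibility of the proposal pair under exchange of its two ends. -/
lemma RegularPotential.lintegral_logRatio (hg : RegularPotential g) {σ : ℝ} (hσ : 0 < σ)
    {H : ℝ → ENNReal} (hH : Measurable H) :
    ∫⁻ p, H (logRatio alg g σ p) ∂(pairLaw g) =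
      ∫⁻ p, H (-logRatio alg g σ p) * ENNReal.ofReal (Real.exp (logRatio alg g σ p))
        ∂(pairLaw g) := by
  have hk := (hg.continuous_logKernel (alg := alg) σ).measurable
  have hk' : Measurable fun p : ℝ × ℝ => logKernel alg g σ p.2 p.1 := hk.comp measurable_swap
  have m1 : Measurable (Function.uncurry fun u v : ℝ =>
      H (logKernel alg g σ v u - logKernel alg g σ u v)) := hH.comp (hk'.sub hk)
  have m2 : Measurable (Function.uncurry fun u v : ℝ =>
      H (-(logKernel alg g σ v u - logKernel alg g σ u v)) *
        ENNReal.ofReal (Real.exp (logKernel alg g σ v u - logKernel alg g σ u v))) :=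
    (hH.comp (hk'.sub hk).neg).mul (hk'.sub hk).exp.ennreal_ofReal
  have e1 := hg.lintegral_move (alg := alg) hσ m1
  have e2 := hg.lintegral_move (alg := alg) hσ m2
  unfold logRatio
  rw [e1, e2]
  congr 1
  -- After `u` and `v` are exchanged, `exp R` turns the density of the move from `u` to `v` into
  -- that of the reverse move, while `R` changes sign.
  rw [lintegral_lintegral_swap]
  · refine lintegral_congr fun u => lintegral_congr fun v => ?_
    rw [mul_assoc, ← ENNReal.ofReal_mul (Real.exp_pos _).le, ← Real.exp_add, neg_sub,
      sub_add_cancel]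
  · exact (m1.mul hk.exp.ennreal_ofReal).aemeasurable

/-- Signed `H` need no integrability here: the nonnegative case already says that the law of `R` is
the image under negation of its tilt by `exp R`. -/
lemma RegularPotential.integral_logRatio (hg : RegularPotential g) {σ : ℝ} (hσ : 0 < σ)
    {H : ℝ → ℝ} (hH : Measurable H) :
    ∫ p, H (logRatio alg g σ p) ∂(pairLaw g) =
      ∫ p, H (-logRatio alg g σ p) * Real.exp (logRatio alg g σ p) ∂(pairLaw g) := by
  have hr := (hg.continuous_logRatio (alg := alg) σ).measurable
  have hr' : Measurable fun p => -logRatio alg g σ p := hr.neg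
  have key : (pairLaw g).map (logRatio alg g σ) =
      ((pairLaw g).withDensity fun p => ((Real.exp (logRatio alg g σ p)).toNNReal : ENNReal)).map
        fun p => -logRatio alg g σ p := by
    refine Measure.ext_of_lintegral _ fun f hf => ?_
    have hfr : Measurable fun p => f (-logRatio alg g σ p) := hf.comp hr'
    rw [lintegral_map hf hr, lintegral_map hf hr', hg.lintegral_logRatio hσ hf,
      lintegral_withDensity_eq_lintegral_mul _ (by fun_prop) hfr]
    refine lintegral_congr fun p => ?_
    rw [mul_comm]; rfl
  rw [← integral_map hr.aemeasurable hH.aestronglyMeasurable, key,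
    integral_map hr'.aemeasurable hH.aestronglyMeasurable,
    integral_withDensity_eq_integral_smul (by fun_prop)]
  refine integral_congr_ae (ae_of_all _ fun p => ?_)
  simp [NNReal.smul_def, Real.coe_toNNReal _ (Real.exp_pos _).le, mul_comm]

lemma RegularPotential.lintegral_exp_logRatio (hg : RegularPotential g) {σ : ℝ} (hσ : 0 < σ) :
    ∫⁻ p, ENNReal.ofReal (Real.exp (logRatio alg g σ p)) ∂(pairLaw g) = 1 := by
  have := hg.isProbabilityMeasure_pairLaw
  simpa using (hg.lintegral_logRatio (alg := alg) hσ (H := fun _ => 1) measurable_const).symm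

lemma RegularPotential.integrable_exp_logRatio (hg : RegularPotential g) {σ : ℝ} (hσ : 0 < σ) :
    Integrable (fun p => Real.exp (logRatio alg g σ p)) (pairLaw g) := by
  have hr := (hg.continuous_logRatio (alg := alg) σ).measurable
  refine ⟨by fun_prop, ?_⟩
  rw [hasFiniteIntegral_iff_ofReal (ae_of_all _ fun _ => (Real.exp_pos _).le),
    hg.lintegral_exp_logRatio hσ]
  exact ENNReal.one_lt_top

lemma RegularPotential.integral_exp_logRatio (hg : RegularPotential g) {σ : ℝ} (hσ : 0 < σ) :
    ∫ p, Real.exp (logRatio alg g σ p) ∂(pairLaw g) = 1 := by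
  rw [integral_eq_lintegral_of_nonneg_ae (ae_of_all _ fun _ => (Real.exp_pos _).le)
    (hg.integrable_exp_logRatio hσ).1, hg.lintegral_exp_logRatio hσ, ENNReal.toReal_one]

lemma tendsto_comp_div_of_hasDerivAt {a : ℝ → ℝ} {a' c : ℝ} {r s : ℕ → ℝ}
    (ha : HasDerivAt a a' 0) (ha0 : a 0 = 0) (hr : Tendsto r atTop (𝓝 0))
    (hrs : Tendsto (fun n => r n / s n) atTop (𝓝 c)) :
    Tendsto (fun n => a (r n) / s n) atTop (𝓝 (a' * c)) := by
  have h := (hasDerivAt_iff_isLittleO.1 ha).comp_tendsto hr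
  have h1 : (fun n => (a (r n) - r n * a') / s n) =o[atTop] fun n => r n / s n := by
    simpa [Function.comp_def, ha0, div_eq_mul_inv] using h.mul_isBigO (isBigO_refl (fun n => (s n)⁻¹) atTop)
  have h2 : Tendsto (fun n => (a (r n) - r n * a') / s n) atTop (𝓝 0) := by
    have := h1.trans_isBigO (hrs.isBigO_one ℝ)
    exact (isLittleO_one_iff ℝ).1 this
  have := h2.add (hrs.const_mul a')
  rw [zero_add] at this
  refine this.congr fun n => ?_
  ring

/-- A dominated bound for the log ratio, in terms of one weight with all moments. -/
lemma exists_logRatio_bound (hg : RegularPotential g) (alg : Algorithm) :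
    ∃ L : ℝ × ℝ → ℝ, Measurable L ∧ (∀ p, 1 ≤ L p) ∧ (∀ k : ℕ, Integrable (fun p => L p ^ k)
      (pairLaw g)) ∧ ∀ p : ℝ × ℝ,
      |p.1| ≤ L p ∧ |p.2| ≤ L p ∧ |drift alg g p.1| ≤ L p ∧ |lead alg g p| ≤ L p ∧
      ∀ σ, 0 < σ → σ ≤ 1 →
        |logRatio alg g σ p - σ ^ alg.order * lead alg g p| ≤ σ ^ (alg.order + 1) * L p := by
  obtain ⟨C, k, hC, h⟩ := exists_dominating_weight hg alg
  refine ⟨fun p => C * weight p ^ k, (measurable_weight.pow_const k).const_mul C,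
    fun p => one_le_mul_of_one_le_of_one_le hC (one_le_pow₀ (one_le_weight p)), fun j => ?_, h⟩
  simp_rw [mul_pow, ← pow_mul]
  exact (hg.integrable_weight_pow _).const_mul _

section OneCoordinate

variable {σ : ℕ → ℝ}

lemma tendsto_logRatio_div (hg : RegularPotential g) (hσ : ∀ᶠ n in atTop, 0 < σ n)
    (hσ0 : Tendsto σ atTop (𝓝 0)) (p : ℝ × ℝ) :
    Tendsto (fun n => logRatio alg g (σ n) p / σ n ^ alg.order) atTop (𝓝 (lead alg g p)) := by
  obtain ⟨L, -, -, -, h⟩ := exists_logRatio_bound hg alg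
  obtain ⟨-, -, -, -, hb⟩ := h p
  rw [tendsto_iff_norm_sub_tendsto_zero]
  have hz : Tendsto (fun n => σ n * L p) atTop (𝓝 0) := by simpa using hσ0.mul_const (L p)
  refine squeeze_zero' (Eventually.of_forall fun _ => norm_nonneg _) ?_ hz
  filter_upwards [hσ, hσ0.eventually_le_const zero_lt_one] with n h0 h1
  have hs : 0 < σ n ^ alg.order := by positivity
  have : logRatio alg g (σ n) p / σ n ^ alg.order - lead alg g p =
      (logRatio alg g (σ n) p - σ n ^ alg.order * lead alg g p) / σ n ^ alg.order := by
    field_simp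
  rw [this, Real.norm_eq_abs, abs_div, abs_of_pos hs, div_le_iff₀ hs]
  refine (hb _ h0 h1).trans_eq ?_
  ring

lemma tendsto_logRatio_zero (hg : RegularPotential g) (hσ : ∀ᶠ n in atTop, 0 < σ n)
    (hσ0 : Tendsto σ atTop (𝓝 0)) (p : ℝ × ℝ) :
    Tendsto (fun n => logRatio alg g (σ n) p) atTop (𝓝 0) := by
  have h := (tendsto_logRatio_div (alg := alg) hg hσ hσ0 p).mul (hσ0.pow alg.order)
  have : alg.order ≠ 0 := by cases alg <;> simp [Algorithm.order]
  rw [zero_pow this, mul_zero] at h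
  refine h.congr' ?_
  filter_upwards [hσ] with n h0
  exact div_mul_cancel₀ _ (by positivity)

/-- Second order asymptotics of expectations of functions of the log ratio. -/
lemma tendsto_integral_logRatio (hg : RegularPotential g) (hσ : ∀ᶠ n in atTop, 0 < σ n)
    (hσ0 : Tendsto σ atTop (𝓝 0)) {a b : ℝ → ℝ} {a' b' A : ℝ} (hac : Continuous a)
    (hbc : Continuous b) (ha : HasDerivAt a a' 0) (hb : HasDerivAt b b' 0)
    (haA : ∀ r, |a r| ≤ A * |r|) (hbA : ∀ r, |b r| ≤ A * |r|) :
    Tendsto (fun n => (∫ p, a (logRatio alg g (σ n) p) * b (logRatio alg g (σ n) p) ∂(pairLaw g))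
      / σ n ^ (2 * alg.order)) atTop (𝓝 (a' * b' * roughness alg g)) := by
  obtain ⟨L, hLm, hL1, hLi, h⟩ := exists_logRatio_bound hg alg
  have ha0 : a 0 = 0 := by simpa using haA 0
  have hb0 : b 0 = 0 := by simpa using hbA 0
  have hr := fun n => (hg.continuous_logRatio (alg := alg) (σ n))
  have hA : 0 ≤ A := by simpa using (abs_nonneg _).trans (haA 1)
  simp_rw [← integral_div]
  rw [← hg.integral_lead_sq, ← integral_const_mul]
  refine tendsto_integral_filter_of_dominated_convergence
    (fun p => (2 * A) ^ 2 * L p ^ 2) ?_ ?_ ((hLi 2).const_mul _) (ae_of_all _ fun p => ?_)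
  · exact Eventually.of_forall fun n => by
      have := hr n
      exact (Continuous.aestronglyMeasurable (by fun_prop))
  · filter_upwards [hσ, hσ0.eventually_le_const zero_lt_one] with n h0 h1
    refine ae_of_all _ fun p => ?_
    obtain ⟨-, -, -, hl, hb'⟩ := h p
    have hs : 0 < σ n ^ alg.order := by positivity
    have L0 : 0 < L p := by linarith [hL1 p]
    -- After division by `σ^(2m)`, this makes the integrand bounded by a multiple of `L^2`
    -- independent of `n`.
    have e1 : |logRatio alg g (σ n) p| ≤ σ n ^ alg.order * (2 * L p) := by
      have e2 := hb' _ h0 h1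
      have e3 : σ n ^ (alg.order + 1) * L p ≤ σ n ^ alg.order * L p := by
        gcongr ?_ * _
        exact pow_le_pow_of_le_one h0.le h1 (by omega)
      have e4 : |σ n ^ alg.order * lead alg g p| ≤ σ n ^ alg.order * L p := by
        rw [abs_mul, abs_of_pos hs]; gcongr
      have e5 := abs_add_le (logRatio alg g (σ n) p - σ n ^ alg.order * lead alg g p)
        (σ n ^ alg.order * lead alg g p)
      rw [sub_add_cancel] at e5
      linarith
    rw [Real.norm_eq_abs, abs_div, abs_of_pos (by positivity : 0 < σ n ^ (2 * alg.order)),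
      div_le_iff₀ (by positivity)]
    calc |a (logRatio alg g (σ n) p) * b (logRatio alg g (σ n) p)|
        ≤ (A * (σ n ^ alg.order * (2 * L p))) * (A * (σ n ^ alg.order * (2 * L p))) :=
          abs_mul_le_mul ((haA _).trans (by gcongr)) ((hbA _).trans (by gcongr))
      _ = _ := by ring
  · have t := tendsto_logRatio_div (alg := alg) hg hσ hσ0 p
    have t0 := tendsto_logRatio_zero (alg := alg) hg hσ hσ0 p
    have := (tendsto_comp_div_of_hasDerivAt ha ha0 t0 t).mul
      (tendsto_comp_div_of_hasDerivAt hb hb0 t0 t)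
    convert this using 2 with n
    · rw [div_mul_div_comm, ← pow_add, two_mul]
    · ring

/-- The odd function `-tanh (r / 2)`. -/
def negTanhHalf (r : ℝ) : ℝ := (1 - Real.exp r) / (1 + Real.exp r)

lemma continuous_negTanhHalf : Continuous negTanhHalf := by
  unfold negTanhHalf
  exact Continuous.div (by fun_prop) (by fun_prop) fun r => by positivity

lemma hasDerivAt_negTanhHalf : HasDerivAt negTanhHalf (-1 / 2) 0 := by
  have h1 := (Real.hasDerivAt_exp 0).const_sub 1
  have h2 := (Real.hasDerivAt_exp 0).const_add 1
  exact (h1.fun_div h2 (by positivity)).congr_deriv (by norm_num)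

lemma abs_negTanhHalf_le (r : ℝ) : |negTanhHalf r| ≤ 1 * |r| := by
  unfold negTanhHalf
  have h0 := Real.exp_pos r
  rw [abs_div, abs_of_pos (by positivity : 0 < 1 + Real.exp r), div_le_iff₀ (by positivity),
    one_mul]
  rcases le_total 0 r with h | h
  · have h1 := Real.one_le_exp h
    have h2 := Real.add_one_le_exp (-r)
    rw [Real.exp_neg] at h2
    rw [abs_of_nonneg h, abs_sub_comm, abs_of_nonneg (by linarith)]
    have : (-r + 1) * Real.exp r ≤ 1 := by
      calc (-r + 1) * Real.exp r ≤ (Real.exp r)⁻¹ * Real.exp r := by gcongr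
        _ = 1 := inv_mul_cancel₀ h0.ne'
    nlinarith
  · have h1 := Real.exp_le_one_iff.2 h
    have h2 := Real.add_one_le_exp r
    rw [abs_of_nonpos h, abs_of_nonneg (by linarith)]
    nlinarith

lemma integrable_comp_logRatio (hg : RegularPotential g) (s : ℝ) {F : ℝ → ℝ} {B : ℝ}
    (hF : Continuous F) (hB : ∀ r, |F r| ≤ B) :
    Integrable (fun p => F (logRatio alg g s p)) (pairLaw g) := by
  have := hg.isProbabilityMeasure_pairLaw
  exact (integrable_const B).mono'
    (hF.comp (hg.continuous_logRatio s)).aestronglyMeasurable (ae_of_all _ fun p => hB _)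

/-- The left side looks like a first order quantity in `R`, but reversibility makes it second order.
The function `H` below satisfies `H(-r) e^r = -H(r)`, so its mean is zero, and subtracting `2H` from
the sine produces the factor `-tanh(r/2)`. No expansion of the mean of `R` is needed. -/
lemma integral_sin_logRatio (hg : RegularPotential g) {s : ℝ} (hs : 0 < s) (t : ℝ) :
    ∫ p, Real.sin (t * logRatio alg g s p) ∂(pairLaw g) =
      ∫ p, Real.sin (t * logRatio alg g s p) * negTanhHalf (logRatio alg g s p) ∂(pairLaw g) := by
  set H : ℝ → ℝ := fun r => Real.sin (t * r) * (Real.exp r / (1 + Real.exp r)) with hH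
  have hHc : Continuous H := by
    have : Continuous fun r => Real.exp r / (1 + Real.exp r) :=
      Continuous.div (by fun_prop) (by fun_prop) fun r => by positivity
    fun_prop
  have hHb : ∀ r, |H r| ≤ 1 := fun r => by
    have h0 := Real.exp_pos r
    have : |Real.exp r / (1 + Real.exp r)| ≤ 1 := by
      rw [abs_of_pos (by positivity), div_le_one (by positivity)]; linarith
    exact (abs_mul_le_mul (Real.abs_sin_le_one (t * r)) this).trans_eq (one_mul 1)
  have hsymm := hg.integral_logRatio (alg := alg) hs hHc.measurable
  have hneg : ∀ r, H (-r) * Real.exp r = -H r := fun r => by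
    simp only [hH]
    rw [mul_neg, Real.sin_neg, Real.exp_neg]
    have h0 := Real.exp_pos r
    field_simp
    ring
  simp_rw [hneg] at hsymm
  rw [integral_neg] at hsymm
  have hzero : ∫ p, H (logRatio alg g s p) ∂(pairLaw g) = 0 := by linarith
  have hpt : ∀ r, Real.sin (t * r) * negTanhHalf r = Real.sin (t * r) - 2 * H r := fun r => by
    have h0 := Real.exp_pos r
    simp only [hH, negTanhHalf]
    field_simp
    ring
  simp_rw [hpt]
  rw [integral_sub (integrable_comp_logRatio hg s (F := fun r => Real.sin (t * r)) (by fun_prop)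
    fun r => Real.abs_sin_le_one _) ((integrable_comp_logRatio hg s hHc hHb).const_mul 2),
    integral_const_mul, hzero]
  ring

/-- Asymptotics of the characteristic function of one log ratio. -/
lemma tendsto_charFun_logRatio (hg : RegularPotential g) (hσ : ∀ᶠ n in atTop, 0 < σ n)
    (hσ0 : Tendsto σ atTop (𝓝 0)) {τ : ℝ}
    (hτ : Tendsto (fun n : ℕ => n * σ n ^ (2 * alg.order)) atTop (𝓝 τ)) (t : ℝ) :
    Tendsto (fun n : ℕ => charFun ((pairLaw g).map (logRatio alg g (σ n))) t ^ n) atTop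
      (𝓝 (Complex.exp (t * ((-(τ * roughness alg g / 2) : ℝ) : ℂ) * Complex.I
        - ((τ * roughness alg g : ℝ) : ℂ) * t ^ 2 / 2))) := by
  have := hg.isProbabilityMeasure_pairLaw
  have hr := fun n => (hg.continuous_logRatio (alg := alg) (σ n)).measurable
  have hsin : ∀ c r : ℝ, |Real.sin (c * r)| ≤ |c| * |r| := fun c r => by
    rw [← abs_mul]; exact Real.abs_sin_le_abs
  have dsin : ∀ c : ℝ, HasDerivAt (fun r => Real.sin (c * r)) c 0 := fun c => by
    have := ((hasDerivAt_id (0 : ℝ)).const_mul c).sin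
    exact this.congr_deriv (by simp)
  have hcf : ∀ᶠ n in atTop, charFun ((pairLaw g).map (logRatio alg g (σ n))) t = 1 +
      (((∫ p, -2 * (Real.sin (t / 2 * logRatio alg g (σ n) p) *
        Real.sin (t / 2 * logRatio alg g (σ n) p)) ∂(pairLaw g) : ℝ) : ℂ)
      + ((∫ p, Real.sin (t * logRatio alg g (σ n) p) * negTanhHalf (logRatio alg g (σ n) p)
        ∂(pairLaw g) : ℝ) : ℂ) * Complex.I) := by
    filter_upwards [hσ] with n h0
    rw [charFun_apply_real, integral_map (hr n).aemeasurable (by fun_prop)]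
    have e : ∀ p, Complex.exp (t * (logRatio alg g (σ n) p) * Complex.I) =
        ((Real.cos (t * logRatio alg g (σ n) p) : ℝ) : ℂ)
          + ((Real.sin (t * logRatio alg g (σ n) p) : ℝ) : ℂ) * Complex.I := fun p => by
      rw [← Complex.ofReal_mul, Complex.exp_mul_I, Complex.ofReal_cos, Complex.ofReal_sin]
    simp_rw [e]
    have ic := integrable_comp_logRatio (alg := alg) hg (σ n) (F := fun r => Real.cos (t * r))
      (by fun_prop) (fun r => Real.abs_cos_le_one _)
    have is := integrable_comp_logRatio (alg := alg) hg (σ n) (F := fun r => Real.sin (t * r))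
      (by fun_prop) (fun r => Real.abs_sin_le_one _)
    rw [integral_add ic.ofReal (is.ofReal.mul_const _), integral_mul_const, integral_complex_ofReal,
      integral_complex_ofReal, integral_sin_logRatio hg h0, ← add_assoc]
    congr 1
    -- The half-angle formula writes the real part as a product of two functions that vanish
    -- linearly at zero, the shape required by `tendsto_integral_logRatio`.
    have hcos : ∀ p, -2 * (Real.sin (t / 2 * logRatio alg g (σ n) p) *
        Real.sin (t / 2 * logRatio alg g (σ n) p)) = Real.cos (t * logRatio alg g (σ n) p) - 1 := by
      intro p
      have h := Real.cos_sq_add_sin_sq (t / 2 * logRatio alg g (σ n) p)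
      have h2 := Real.cos_two_mul (t / 2 * logRatio alg g (σ n) p)
      have : 2 * (t / 2 * logRatio alg g (σ n) p) = t * logRatio alg g (σ n) p := by ring
      rw [this] at h2
      rw [h2]
      linarith
    simp_rw [hcos]
    rw [integral_sub ic (integrable_const _)]
    simp
  have t1 := tendsto_integral_logRatio (alg := alg) hg hσ hσ0
    (a := fun r => Real.sin (t / 2 * r)) (b := fun r => Real.sin (t / 2 * r))
    (by fun_prop) (by fun_prop) (dsin _) (dsin _) (hsin _) (hsin _)
  -- The constant `|t| + 1` serves both factors, whose Lipschitz-type bounds are `|t|` and `1`.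
  have t2 := tendsto_integral_logRatio (alg := alg) hg hσ hσ0 (A := |t| + 1)
    (a := fun r => Real.sin (t * r)) (b := negTanhHalf)
    (by fun_prop) continuous_negTanhHalf (dsin _) hasDerivAt_negTanhHalf
    (fun r => (hsin t r).trans (by have := abs_nonneg r; nlinarith))
    (fun r => (abs_negTanhHalf_le r).trans
      (by have := abs_nonneg r; have := abs_nonneg t; nlinarith))
  have u1 := hτ.mul (t1.const_mul (-2))
  have u2 := hτ.mul t2
  have c1 := (Complex.continuous_ofReal.tendsto _).comp u1
  have c2 := ((Complex.continuous_ofReal.tendsto _).comp u2).mul_const Complex.I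
  have hlim := c1.add c2
  have hpow := Complex.tendsto_one_add_pow_exp_of_tendsto (g := fun n =>
    (((∫ p, -2 * (Real.sin (t / 2 * logRatio alg g (σ n) p) *
        Real.sin (t / 2 * logRatio alg g (σ n) p)) ∂(pairLaw g) : ℝ) : ℂ)
      + ((∫ p, Real.sin (t * logRatio alg g (σ n) p) * negTanhHalf (logRatio alg g (σ n) p)
        ∂(pairLaw g) : ℝ) : ℂ) * Complex.I)) (t := t * ((-(τ * roughness alg g / 2) : ℝ) : ℂ) * Complex.I
        - ((τ * roughness alg g : ℝ) : ℂ) * t ^ 2 / 2) ?_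
  · refine hpow.congr' ?_
    filter_upwards [hcf] with n hn
    rw [hn]
  · convert hlim.congr' ?_ using 2
    · push_cast; ring
    · filter_upwards [hσ] with n h0
      have hs : σ n ^ (2 * alg.order) ≠ 0 := by positivity
      simp only [Function.comp_apply]
      rw [integral_const_mul]
      have k1 : ∀ x : ℝ, (n : ℝ) * σ n ^ (2 * alg.order) * (x / σ n ^ (2 * alg.order)) = n * x :=
        fun x => by field_simp
      have k2 : ∀ x : ℝ, (n : ℝ) * σ n ^ (2 * alg.order) * (-2 * (x / σ n ^ (2 * alg.order)))
        = n * (-2 * x) := fun x => by field_simp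
      rw [k1, k2]
      push_cast
      ring

/-- The affinity of the two directions of a move falls below one by the order of `σ ^ (2m)`. -/
lemma eventually_integral_exp_half_le (hg : RegularPotential g) (hσ : ∀ᶠ n in atTop, 0 < σ n)
    (hσ0 : Tendsto σ atTop (𝓝 0)) :
    ∀ᶠ n in atTop, ∫ p, Real.exp (logRatio alg g (σ n) p / 2) ∂(pairLaw g) ≤
      1 - roughness alg g / 64 * σ n ^ (2 * alg.order) := by
  have := hg.isProbabilityMeasure_pairLaw
  have hK := hg.roughness_pos (alg := alg)
  have hd : HasDerivAt (fun r => negTanhHalf (r / 2)) (-1 / 4) 0 := by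
    have h : HasDerivAt (fun r : ℝ => r / 2) (1 / 2) 0 := (hasDerivAt_id (0 : ℝ)).div_const 2
    have h' : HasDerivAt negTanhHalf (-1 / 2) ((0 : ℝ) / 2) := by
      rw [zero_div]; exact hasDerivAt_negTanhHalf
    have h2 := h'.comp (0 : ℝ) h
    rw [show (-1 / 2 : ℝ) * (1 / 2) = -1 / 4 by norm_num] at h2
    exact h2
  have hb : ∀ r, |negTanhHalf (r / 2)| ≤ 1 * |r| := fun r => by
    refine (abs_negTanhHalf_le _).trans ?_
    rw [abs_div, abs_two]; have := abs_nonneg r; linarith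
  have hc : Continuous fun r => negTanhHalf (r / 2) :=
    continuous_negTanhHalf.comp (by fun_prop)
  have t1 := tendsto_integral_logRatio (alg := alg) hg hσ hσ0 hc hc hd hd hb hb
  -- The limit is `K / 16`; half of it leaves room for a strict eventual inequality, and another
  -- factor of two is lost below.
  have hlt : roughness alg g / 32 < -1 / 4 * (-1 / 4) * roughness alg g := by linarith
  filter_upwards [hσ, t1.eventually_const_lt hlt] with n h0 hn
  rw [lt_div_iff₀ (by positivity)] at hn
  have i1 := hg.integrable_exp_logRatio (alg := alg) h0
  have hr := (hg.continuous_logRatio (alg := alg) (σ n))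
  have i2 : Integrable (fun p => Real.exp (logRatio alg g (σ n) p / 2)) (pairLaw g) := by
    refine ((integrable_const 1).add i1).mono' (Continuous.aestronglyMeasurable (by fun_prop))
      (ae_of_all _ fun p => ?_)
    rw [Real.norm_of_nonneg (Real.exp_pos _).le]
    simp only [Pi.add_apply]
    have : Real.exp (logRatio alg g (σ n) p) = Real.exp (logRatio alg g (σ n) p / 2) ^ 2 := by
      rw [← Real.exp_nat_mul]; congr 1; push_cast; ring
    rw [this]
    nlinarith [sq_nonneg (Real.exp (logRatio alg g (σ n) p / 2) - 1)]
  -- With `s = exp (R/2)` and `E[s^2] = 1`, one has `E[(1 - s)^2] = 2 - 2 E[s]`. Since `1 - s` has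
  -- no global linear bound in `R`, it is compared with `(1 - s) / (1 + s)`, which has one.
  have hle : ∫ p, negTanhHalf (logRatio alg g (σ n) p / 2) * negTanhHalf (logRatio alg g (σ n) p / 2)
      ∂(pairLaw g) ≤ ∫ p, (1 - 2 * Real.exp (logRatio alg g (σ n) p / 2)
        + Real.exp (logRatio alg g (σ n) p)) ∂(pairLaw g) := by
    have ib : Integrable (fun p => 1 - 2 * Real.exp (logRatio alg g (σ n) p / 2)
        + Real.exp (logRatio alg g (σ n) p)) (pairLaw g) :=
      ((integrable_const 1).sub' (i2.const_mul 2)).add i1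
    refine integral_mono_of_nonneg (ae_of_all _ fun p => mul_self_nonneg _) ib
      (ae_of_all _ fun p => ?_)
    have e : Real.exp (logRatio alg g (σ n) p) = Real.exp (logRatio alg g (σ n) p / 2) ^ 2 := by
      rw [← Real.exp_nat_mul]; congr 1; push_cast; ring
    have h1 := Real.exp_pos (logRatio alg g (σ n) p / 2)
    simp only [negTanhHalf, e]
    rw [div_mul_div_comm, div_le_iff₀ (by positivity)]
    set s := Real.exp (logRatio alg g (σ n) p / 2)
    nlinarith [mul_nonneg (mul_nonneg h1.le (by linarith : 0 ≤ 2 + s)) (sq_nonneg (1 - s))]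
  rw [integral_add ((integrable_const 1).sub' (i2.const_mul 2)) i1,
    integral_sub (integrable_const 1) (i2.const_mul 2), integral_const_mul,
    hg.integral_exp_logRatio h0] at hle
  simp only [integral_const, probReal_univ, smul_eq_mul, mul_one] at hle
  linarith

end OneCoordinate

end

/-! ### The central limit theorem for the sum of the log ratios. -/

section

/-- The acceptance probability as a function of the log acceptance ratio. -/
def capExp (x : ℝ) : ℝ := min 1 (Real.exp x)

lemma continuous_capExp : Continuous capExp := by unfold capExp; fun_prop

lemma capExp_nonneg (x : ℝ) : 0 ≤ capExp x := le_min zero_le_one (Real.exp_pos _).le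

lemma capExp_le_one (x : ℝ) : capExp x ≤ 1 := min_le_left _ _

lemma abs_capExp_le (x : ℝ) : |capExp x| ≤ 1 := by
  rw [abs_of_nonneg (capExp_nonneg x)]; exact capExp_le_one x

/-- The exponent one half makes the bound on the acceptance rate a product of affinities; with
exponent one the product would be one, by reversibility. -/
lemma capExp_le_exp_half (x : ℝ) : capExp x ≤ Real.exp (x / 2) := by
  rcases le_total x 0 with h | h
  · exact (min_le_right _ _).trans (Real.exp_le_exp.2 (by linarith))
  · exact (min_le_left _ _).trans (Real.one_le_exp (by linarith))

/-- The exponential has slope at most one on the negative axis and the cap is flat beyond it. This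
makes the acceptance probability insensitive to vanishing changes of the log ratio. -/
lemma abs_capExp_sub_le (a b : ℝ) : |capExp a - capExp b| ≤ |a - b| := by
  have key : ∀ a b : ℝ, b ≤ a → capExp a - capExp b ≤ a - b := by
    intro a b h
    unfold capExp
    rcases le_total b 0 with hb | hb
    · rw [min_eq_right (Real.exp_le_one_iff.2 hb)]
      have hb1 := Real.exp_le_one_iff.2 hb
      have hb2 := Real.exp_pos b
      rcases le_total a 0 with ha | ha
      · rw [min_eq_right (Real.exp_le_one_iff.2 ha)]
        have h1 := Real.add_one_le_exp (b - a)
        rw [Real.exp_sub] at h1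
        have ha1 := Real.exp_le_one_iff.2 ha
        have ha2 := Real.exp_pos a
        rw [le_div_iff₀ ha2] at h1
        nlinarith
      · have h1 := Real.add_one_le_exp b
        have h2 := min_le_left 1 (Real.exp a)
        linarith
    · rw [min_eq_left (Real.one_le_exp hb)]
      have h2 := min_le_left 1 (Real.exp a)
      linarith
  have mono : Monotone capExp := fun a b h => min_le_min le_rfl (Real.exp_le_exp.2 h)
  rcases le_total b a with h | h
  · rw [abs_of_nonneg (sub_nonneg.2 (mono h)), abs_of_nonneg (sub_nonneg.2 h)]
    exact key a b h
  · rw [abs_sub_comm, abs_sub_comm a b, abs_of_nonneg (sub_nonneg.2 (mono h)),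
      abs_of_nonneg (sub_nonneg.2 h)]
    exact key b a h

/-- The mean of `min 1 exp` under the normal law with mean `-v / 2` and variance `v`. -/
lemma integral_capExp_gaussianReal {v : ℝ} (hv : 0 ≤ v) :
    ∫ x, capExp x ∂(gaussianReal (-(v / 2)) v.toNNReal) =
      2 * cdf (gaussianReal 0 1) (-(√v / 2)) := by
  have hsymm : (gaussianReal 0 1).real (Set.Iic 0) = (1 / 2 : ℝ) := by
    have h1 : (gaussianReal 0 1).real (Set.Iic (0 : ℝ)) = (gaussianReal 0 1).real (Set.Ioi 0) := by
      have hm : (gaussianReal 0 1).map (fun x : ℝ => -x) = gaussianReal 0 1 := by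
        rw [gaussianReal_map_neg, neg_zero]
      have hI : (gaussianReal 0 1).real (Set.Iio (0 : ℝ)) = (gaussianReal 0 1).real (Set.Ioi 0) := by
        conv_lhs => rw [← hm, map_measureReal_apply measurable_neg measurableSet_Iio]
        congr 1
        ext x; simp
      have := nullSingletonClass_gaussianReal (μ := 0) (v := 1) one_ne_zero
      rw [← hI]
      exact measureReal_congr Iio_ae_eq_Iic.symm
    have h2 := probReal_compl_eq_one_sub (μ := gaussianReal 0 1) (measurableSet_Iic (a := (0 : ℝ)))
    rw [Set.compl_Iic] at h2
    linarith
  -- The degenerate normal law is needed when the steps are so small that the variance vanishes in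
  -- the limit.
  rcases hv.eq_or_lt with rfl | hv
  · rw [Real.toNNReal_zero, gaussianReal_zero_var, integral_dirac, cdf_eq_real]
    simp only [Real.sqrt_zero, zero_div, neg_zero, hsymm]
    simp [capExp]
  have hv0 : v.toNNReal ≠ 0 := by simpa using hv
  have hvc : (v.toNNReal : ℝ) = v := Real.coe_toNNReal _ hv.le
  -- The mean `-v/2` is exactly the one for which tilting by `exp x` reflects the density to mean
  -- `v/2`; the two halves then have equal mass.
  have hsplit : ∀ x, gaussianPDFReal (-(v / 2)) v.toNNReal x • capExp x =
      (Set.Ioi (0 : ℝ)).indicator (gaussianPDFReal (-(v / 2)) v.toNNReal) x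
        + (Set.Iic (0 : ℝ)).indicator (gaussianPDFReal (v / 2) v.toNNReal) x := fun x => by
    rw [smul_eq_mul]
    rcases lt_or_ge 0 x with h | h
    · rw [Set.indicator_of_mem (Set.mem_Ioi.2 h), Set.indicator_of_notMem (by simpa using h)]
      simp [capExp, Real.one_le_exp h.le]
    · rw [Set.indicator_of_notMem (by simpa using h), Set.indicator_of_mem (Set.mem_Iic.2 h)]
      simp only [capExp, min_eq_right (Real.exp_le_one_iff.2 h), gaussianPDFReal, hvc, zero_add]
      rw [mul_assoc, ← Real.exp_add]
      congr 2
      field_simp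
      ring
  rw [integral_gaussianReal_eq_integral_smul hv0]
  simp_rw [hsplit]
  rw [integral_add ((integrable_gaussianPDFReal _ _).indicator measurableSet_Ioi)
    ((integrable_gaussianPDFReal _ _).indicator measurableSet_Iic),
    integral_indicator measurableSet_Ioi, integral_indicator measurableSet_Iic]
  have hreal : ∀ (m : ℝ) (s : Set ℝ), ∫ x in s, gaussianPDFReal m v.toNNReal x =
      (gaussianReal m v.toNNReal).real s := fun m s => by
    rw [Measure.real, gaussianReal_apply_eq_integral _ hv0,
      ENNReal.toReal_ofReal (integral_nonneg fun x => gaussianPDFReal_nonneg _ _ _)]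
  rw [hreal, hreal]
  have hneg : (gaussianReal (-(v / 2)) v.toNNReal).real (Set.Ioi 0) =
      (gaussianReal (v / 2) v.toNNReal).real (Set.Iic 0) := by
    have hm := gaussianReal_map_neg (μ := v / 2) (v := v.toNNReal)
    rw [← hm, map_measureReal_apply measurable_neg measurableSet_Ioi]
    have := nullSingletonClass_gaussianReal (μ := v / 2) (v := v.toNNReal) hv0
    have e : (fun x : ℝ => -x) ⁻¹' Set.Ioi 0 = Set.Iio 0 := by ext x; simp
    rw [e]
    exact measureReal_congr Iio_ae_eq_Iic
  have hphi : (gaussianReal (v / 2) v.toNNReal).real (Set.Iic 0) =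
      cdf (gaussianReal 0 1) (-(√v / 2)) := by
    have hm : gaussianReal (v / 2) v.toNNReal =
        (gaussianReal 0 1).map fun z => v / 2 + √v * z := by
      have : (fun z => v / 2 + √v * z) = (fun x => v / 2 + x) ∘ fun z => √v * z := rfl
      rw [this, ← Measure.map_map (by fun_prop) (by fun_prop), gaussianReal_map_const_mul,
        gaussianReal_map_const_add, mul_zero, zero_add, mul_one]
      congr 1
      ext; simp [hvc, Real.sq_sqrt hv.le]
    rw [hm, map_measureReal_apply (by fun_prop) measurableSet_Iic, cdf_eq_real]
    congr 1
    ext z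
    have hs := Real.sqrt_pos.2 hv
    have hs2 := Real.mul_self_sqrt hv.le
    simp only [Set.mem_preimage, Set.mem_Iic]
    constructor
    · intro h
      nlinarith
    · intro h
      nlinarith
  rw [hneg, hphi]
  ring

/-- The law of the whole sequence of rescaled coordinates and noises. -/
def seqLaw (g : ℝ → ℝ) : Measure (ℕ → ℝ × ℝ) := Measure.infinitePi fun _ => pairLaw g

/-- The log acceptance ratio of the first `n` coordinates, without the change of measure. -/
def sumLogRatio (alg : Algorithm) (g : ℝ → ℝ) (s : ℝ) (n : ℕ) (w : ℕ → ℝ × ℝ) : ℝ :=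
  ∑ i ∈ Finset.range n, logRatio alg g s (w i)

variable {g : ℝ → ℝ} {alg : Algorithm}

lemma RegularPotential.isProbabilityMeasure_seqLaw (hg : RegularPotential g) :
    IsProbabilityMeasure (seqLaw g) := by
  have := hg.isProbabilityMeasure_pairLaw
  unfold seqLaw; infer_instance

lemma RegularPotential.measurable_sumLogRatio (hg : RegularPotential g) (s : ℝ) (n : ℕ) :
    Measurable (sumLogRatio alg g s n) := by
  have := (hg.continuous_logRatio (alg := alg) s).measurable
  unfold sumLogRatio
  exact Finset.measurable_sum _ fun i _ => this.comp (measurable_pi_apply i)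

lemma RegularPotential.measurePreserving_eval (hg : RegularPotential g) (i : ℕ) :
    MeasurePreserving (fun w : ℕ → ℝ × ℝ => w i) (seqLaw g) (pairLaw g) := by
  have := hg.isProbabilityMeasure_pairLaw
  exact measurePreserving_eval_infinitePi (fun _ : ℕ => pairLaw g) i

lemma RegularPotential.iIndepFun_logRatio (hg : RegularPotential g) (s : ℝ) :
    iIndepFun (fun (i : ℕ) (w : ℕ → ℝ × ℝ) => logRatio alg g s (w i)) (seqLaw g) := by
  have := hg.isProbabilityMeasure_pairLaw
  exact iIndepFun_infinitePi fun _ => (hg.continuous_logRatio (alg := alg) s).measurable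

lemma RegularPotential.map_logRatio_eval (hg : RegularPotential g) (s : ℝ) (i : ℕ) :
    (seqLaw g).map (fun w => logRatio alg g s (w i)) = (pairLaw g).map (logRatio alg g s) := by
  have hr := (hg.continuous_logRatio (alg := alg) s).measurable
  have he := hg.measurePreserving_eval i
  rw [← he.map_eq, Measure.map_map hr he.measurable]
  rfl

/-- The central limit theorem for the log acceptance ratio, in the form of its consequence for the
mean acceptance probability. -/
lemma tendsto_integral_capExp (hg : RegularPotential g) {σ : ℕ → ℝ}
    (hσ : ∀ᶠ n in atTop, 0 < σ n) (hσ0 : Tendsto σ atTop (𝓝 0)) {τ : ℝ} (hτ0 : 0 ≤ τ)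
    (hτ : Tendsto (fun n : ℕ => n * σ n ^ (2 * alg.order)) atTop (𝓝 τ)) :
    Tendsto (fun n => ∫ w, capExp (sumLogRatio alg g (σ n) n w) ∂(seqLaw g)) atTop
      (𝓝 (2 * cdf (gaussianReal 0 1) (-(√(τ * roughness alg g) / 2)))) := by
  have := hg.isProbabilityMeasure_seqLaw
  have hv : 0 ≤ τ * roughness alg g := mul_nonneg hτ0 hg.roughness_pos.le
  have hS := fun n => hg.measurable_sumLogRatio (alg := alg) (σ n) n
  let μ : ℕ → ProbabilityMeasure ℝ := fun n =>
    ⟨(seqLaw g).map (sumLogRatio alg g (σ n) n), Measure.isProbabilityMeasure_map (hS n).aemeasurable⟩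
  let μ₀ : ProbabilityMeasure ℝ :=
    ⟨gaussianReal (-(τ * roughness alg g / 2)) (τ * roughness alg g).toNNReal, inferInstance⟩
  -- The summands change with `n`, a triangular array, so Lévy's continuity theorem is applied to
  -- the characteristic functions directly.
  have hconv : Tendsto μ atTop (𝓝 μ₀) := by
    refine ProbabilityMeasure.tendsto_iff_tendsto_charFun.2 fun t => ?_
    have h1 : ∀ n, charFun (μ n : Measure ℝ) t =
        charFun ((pairLaw g).map (logRatio alg g (σ n))) t ^ n := fun n => by
      have hr := (hg.continuous_logRatio (alg := alg) (σ n)).measurable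
      have := iIndepFun.charFun_map_fun_finsetSum_eq_prod (s := Finset.range n)
        (X := fun (i : ℕ) (w : ℕ → ℝ × ℝ) => logRatio alg g (σ n) (w i))
        (fun i _ => (hr.comp (measurable_pi_apply i)).aemeasurable)
        ((hg.iIndepFun_logRatio (alg := alg) (σ n)).restrict (Finset.range n))
      change charFun ((seqLaw g).map fun w => ∑ i ∈ Finset.range n, logRatio alg g (σ n) (w i)) t = _
      rw [this, Finset.prod_apply]
      simp [hg.map_logRatio_eval]
    simp_rw [h1]
    have h2 : charFun (μ₀ : Measure ℝ) t = Complex.exp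
        (t * ((-(τ * roughness alg g / 2) : ℝ) : ℂ) * Complex.I
          - ((τ * roughness alg g : ℝ) : ℂ) * t ^ 2 / 2) := by
      change charFun (gaussianReal _ _) t = _
      rw [charFun_gaussianReal, Real.coe_toNNReal _ hv]
    rw [h2]
    exact tendsto_charFun_logRatio hg hσ hσ0 hτ t
  let F : BoundedContinuousFunction ℝ ℝ :=
    BoundedContinuousFunction.ofNormedAddCommGroup capExp continuous_capExp 1 abs_capExp_le
  have := ProbabilityMeasure.tendsto_iff_forall_integral_tendsto.1 hconv F
  rw [← integral_capExp_gaussianReal hv]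
  refine this.congr fun n => ?_
  exact integral_map (hS n).aemeasurable continuous_capExp.aestronglyMeasurable

/-- Superpolynomial smallness of the affinity of `n` coordinates. -/
lemma eventually_integral_exp_half_sum_le (hg : RegularPotential g) {σ : ℕ → ℝ}
    (hσ : ∀ᶠ n in atTop, 0 < σ n) (hσ0 : Tendsto σ atTop (𝓝 0)) :
    ∀ᶠ n : ℕ in atTop,
      ∫ w, Real.exp (sumLogRatio alg g (σ n) n w / 2) ∂(seqLaw g) ≤
        Real.exp (-(roughness alg g / 64 * (n * σ n ^ (2 * alg.order)))) ∧
      Integrable (fun w => Real.exp (sumLogRatio alg g (σ n) n w / 2)) (seqLaw g) := by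
  have := hg.isProbabilityMeasure_seqLaw
  have := hg.isProbabilityMeasure_pairLaw
  filter_upwards [eventually_integral_exp_half_le (alg := alg) hg hσ hσ0, hσ] with n hn h0
  have hr := (hg.continuous_logRatio (alg := alg) (σ n)).measurable
  have hX : ∀ i : ℕ, Measurable fun w : ℕ → ℝ × ℝ => logRatio alg g (σ n) (w i) :=
    fun i => hr.comp (measurable_pi_apply i)
  have heq : ∀ w, Real.exp (sumLogRatio alg g (σ n) n w / 2) =
      Real.exp ((1 / 2) * (∑ i ∈ Finset.range n,
        fun w : ℕ → ℝ × ℝ => logRatio alg g (σ n) (w i)) w) := fun w => by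
    rw [Finset.sum_apply, sumLogRatio]; ring_nf
  have hmgf : ∀ i : ℕ, mgf (fun w : ℕ → ℝ × ℝ => logRatio alg g (σ n) (w i)) (seqLaw g) (1 / 2) =
      ∫ p, Real.exp (logRatio alg g (σ n) p / 2) ∂(pairLaw g) := fun i => by
    have he := hg.measurePreserving_eval i
    rw [mgf, ← he.map_eq, integral_map he.measurable.aemeasurable
      (by fun_prop)]
    refine integral_congr_ae (ae_of_all _ fun w => ?_)
    simp only; ring_nf
  constructor
  -- Independence turns the moment generating function at `1/2` into an `n`-th power, bounded by `1
  -- - x ≤ exp (-x)`.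
  · simp_rw [heq]
    have := (hg.iIndepFun_logRatio (alg := alg) (σ n)).mgf_sum (t := 1 / 2) hX (Finset.range n)
    rw [mgf] at this
    rw [this]
    simp only [hmgf, Finset.prod_const, Finset.card_range]
    have hnn : 0 ≤ ∫ p, Real.exp (logRatio alg g (σ n) p / 2) ∂(pairLaw g) :=
      integral_nonneg fun _ => (Real.exp_pos _).le
    calc _ ≤ (1 - roughness alg g / 64 * σ n ^ (2 * alg.order)) ^ n := by gcongr
      _ ≤ Real.exp (-(roughness alg g / 64 * σ n ^ (2 * alg.order))) ^ n := by
        gcongr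
        · exact hnn.trans hn
        · have := Real.add_one_le_exp (-(roughness alg g / 64 * σ n ^ (2 * alg.order)))
          linarith
      _ = _ := by rw [← Real.exp_nat_mul]; ring_nf
  · simp_rw [heq]
    refine (hg.iIndepFun_logRatio (alg := alg) (σ n)).integrable_exp_mul_sum hX fun i _ => ?_
    have he := hg.measurePreserving_eval i
    have i1 := hg.integrable_exp_logRatio (alg := alg) h0
    have i2 : Integrable (fun p => Real.exp (1 / 2 * logRatio alg g (σ n) p)) (pairLaw g) := by
      refine ((integrable_const 1).add i1).mono' (by fun_prop) (ae_of_all _ fun p => ?_)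
      rw [Real.norm_of_nonneg (Real.exp_pos _).le]
      simp only [Pi.add_apply]
      have : Real.exp (logRatio alg g (σ n) p) = Real.exp (1 / 2 * logRatio alg g (σ n) p) ^ 2 := by
        rw [← Real.exp_nat_mul]; congr 1; push_cast; ring
      rw [this]
      nlinarith [sq_nonneg (Real.exp (1 / 2 * logRatio alg g (σ n) p) - 1)]
    exact he.integrable_comp_of_integrable i2

end

/-! ### Reduction of the chain to i.i.d. rescaled coordinates. -/

section

variable {g : ℝ → ℝ} {alg : Algorithm} {n : ℕ}

/-- The state with rescaled coordinates `u`. -/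
def rescale (lam : Fin n → ℝ) (u : Fin n → ℝ) : Fin n → ℝ := fun i => lam i * u i

/-- The current state, as a function of the sequence of rescaled coordinates and noises. -/
def state (lam : Fin n → ℝ) (w : ℕ → ℝ × ℝ) : Fin n → ℝ := rescale lam fun i => (w i).1

/-- The first `n` noises. -/
def noise (n : ℕ) (w : ℕ → ℝ × ℝ) : Fin n → ℝ := fun i => (w i).2

/-- The proposal, as a function of the sequence of rescaled coordinates and noises. -/
def movedState (alg : Algorithm) (g : ℝ → ℝ) (lam : Fin n → ℝ) (s : ℝ) (w : ℕ → ℝ × ℝ) :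
    Fin n → ℝ := rescale lam fun i => move alg g s (w i)

lemma measurable_state (lam : Fin n → ℝ) : Measurable (state lam) := by
  unfold state rescale; fun_prop

lemma measurable_noise : Measurable (noise n) := by
  unfold noise; fun_prop

lemma RegularPotential.measurable_movedState (hg : RegularPotential g) (lam : Fin n → ℝ) (s : ℝ) :
    Measurable (movedState alg g lam s) := by
  have := (hg.continuous_move (alg := alg) s).measurable
  unfold movedState rescale; fun_prop

lemma proposalMean_rescale {lam : Fin n → ℝ} (hlam : ∀ i, 0 < lam i) (s : ℝ) (u : Fin n → ℝ)
    (i : Fin n) :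
    proposalMean alg g lam s (rescale lam u) i = lam i * (u i + s ^ 2 * drift alg g (u i)) := by
  have := (hlam i).ne'
  cases alg
  · simp [proposalMean, rescale, drift]
  · simp only [proposalMean, rescale, drift, mul_div_cancel_left₀ _ this, iteratedDeriv_one]
    ring

lemma proposal_state {lam : Fin n → ℝ} (hlam : ∀ i, 0 < lam i) (s : ℝ) (w : ℕ → ℝ × ℝ) :
    proposal alg g lam s (state lam w) (noise n w) = movedState alg g lam s w := by
  funext i
  simp only [proposal, state, proposalMean_rescale hlam, movedState, noise, rescale, move]
  ring

/-- The prefactor does not depend on `u` and `v`, so it cancels in the acceptance ratio; the scales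
survive only inside `φ`. -/
lemma targetDensity_mul_proposalDensity {lam : Fin n → ℝ} (hlam : ∀ i, 0 < lam i) {s : ℝ}
    (hs : 0 < s) (φ : (Fin n → ℝ) → ℝ) (u v : Fin n → ℝ) :
    targetDensity g lam φ (rescale lam u) *
        proposalDensity alg g lam s (rescale lam u) (rescale lam v) =
      (∏ i, 1 / lam i * (√(2 * Real.pi * (s * lam i) ^ 2))⁻¹) *
        Real.exp (-φ (rescale lam u) + ∑ i, logKernel alg g s (u i) (v i)) := by
  rw [targetDensity, refDensity, proposalDensity, Real.exp_add, Real.exp_sum, mul_assoc,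
    ← Finset.prod_mul_distrib, mul_left_comm, ← Finset.prod_mul_distrib]
  congr 1
  refine Finset.prod_congr rfl fun i _ => ?_
  have h0 := (hlam i).ne'
  have hs0 := hs.ne'
  rw [proposalMean_rescale hlam, gaussianPDFReal, Real.coe_toNNReal _ (sq_nonneg _)]
  simp only [rescale, mul_div_cancel_left₀ _ h0, logKernel]
  rw [sub_eq_add_neg (-g (u i)), Real.exp_add]
  have : -(lam i * v i - lam i * (u i + s ^ 2 * drift alg g (u i))) ^ 2 / (2 * (s * lam i) ^ 2) =
      -((v i - (u i + s ^ 2 * drift alg g (u i))) ^ 2 / (2 * s ^ 2)) := by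
    field_simp
  rw [this]
  ring

/-- The acceptance probability in rescaled coordinates. -/
lemma acceptProb_eq {lam : Fin n → ℝ} (hlam : ∀ i, 0 < lam i) {s : ℝ}
    (hs : 0 < s) (φ : (Fin n → ℝ) → ℝ) (w : ℕ → ℝ × ℝ) :
    acceptProb alg g lam s φ (state lam w) (movedState alg g lam s w) =
      capExp (sumLogRatio alg g s n w + (φ (state lam w) - φ (movedState alg g lam s w))) := by
  have hC : 0 < ∏ i, 1 / lam i * (√(2 * Real.pi * (s * lam i) ^ 2))⁻¹ :=
    Finset.prod_pos fun i _ => by have := hlam i; positivity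
  unfold acceptProb
  simp only [state, movedState, targetDensity_mul_proposalDensity hlam hs]
  -- The densities are everywhere positive, so the default value `0` of the acceptance probability
  -- never occurs.
  rw [if_pos (mul_pos hC (Real.exp_pos _)), mul_div_mul_left _ _ hC.ne', ← Real.exp_sub, capExp]
  congr 2
  simp only [sumLogRatio, logRatio, Finset.sum_range, Finset.sum_sub_distrib]
  ring

lemma RegularPotential.refMeasure_eq (hg : RegularPotential g) {lam : Fin n → ℝ}
    (hlam : ∀ i, 0 < lam i) :
    refMeasure g lam = (Measure.pi fun _ : Fin n => marginal g).map (rescale lam) := by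
  have := hg.isProbabilityMeasure_marginal
  have hgm := hg.continuous.measurable
  set f : Fin n → ℝ → ℝ := fun i x => 1 / lam i * Real.exp (-g (x / lam i)) with hf
  have hfm : ∀ i, Measurable (f i) := fun i => by simp only [hf]; fun_prop
  have hf0 : ∀ i x, 0 ≤ f i x := fun i x => by have := hlam i; simp only [hf]; positivity
  have hmap : ∀ i, (marginal g).map (fun u => lam i * u) =
      volume.withDensity fun x => ENNReal.ofReal (f i x) := fun i => by
    have hl := hlam i
    refine Measure.ext_of_lintegral _ fun F hF => ?_
    have hFl : Measurable fun u => F (lam i * u) := hF.comp (by fun_prop)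
    have hc : Measurable fun u => ((fun x => ENNReal.ofReal (f i x)) * F) (lam i * u) :=
      ((hfm i).ennreal_ofReal.mul hF).comp (measurable_const_mul _)
    rw [lintegral_map hF (by fun_prop), marginal,
      lintegral_withDensity_eq_lintegral_mul _ (by fun_prop) hFl,
      lintegral_withDensity_eq_lintegral_mul _ (hfm i).ennreal_ofReal hF]
    conv_rhs => rw [← Real.smul_map_volume_mul_left hl.ne']
    rw [lintegral_smul_measure, lintegral_map ((hfm i).ennreal_ofReal.mul hF) (by fun_prop),
      smul_eq_mul, ← lintegral_const_mul _ hc]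
    refine lintegral_congr fun u => ?_
    simp only [Pi.mul_apply, hf]
    rw [← mul_assoc, ← ENNReal.ofReal_mul (abs_nonneg _), mul_div_cancel_left₀ _ hl.ne',
      abs_of_pos hl, ← mul_assoc, mul_one_div_cancel hl.ne', one_mul]
  have hprob : ∀ i, IsProbabilityMeasure (volume.withDensity fun x => ENNReal.ofReal (f i x)) :=
    fun i => by rw [← hmap]; exact Measure.isProbabilityMeasure_map (by fun_prop)
  have hint : ∀ i, Integrable (f i) := fun i =>
    (hg.integrable_exp.comp_div (hlam i).ne').const_mul _
  have h1 : (Measure.pi fun _ : Fin n => marginal g).map (rescale lam) =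
      Measure.pi fun i => volume.withDensity fun x => ENNReal.ofReal (f i x) :=
    (measurePreserving_pi _ _ fun i => (⟨by fun_prop, hmap i⟩ :
      MeasurePreserving (fun u => lam i * u) (marginal g) _)).map_eq
  rw [h1]
  symm
  -- It suffices to compare boxes, where the integral of the product density factorises.
  refine Measure.pi_eq fun s hs => ?_
  rw [refMeasure, withDensity_apply _ (MeasurableSet.univ_pi hs),
    ← lintegral_indicator (MeasurableSet.univ_pi hs)]
  have hind : ∀ x : Fin n → ℝ, (Set.univ.pi s).indicator
      (fun x => ENNReal.ofReal (refDensity g lam x)) x =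
      ENNReal.ofReal (∏ i, (s i).indicator (f i) (x i)) := fun x => by
    by_cases hx : x ∈ Set.univ.pi s
    · rw [Set.indicator_of_mem hx, refDensity]
      congr 1
      refine Finset.prod_congr rfl fun i _ => ?_
      rw [Set.indicator_of_mem (hx i (Set.mem_univ i))]
    · rw [Set.indicator_of_notMem hx]
      simp only [Set.mem_univ_pi, not_forall] at hx
      obtain ⟨i, hi⟩ := hx
      rw [Finset.prod_eq_zero (Finset.mem_univ i) (Set.indicator_of_notMem hi _),
        ENNReal.ofReal_zero]
  simp_rw [hind]
  rw [volume_pi, ← ofReal_integral_eq_lintegral_ofReal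
    (Integrable.fintype_prod_dep fun i => (hint i).indicator (hs i))
    (ae_of_all _ fun x => Finset.prod_nonneg fun i _ => Set.indicator_nonneg (fun _ _ => hf0 i _) _),
    integral_fintype_prod_eq_prod (fun i => (s i).indicator (f i)),
    ENNReal.ofReal_prod_of_nonneg fun i _ => integral_nonneg fun x =>
      Set.indicator_nonneg (fun _ _ => hf0 i _) _]
  refine Finset.prod_congr rfl fun i _ => ?_
  rw [withDensity_apply _ (hs i), integral_indicator (hs i),
    ofReal_integral_eq_lintegral_ofReal (hint i).restrict (ae_of_all _ fun x => hf0 i x)]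

/-- States and noises of all dimensions are read off one random sequence, so that almost sure limits
as `n → ∞` make sense. -/
lemma RegularPotential.map_state_noise (hg : RegularPotential g) {lam : Fin n → ℝ}
    (hlam : ∀ i, 0 < lam i) :
    (seqLaw g).map (fun w => (state lam w, noise n w)) =
      (refMeasure g lam).prod (Measure.pi fun _ : Fin n => gaussianReal 0 1) := by
  have := hg.isProbabilityMeasure_marginal
  have := hg.isProbabilityMeasure_pairLaw
  have h1 : (seqLaw g).map (fun w (i : Fin n) => w i) = Measure.pi fun _ => pairLaw g := by
    rw [seqLaw, Measure.map_infinitePi_infinitePi_of_inj (P := fun _ : ℕ => pairLaw g)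
      (f := fun i : Fin n => (i : ℕ)) Fin.val_injective, Measure.infinitePi_eq_pi]
  have h2 := measurePreserving_arrowProdEquivProdArrow ℝ ℝ (Fin n) (fun _ => marginal g)
    (fun _ => gaussianReal 0 1)
  have hres : Measurable (rescale lam) := by unfold rescale; fun_prop
  have h3 : (fun w => (state lam w, noise n w)) =
      (Prod.map (rescale lam) id ∘ MeasurableEquiv.arrowProdEquivProdArrow ℝ ℝ (Fin n)) ∘
        fun (w : ℕ → ℝ × ℝ) (i : Fin n) => w i := rfl
  rw [h3, ← Measure.map_map ((hres.prodMap measurable_id).comp h2.measurable) (by fun_prop), h1,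
    ← Measure.map_map (hres.prodMap measurable_id) h2.measurable]
  change (((Measure.pi fun _ => (marginal g).prod (gaussianReal 0 1)).map _).map _) = _
  rw [h2.map_eq, ← Measure.map_prod_map _ _ hres measurable_id, hg.refMeasure_eq hlam,
    Measure.map_id]

/-- The randomness of one step in terms of the sequence of rescaled coordinates and noises. -/
def toStep (lam : Fin n → ℝ) (q : (ℕ → ℝ × ℝ) × ℝ) : StepSpace n :=
  (state lam q.1, noise n q.1, q.2)

lemma measurable_toStep (lam : Fin n → ℝ) : Measurable (toStep lam) := by
  have := measurable_state lam
  have := measurable_noise (n := n)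
  unfold toStep; fun_prop

/-- The joint law of the sequence of rescaled coordinates and noises and of the uniform variable. -/
def fullLaw (g : ℝ → ℝ) : Measure ((ℕ → ℝ × ℝ) × ℝ) :=
  (seqLaw g).prod (volume.restrict (Set.Icc (0 : ℝ) 1))

/-- Expectations under the target become weighted expectations on a space that does not depend on
`n`; the change of measure acts on the state alone. -/
lemma RegularPotential.stepLaw_eq (hg : RegularPotential g) {lam : Fin n → ℝ}
    (hlam : ∀ i, 0 < lam i) {φ : (Fin n → ℝ) → ℝ} (hφ : Measurable φ) :
    stepLaw g lam φ = ((fullLaw g).map (toStep lam)).withDensity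
      fun w => ((Real.exp (-φ w.1)).toNNReal : ENNReal) := by
  have := hg.isProbabilityMeasure_seqLaw
  have hsf : SFinite (refMeasure g lam) := by unfold refMeasure; infer_instance
  have hsn : Measurable fun w => (state lam w, noise n w) :=
    (measurable_state lam).prodMk measurable_noise
  have h1 : (fullLaw g).map (toStep lam) = (refMeasure g lam).prod
      ((Measure.pi fun _ : Fin n => gaussianReal 0 1).prod
        (volume.restrict (Set.Icc (0 : ℝ) 1))) := by
    rw [← Measure.prodAssoc_prod, ← hg.map_state_noise hlam]
    conv_rhs =>
      rw [← Measure.map_id (μ := volume.restrict (Set.Icc (0 : ℝ) 1)),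
        Measure.map_prod_map _ _ hsn measurable_id,
        Measure.map_map MeasurableEquiv.prodAssoc.measurable (hsn.prodMap measurable_id)]
    rfl
  rw [h1, stepLaw, target]
  exact prod_withDensity_left (by fun_prop)

lemma RegularPotential.integral_stepLaw (hg : RegularPotential g) {lam : Fin n → ℝ}
    (hlam : ∀ i, 0 < lam i) {φ : (Fin n → ℝ) → ℝ} (hφ : Measurable φ) {F : StepSpace n → ℝ}
    (hF : Measurable F) :
    ∫ w, F w ∂(stepLaw g lam φ) =
      ∫ q, Real.exp (-φ (state lam q.1)) * F (toStep lam q) ∂(fullLaw g) := by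
  have hT := measurable_toStep lam
  rw [hg.stepLaw_eq hlam hφ, integral_withDensity_eq_integral_smul (by fun_prop),
    integral_map hT.aemeasurable (by
      have : Measurable fun w : StepSpace n => (Real.exp (-φ w.1)).toNNReal := by fun_prop
      exact (this.smul hF).aestronglyMeasurable)]
  refine integral_congr_ae (ae_of_all _ fun q => ?_)
  simp [NNReal.smul_def, Real.coe_toNNReal _ (Real.exp_pos _).le, toStep]

lemma RegularPotential.integrable_stepLaw_iff (hg : RegularPotential g) {lam : Fin n → ℝ}
    (hlam : ∀ i, 0 < lam i) {φ : (Fin n → ℝ) → ℝ} (hφ : Measurable φ) {F : StepSpace n → ℝ}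
    (hF : Measurable F) :
    Integrable F (stepLaw g lam φ) ↔
      Integrable (fun q => Real.exp (-φ (state lam q.1)) * F (toStep lam q)) (fullLaw g) := by
  have hT := measurable_toStep lam
  have hm : Measurable fun w : StepSpace n => (Real.exp (-φ w.1)).toNNReal := by fun_prop
  have hm' : AEStronglyMeasurable (fun w : StepSpace n => (Real.exp (-φ w.1)).toNNReal • F w)
      ((fullLaw g).map (toStep lam)) := (hm.smul hF).aestronglyMeasurable
  rw [hg.stepLaw_eq hlam hφ, integrable_withDensity_iff_integrable_smul (by fun_prop),
    integrable_map_measure hm' hT.aemeasurable]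
  refine integrable_congr (ae_of_all _ fun q => ?_)
  simp [NNReal.smul_def, Real.coe_toNNReal _ (Real.exp_pos _).le, toStep]

end

/-! ### Asymptotic independence of the weight and the sum. -/

section

/-- Asymptotic independence: a bounded weight that is approximated, uniformly in `n`, by functions
of finitely many coordinates decouples from sums of individually negligible terms. -/
lemma tendsto_integral_decouple {E : Type*} [MeasurableSpace E] (ν : Measure E)
    [IsProbabilityMeasure ν] {D : ℕ → (ℕ → E) → ℝ} {D' : ∀ k : ℕ, ℕ → (Finset.range k → E) → ℝ}
    {B : ℝ} {N : ℕ} (hDm : ∀ n, Measurable (D n)) (hDm' : ∀ k n, Measurable (D' k n))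
    (hDB : ∀ n ≥ N, ∀ w, |D n w| ≤ B) (hDB' : ∀ k, ∀ n ≥ N, ∀ x, |D' k n x| ≤ B)
    (happ : ∀ᵐ w ∂(Measure.infinitePi fun _ : ℕ => ν),
      Tendsto (fun q : ℕ × ℕ => D q.2 w - D' q.1 q.2 fun i => w i) (atTop ×ˢ atTop) (𝓝 0))
    {r : ℕ → E → ℝ} (hrm : ∀ n, Measurable (r n)) (hr0 : ∀ p, Tendsto (fun n => r n p) atTop (𝓝 0))
    {v : E → ℝ} (hvm : Measurable v) (hvi : Integrable v ν) (j : ℕ) :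
    Tendsto (fun n => ∫ w, D n w * v (w j) * capExp (∑ i ∈ Finset.range n, r n (w i))
        ∂(Measure.infinitePi fun _ : ℕ => ν)
      - (∫ w, D n w * v (w j) ∂(Measure.infinitePi fun _ : ℕ => ν)) *
        ∫ w, capExp (∑ i ∈ Finset.range n, r n (w i)) ∂(Measure.infinitePi fun _ : ℕ => ν))
      atTop (𝓝 0) := by
  set P : Measure (ℕ → E) := Measure.infinitePi fun _ : ℕ => ν with hP
  have hB : 0 ≤ B := by
    obtain ⟨w⟩ : Nonempty (ℕ → E) := nonempty_of_isProbabilityMeasure P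
    exact (abs_nonneg _).trans (hDB N le_rfl w)
  have hV : Integrable (fun w : ℕ → E => v (w j)) P :=
    (measurePreserving_eval_infinitePi (fun _ : ℕ => ν) j).integrable_comp_of_integrable hvi
  have hVm : Measurable fun w : ℕ → E => v (w j) := hvm.comp (measurable_pi_apply j)
  have hrs : ∀ n (s : Finset ℕ), Measurable fun w : ℕ → E => capExp (∑ i ∈ s, r n (w i)) :=
    fun n s => continuous_capExp.measurable.comp
      (Finset.measurable_sum _ fun i _ => (hrm n).comp (measurable_pi_apply i))
  have hDk : ∀ k n, Measurable fun w : ℕ → E => D' k n fun i => w i := fun k n =>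
    (hDm' k n).comp (by fun_prop)
  -- the three error terms
  have T1 : Tendsto (fun q : ℕ × ℕ => ∫ w, |D q.2 w - D' q.1 q.2 fun i => w i| * |v (w j)| ∂P)
      (atTop ×ˢ atTop) (𝓝 0) := by
    have := tendsto_integral_filter_of_dominated_convergence (μ := P)
      (F := fun (q : ℕ × ℕ) w => |D q.2 w - D' q.1 q.2 fun i => w i| * |v (w j)|)
      (f := fun _ => (0 : ℝ)) (l := atTop ×ˢ atTop) (fun w => 2 * B * |v (w j)|) ?_ ?_
      (hV.abs.const_mul _) ?_
    · simpa using this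
    · exact Eventually.of_forall fun q =>
        (((hDm q.2).sub (hDk q.1 q.2)).norm.mul hVm.norm).aestronglyMeasurable
    · filter_upwards [tendsto_snd.eventually (eventually_ge_atTop N)] with q hq
      refine ae_of_all _ fun w => ?_
      rw [norm_mul, Real.norm_eq_abs, abs_abs, Real.norm_eq_abs, abs_abs]
      gcongr
      refine (abs_sub _ _).trans ?_
      have := hDB _ hq w
      have := hDB' q.1 _ hq fun i => w i
      linarith
    · filter_upwards [happ] with w hw
      have := hw.abs.mul_const |v (w j)|
      simpa using this
  -- For fixed `k` the first `k` terms of the sum vanish as `n → ∞`, so they may be dropped.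
  have hpt : ∀ (k : ℕ) (w : ℕ → E), Tendsto (fun n => capExp (∑ i ∈ Finset.range n, r n (w i))
      - capExp (∑ i ∈ Finset.Ico k n, r n (w i))) atTop (𝓝 0) := fun k w => by
    have h0 : Tendsto (fun n => |∑ i ∈ Finset.range k, r n (w i)|) atTop (𝓝 0) := by
      have := tendsto_finsetSum (Finset.range k) fun i _ => hr0 (w i)
      simpa using this.abs
    refine squeeze_zero_norm' ?_ h0
    filter_upwards [eventually_ge_atTop k] with n hn
    refine (abs_capExp_sub_le _ _).trans_eq ?_
    rw [← Finset.sum_range_add_sum_Ico _ hn, add_sub_cancel_right]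
  have T2 : ∀ (k : ℕ) (F : (ℕ → E) → ℝ), Measurable F → Integrable F P →
      Tendsto (fun n => ∫ w, |F w| * |capExp (∑ i ∈ Finset.range n, r n (w i))
        - capExp (∑ i ∈ Finset.Ico k n, r n (w i))| ∂P) atTop (𝓝 0) := fun k F hFm hF => by
    have := tendsto_integral_filter_of_dominated_convergence (μ := P)
      (F := fun (n : ℕ) w => |F w| * |capExp (∑ i ∈ Finset.range n, r n (w i))
        - capExp (∑ i ∈ Finset.Ico k n, r n (w i))|)
      (f := fun _ => (0 : ℝ)) (l := atTop) (fun w => 2 * |F w|) ?_ ?_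
      (hF.abs.const_mul _) ?_
    · simpa using this
    · exact Eventually.of_forall fun n =>
        (hFm.norm.mul ((hrs n _).sub (hrs n _)).norm).aestronglyMeasurable
    · refine Eventually.of_forall fun n => ae_of_all _ fun w => ?_
      rw [norm_mul, Real.norm_eq_abs, abs_abs, Real.norm_eq_abs, abs_abs, mul_comm]
      gcongr
      refine (abs_sub _ _).trans ?_
      have := abs_capExp_le (∑ i ∈ Finset.range n, r n (w i))
      have := abs_capExp_le (∑ i ∈ Finset.Ico k n, r n (w i))
      linarith
    · refine ae_of_all _ fun w => ?_
      have := (hpt k w).abs.const_mul |F w|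
      simpa using this
  -- Exact independence: the approximate weight and `v (w j)` use coordinates below `k`, the
  -- shortened sum only those from `k` on.
  have hind : ∀ k n, j < k →
      ∫ w, (D' k n fun i => w i) * v (w j) * capExp (∑ i ∈ Finset.Ico k n, r n (w i)) ∂P =
      (∫ w, (D' k n fun i => w i) * v (w j) ∂P) *
        ∫ w, capExp (∑ i ∈ Finset.Ico k n, r n (w i)) ∂P := fun k n hjk => by
    have hI : iIndepFun (fun (i : ℕ) (w : ℕ → E) => w i) P :=
      iIndepFun_infinitePi (X := fun _ x => x) fun _ => measurable_id
    have hd : Disjoint (Finset.range k) (Finset.Ico k n) := by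
      rw [Finset.disjoint_left]
      intro i hi hi'
      rw [Finset.mem_range] at hi
      rw [Finset.mem_Ico] at hi'
      omega
    have h1 := hI.indepFun_finset _ _ hd fun i => measurable_pi_apply i
    have h2 := h1.comp (φ := fun x : Finset.range k → E =>
        D' k n x * v (x ⟨j, Finset.mem_range.2 hjk⟩))
      (ψ := fun x : Finset.Ico k n → E => capExp (∑ i, r n (x i)))
      ((hDm' k n).mul (hvm.comp (measurable_pi_apply _)))
      (continuous_capExp.measurable.comp
        (Finset.measurable_sum _ fun i _ => (hrm n).comp (measurable_pi_apply i)))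
    have h3 := h2.integral_fun_mul_eq_mul_integral
      (((hDk k n).mul hVm).aestronglyMeasurable) (by
        have := (hrs n (Finset.Ico k n)).aestronglyMeasurable (μ := P)
        convert this using 3 with w
        exact congrArg capExp (Finset.sum_coe_sort (Finset.Ico k n) fun i => r n (w i)))
    have h4 : ∀ w : ℕ → E, capExp (∑ i ∈ Finset.Ico k n, r n (w i)) =
        capExp (∑ i : Finset.Ico k n, r n (w i)) := fun w =>
      congrArg capExp (Finset.sum_coe_sort (Finset.Ico k n) fun i => r n (w i)).symm
    simp_rw [h4]
    exact h3
  -- combination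
  set A := ∫ w, |v (w j)| ∂P with hA
  have hA0 : 0 ≤ A := integral_nonneg fun _ => abs_nonneg _
  rw [Metric.tendsto_atTop']
  intro ε hε
  -- The joint limit in `(k, n)` is curried so that `k > j` is fixed first and `n` is sent to
  -- infinity afterwards.
  have e1 : ∀ᶠ k in atTop, ∀ᶠ n in atTop,
      ∫ w, |D n w - D' k n fun i => w i| * |v (w j)| ∂P < ε / 8 :=
    (T1.eventually_lt_const (by positivity : 0 < ε / 8)).curry
  obtain ⟨k, hk1, hk2⟩ := (e1.and (eventually_gt_atTop j)).exists
  have t2 := (T2 k _ hVm hV).const_mul B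
  have t3 := (T2 k (fun _ => 1) measurable_const (integrable_const _)).const_mul (B * A)
  rw [mul_zero] at t2 t3
  have hev := hk1.and ((t2.eventually_lt_const (by positivity : 0 < ε / 8)).and
    ((t3.eventually_lt_const (by positivity : 0 < ε / 8)).and (eventually_ge_atTop N)))
  obtain ⟨N', hN'⟩ := eventually_atTop.1 hev
  refine ⟨N', fun n hn => ?_⟩
  obtain ⟨h1, h2, h3, hNn⟩ := hN' n hn.le
  have iDV : ∀ {F : (ℕ → E) → ℝ}, Measurable F → (∀ w, |F w| ≤ B) →
      Integrable (fun w => F w * v (w j)) P := fun {F} hFm hF =>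
    hV.bdd_mul hFm.aestronglyMeasurable (ae_of_all _ hF)
  have i1 := iDV (hDm n) (hDB n hNn)
  have i2 := iDV (hDk k n) fun w => hDB' k n hNn _
  have i3 : Integrable (fun w => |D n w - D' k n fun i => w i| * |v (w j)|) P := by
    refine (i1.sub i2).abs.congr (ae_of_all _ fun w => ?_)
    simp only [Pi.sub_apply]
    rw [← sub_mul, abs_mul]
  have ih : ∀ s : Finset ℕ, Integrable (fun w => capExp (∑ i ∈ s, r n (w i))) P := fun s =>
    (integrable_const (1 : ℝ)).mono' (hrs n s).aestronglyMeasurable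
      (ae_of_all _ fun w => abs_capExp_le _)
  have i4 : Integrable (fun w => D n w * v (w j) * capExp (∑ i ∈ Finset.range n, r n (w i))) P :=
    i1.mul_bdd (c := 1) (hrs n _).aestronglyMeasurable (ae_of_all _ fun w => abs_capExp_le _)
  have i5 : Integrable (fun w => (D' k n fun i => w i) * v (w j) *
      capExp (∑ i ∈ Finset.Ico k n, r n (w i))) P :=
    i2.mul_bdd (c := 1) (hrs n _).aestronglyMeasurable (ae_of_all _ fun w => abs_capExp_le _)
  have i6 : ∀ F : (ℕ → E) → ℝ, Measurable F → Integrable F P → Integrable (fun w => |F w| *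
      |capExp (∑ i ∈ Finset.range n, r n (w i)) - capExp (∑ i ∈ Finset.Ico k n, r n (w i))|) P :=
    fun F hFm hF => hF.abs.mul_bdd (c := 2) ((hrs n _).sub (hrs n _)).norm.aestronglyMeasurable
      (ae_of_all _ fun w => by
        rw [Real.norm_eq_abs, abs_abs]
        refine (abs_sub _ _).trans ?_
        have := abs_capExp_le (∑ i ∈ Finset.range n, r n (w i))
        have := abs_capExp_le (∑ i ∈ Finset.Ico k n, r n (w i))
        linarith)
  have b1 : |∫ w, D n w * v (w j) * capExp (∑ i ∈ Finset.range n, r n (w i)) ∂P -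
      ∫ w, (D' k n fun i => w i) * v (w j) * capExp (∑ i ∈ Finset.Ico k n, r n (w i)) ∂P| ≤
      ∫ w, |D n w - D' k n fun i => w i| * |v (w j)| ∂P +
      B * ∫ w, |v (w j)| * |capExp (∑ i ∈ Finset.range n, r n (w i))
        - capExp (∑ i ∈ Finset.Ico k n, r n (w i))| ∂P := by
    rw [← integral_sub i4 i5, ← integral_const_mul, ← integral_add i3 ((i6 _ hVm hV).const_mul B)]
    refine (abs_integral_le_integral_abs).trans (integral_mono (i4.sub i5).abs
      (i3.add ((i6 _ hVm hV).const_mul B)) fun w => ?_)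
    have hb := hDB' k n hNn fun i => w i
    have hc := abs_capExp_le (∑ i ∈ Finset.range n, r n (w i))
    simp only
    generalize capExp (∑ i ∈ Finset.range n, r n (w i)) = a at *
    generalize capExp (∑ i ∈ Finset.Ico k n, r n (w i)) = b at *
    generalize (D' k n fun i => w i) = d' at *
    generalize D n w = d
    generalize v (w j) = x
    calc |d * x * a - d' * x * b| = |(d - d') * x * a + d' * (x * (a - b))| := by ring_nf
      _ ≤ |(d - d') * x * a| + |d' * (x * (a - b))| := abs_add_le _ _
      _ = |d - d'| * |x| * |a| + |d'| * (|x| * |a - b|) := by simp only [abs_mul]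
      _ ≤ |d - d'| * |x| * 1 + B * (|x| * |a - b|) := by gcongr
      _ = _ := by rw [mul_one]
  have b2 : |∫ w, (D' k n fun i => w i) * v (w j) ∂P - ∫ w, D n w * v (w j) ∂P| ≤
      ∫ w, |D n w - D' k n fun i => w i| * |v (w j)| ∂P := by
    rw [← integral_sub i2 i1]
    refine (abs_integral_le_integral_abs).trans_eq (integral_congr_ae (ae_of_all _ fun w => ?_))
    simp only
    rw [← sub_mul, abs_mul, abs_sub_comm]
  have b3 : |∫ w, capExp (∑ i ∈ Finset.Ico k n, r n (w i)) ∂P -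
      ∫ w, capExp (∑ i ∈ Finset.range n, r n (w i)) ∂P| ≤
      ∫ w, |(fun _ => 1 : (ℕ → E) → ℝ) w| * |capExp (∑ i ∈ Finset.range n, r n (w i))
        - capExp (∑ i ∈ Finset.Ico k n, r n (w i))| ∂P := by
    rw [← integral_sub (ih _) (ih _)]
    refine (abs_integral_le_integral_abs).trans_eq (integral_congr_ae (ae_of_all _ fun w => ?_))
    simp only [abs_one, one_mul]
    rw [abs_sub_comm]
  have b4 : |∫ w, D n w * v (w j) ∂P| ≤ B * A := by
    refine (abs_integral_le_integral_abs).trans ?_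
    rw [hA, ← integral_const_mul]
    refine integral_mono i1.abs (hV.abs.const_mul B) fun w => ?_
    simp only [abs_mul]
    gcongr
    exact hDB n hNn w
  have b5 : |∫ w, capExp (∑ i ∈ Finset.Ico k n, r n (w i)) ∂P| ≤ 1 := by
    refine (abs_integral_le_integral_abs).trans ?_
    calc _ ≤ ∫ _, (1 : ℝ) ∂P :=
          integral_mono (ih _).abs (integrable_const _) fun w => abs_capExp_le _
      _ = 1 := by simp
  rw [hind k n hk2] at b1
  rw [Real.dist_eq, sub_zero]
  have hmul : ∀ {x y : ℝ}, |x| ≤ 1 → |x * y| ≤ |y| := fun {x y} hx => by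
    rw [abs_mul]; exact mul_le_of_le_one_left (abs_nonneg y) hx
  generalize hX : ∫ w, D n w * v (w j) * capExp (∑ i ∈ Finset.range n, r n (w i)) ∂P = X at *
  generalize hX1 : ∫ w, D n w * v (w j) ∂P = X1 at *
  generalize hX2 : ∫ w, capExp (∑ i ∈ Finset.range n, r n (w i)) ∂P = X2 at *
  generalize hY1 : ∫ w, (D' k n fun i => w i) * v (w j) ∂P = Y1 at *
  generalize hY2 : ∫ w, capExp (∑ i ∈ Finset.Ico k n, r n (w i)) ∂P = Y2 at *
  have c1 : X - X1 * X2 = (X - Y1 * Y2) + Y2 * (Y1 - X1) + X1 * (Y2 - X2) := by ring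
  have c2 : |Y2 * (Y1 - X1)| ≤ |Y1 - X1| := hmul b5
  have c3 : |X1 * (Y2 - X2)| ≤ B * A * |Y2 - X2| := by
    rw [abs_mul]; gcongr
  have c4 : B * A * |Y2 - X2| ≤ ε / 8 :=
    (mul_le_mul_of_nonneg_left b3 (mul_nonneg hB hA0)).trans h3.le
  rw [c1]
  refine (abs_add_three _ _ _).trans_lt ?_
  linarith

end

/-! ### Acceptance rate and squared jump as integrals over the sequence space. -/

section

variable {g : ℝ → ℝ} {alg : Algorithm} {n : ℕ}

lemma RegularPotential.measurable_proposalMean (hg : RegularPotential g) (lam : Fin n → ℝ) (s : ℝ)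
    (i : Fin n) : Measurable fun x : Fin n → ℝ => proposalMean alg g lam s x i := by
  have h := (hg.continuous_iteratedDeriv 1).measurable
  rw [iteratedDeriv_one] at h
  cases alg <;> unfold proposalMean <;> fun_prop

lemma RegularPotential.measurable_acceptProb (hg : RegularPotential g) (lam : Fin n → ℝ) (s : ℝ)
    {φ : (Fin n → ℝ) → ℝ} (hφ : Measurable φ) :
    Measurable fun p : (Fin n → ℝ) × (Fin n → ℝ) => acceptProb alg g lam s φ p.1 p.2 := by
  have hgm := hg.continuous.measurable
  have hm := hg.measurable_proposalMean (alg := alg) lam s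
  have hq : Measurable fun p : (Fin n → ℝ) × (Fin n → ℝ) =>
      targetDensity g lam φ p.1 * proposalDensity alg g lam s p.1 p.2 := by
    refine Measurable.mul ?_ (Finset.measurable_prod _ fun i _ => ?_)
    · unfold targetDensity refDensity; fun_prop
    · have := (hm i).comp (measurable_fst : Measurable (Prod.fst : (Fin n → ℝ) × (Fin n → ℝ) → _))
      unfold gaussianPDFReal
      simp only [Function.comp_def] at this
      fun_prop
  have hq' : Measurable fun p : (Fin n → ℝ) × (Fin n → ℝ) =>
      targetDensity g lam φ p.2 * proposalDensity alg g lam s p.2 p.1 := hq.comp measurable_swap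
  unfold acceptProb
  exact Measurable.ite (measurableSet_lt measurable_const hq)
    (measurable_const.min (hq'.div hq)) measurable_const

lemma RegularPotential.measurable_proposal (hg : RegularPotential g) (lam : Fin n → ℝ) (s : ℝ) :
    Measurable fun w : StepSpace n => proposal alg g lam s w.1 w.2.1 := by
  unfold proposal
  refine measurable_pi_lambda _ fun i => ?_
  have := (hg.measurable_proposalMean (alg := alg) lam s i).comp
    (measurable_fst : Measurable (Prod.fst : StepSpace n → _))
  simp only [Function.comp_def] at this
  fun_prop

lemma RegularPotential.measurable_stepAccept (hg : RegularPotential g) (lam : Fin n → ℝ) (s : ℝ)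
    {φ : (Fin n → ℝ) → ℝ} (hφ : Measurable φ) : Measurable (stepAccept alg g lam s φ) :=
  (hg.measurable_acceptProb lam s hφ).comp (measurable_fst.prodMk (hg.measurable_proposal lam s))

lemma RegularPotential.measurable_sqJump (hg : RegularPotential g) (lam : Fin n → ℝ) (s : ℝ)
    {φ : (Fin n → ℝ) → ℝ} (hφ : Measurable φ) (i : Fin n) :
    Measurable (sqJump alg g lam s φ i) := by
  have h1 : Measurable (nextState alg g lam s φ) := by
    unfold nextState
    exact Measurable.ite (measurableSet_le (measurable_snd.comp measurable_snd)
      (hg.measurable_stepAccept lam s hφ)) (hg.measurable_proposal lam s) measurable_fst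
  unfold sqJump
  fun_prop

/-- The acceptance probability as a function of the rescaled coordinates and noises. -/
def seqAccept (alg : Algorithm) (g : ℝ → ℝ) (lam : Fin n → ℝ) (s : ℝ) (φ : (Fin n → ℝ) → ℝ)
    (w : ℕ → ℝ × ℝ) : ℝ :=
  capExp (sumLogRatio alg g s n w + (φ (state lam w) - φ (movedState alg g lam s w)))

lemma RegularPotential.measurable_seqAccept (hg : RegularPotential g) (lam : Fin n → ℝ) (s : ℝ)
    {φ : (Fin n → ℝ) → ℝ} (hφ : Measurable φ) : Measurable (seqAccept alg g lam s φ) :=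
  continuous_capExp.measurable.comp ((hg.measurable_sumLogRatio s n).add
    ((hφ.comp (measurable_state lam)).sub (hφ.comp (hg.measurable_movedState lam s))))

lemma stepAccept_toStep {lam : Fin n → ℝ} (hlam : ∀ i, 0 < lam i) {s : ℝ} (hs : 0 < s)
    (φ : (Fin n → ℝ) → ℝ) (q : (ℕ → ℝ × ℝ) × ℝ) :
    stepAccept alg g lam s φ (toStep lam q) = seqAccept alg g lam s φ q.1 := by
  simp only [stepAccept, toStep, proposal_state hlam, acceptProb_eq hlam hs, seqAccept]

/-- Division by `λ_i` removes the scale, and a rejected move contributes nothing. -/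
lemma sqJump_toStep {lam : Fin n → ℝ} (hlam : ∀ i, 0 < lam i) {s : ℝ} (hs : 0 < s)
    (φ : (Fin n → ℝ) → ℝ) (i : Fin n) (q : (ℕ → ℝ × ℝ) × ℝ) :
    sqJump alg g lam s φ i (toStep lam q) =
      s ^ 2 * ((q.1 i).2 + s * drift alg g (q.1 i).1) ^ 2 *
        (Set.Iic (seqAccept alg g lam s φ q.1)).indicator 1 q.2 := by
  have h0 := (hlam i).ne'
  have hd : (toStep lam q).2.2 = q.2 := rfl
  have ha := stepAccept_toStep (alg := alg) (g := g) hlam hs φ q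
  by_cases h : q.2 ≤ seqAccept alg g lam s φ q.1
  · rw [sqJump, nextState, if_pos (by rw [ha, hd]; exact h), Set.indicator_of_mem (Set.mem_Iic.2 h)]
    simp only [toStep, proposal_state hlam]
    simp only [movedState, state, rescale, move, Pi.one_apply]
    field_simp
    ring
  · rw [sqJump, nextState, if_neg (by rw [ha, hd]; exact h), Set.indicator_of_notMem (by simpa using h)]
    simp

lemma seqAccept_nonneg (lam : Fin n → ℝ) (s : ℝ) (φ : (Fin n → ℝ) → ℝ) (w : ℕ → ℝ × ℝ) :
    0 ≤ seqAccept alg g lam s φ w := capExp_nonneg _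

lemma seqAccept_le_one (lam : Fin n → ℝ) (s : ℝ) (φ : (Fin n → ℝ) → ℝ) (w : ℕ → ℝ × ℝ) :
    seqAccept alg g lam s φ w ≤ 1 := capExp_le_one _

lemma isProbabilityMeasure_unif :
    IsProbabilityMeasure (volume.restrict (Set.Icc (0 : ℝ) 1)) := ⟨by simp⟩

lemma RegularPotential.isProbabilityMeasure_fullLaw (hg : RegularPotential g) :
    IsProbabilityMeasure (fullLaw g) := by
  have := hg.isProbabilityMeasure_seqLaw
  have := isProbabilityMeasure_unif
  unfold fullLaw; infer_instance

lemma RegularPotential.meanAccept_eq (hg : RegularPotential g) {lam : Fin n → ℝ}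
    (hlam : ∀ i, 0 < lam i) {s : ℝ} (hs : 0 < s) {φ : (Fin n → ℝ) → ℝ} (hφ : Measurable φ) :
    meanAccept alg g lam s φ =
      ∫ w, Real.exp (-φ (state lam w)) * seqAccept alg g lam s φ w ∂(seqLaw g) := by
  have := hg.isProbabilityMeasure_seqLaw
  have := isProbabilityMeasure_unif
  rw [meanAccept, hg.integral_stepLaw hlam hφ (hg.measurable_stepAccept lam s hφ)]
  simp_rw [stepAccept_toStep hlam hs]
  rw [fullLaw, integral_fun_fst (μ := seqLaw g) (ν := volume.restrict (Set.Icc (0 : ℝ) 1))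
    (fun w => Real.exp (-φ (state lam w)) * seqAccept alg g lam s φ w)]
  simp

lemma RegularPotential.integrable_stepAccept (hg : RegularPotential g) {lam : Fin n → ℝ}
    (hlam : ∀ i, 0 < lam i) {s : ℝ} (hs : 0 < s) {φ : (Fin n → ℝ) → ℝ} (hφ : Measurable φ)
    {M : ℝ} (hM : ∀ x, M ≤ φ x) :
    Integrable (stepAccept alg g lam s φ) (stepLaw g lam φ) := by
  have := hg.isProbabilityMeasure_fullLaw
  have hst := measurable_state lam
  have ha := hg.measurable_seqAccept (alg := alg) lam s hφ
  rw [hg.integrable_stepLaw_iff hlam hφ (hg.measurable_stepAccept lam s hφ)]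
  simp_rw [stepAccept_toStep hlam hs]
  refine (integrable_const (Real.exp (-M))).mono' (Measurable.aestronglyMeasurable (by fun_prop))
    (ae_of_all _ fun q => ?_)
  rw [Real.norm_of_nonneg (mul_nonneg (Real.exp_pos _).le (seqAccept_nonneg ..))]
  calc _ ≤ Real.exp (-M) * 1 := by
        gcongr
        · exact seqAccept_nonneg ..
        · exact hM _
        · exact seqAccept_le_one ..
    _ = _ := mul_one _

/-- A weight dominating all quantities attached to one coordinate. -/
structure Dominates (alg : Algorithm) (g : ℝ → ℝ) (L : ℝ × ℝ → ℝ) : Prop where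
  measurable : Measurable L
  one_le : ∀ p, 1 ≤ L p
  integrable_pow : ∀ k : ℕ, Integrable (fun p => L p ^ k) (pairLaw g)
  fst_le : ∀ p : ℝ × ℝ, |p.1| ≤ L p
  snd_le : ∀ p : ℝ × ℝ, |p.2| ≤ L p
  drift_le : ∀ p : ℝ × ℝ, |drift alg g p.1| ≤ L p

lemma RegularPotential.exists_dominates (hg : RegularPotential g) (alg : Algorithm) :
    ∃ L, Dominates alg g L := by
  obtain ⟨L, h1, h2, h3, h⟩ := exists_logRatio_bound hg alg
  exact ⟨L, h1, h2, h3, fun p => (h p).1, fun p => (h p).2.1, fun p => (h p).2.2.1⟩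

namespace Dominates

variable {L : ℝ × ℝ → ℝ}

lemma abs_jump_le (hL : Dominates alg g L) {s : ℝ} (hs : 0 < s) (hs1 : s ≤ 1) (p : ℝ × ℝ) :
    |p.2 + s * drift alg g p.1| ≤ 2 * L p := by
  have h1 := hL.snd_le p
  have h2 := hL.drift_le p
  have h3 : |s * drift alg g p.1| ≤ 1 * L p := abs_mul_le_mul (by rwa [abs_of_pos hs]) h2
  refine (abs_add_le _ _).trans ?_
  linarith

lemma sq_jump_le (hL : Dominates alg g L) {s : ℝ} (hs : 0 < s) (hs1 : s ≤ 1) (p : ℝ × ℝ) :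
    (p.2 + s * drift alg g p.1) ^ 2 ≤ 4 * L p ^ 2 := by
  rw [← sq_abs]
  calc |p.2 + s * drift alg g p.1| ^ 2 ≤ (2 * L p) ^ 2 := by
        gcongr; exact hL.abs_jump_le hs hs1 p
    _ = _ := by ring

lemma abs_move_sub_le (hL : Dominates alg g L) {s : ℝ} (hs : 0 < s) (hs1 : s ≤ 1) (p : ℝ × ℝ) :
    |move alg g s p - p.1| ≤ 2 * s * L p := by
  have : move alg g s p - p.1 = s * (p.2 + s * drift alg g p.1) := by unfold move; ring
  rw [this]
  refine (abs_mul_le_mul (abs_of_pos hs).le (hL.abs_jump_le hs hs1 p)).trans_eq ?_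
  ring

lemma abs_move_le (hL : Dominates alg g L) {s : ℝ} (hs : 0 < s) (hs1 : s ≤ 1) (p : ℝ × ℝ) :
    |move alg g s p| ≤ 3 * L p := by
  have h1 := hL.abs_move_sub_le hs hs1 p
  have h2 := hL.fst_le p
  have h3 := hL.one_le p
  have : |move alg g s p| ≤ |move alg g s p - p.1| + |p.1| := by
    simpa using abs_add_le (move alg g s p - p.1) p.1
  nlinarith

lemma integrable_pow_eval (hg : RegularPotential g) (hL : Dominates alg g L) (k i : ℕ) :
    Integrable (fun w : ℕ → ℝ × ℝ => L (w i) ^ k) (seqLaw g) :=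
  (hg.measurePreserving_eval i).integrable_comp_of_integrable (hL.integrable_pow k)

lemma integral_pow_eval (hg : RegularPotential g) (hL : Dominates alg g L) (k i : ℕ) :
    ∫ w, L (w i) ^ k ∂(seqLaw g) = ∫ p, L p ^ k ∂(pairLaw g) := by
  have he := hg.measurePreserving_eval i
  have := hL.measurable
  rw [← he.map_eq, integral_map he.measurable.aemeasurable (by fun_prop)]

end Dominates

lemma RegularPotential.integrable_mul_sqJump (hg : RegularPotential g) {L : ℝ × ℝ → ℝ}
    (hL : Dominates alg g L) {lam : Fin n → ℝ} (hlam : ∀ i, 0 < lam i) {s : ℝ} (hs : 0 < s)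
    (hs1 : s ≤ 1) {φ : (Fin n → ℝ) → ℝ} (hφ : Measurable φ) {M : ℝ} (hM : ∀ x, M ≤ φ x)
    (i : Fin n) :
    Integrable (fun q => Real.exp (-φ (state lam q.1)) *
      sqJump alg g lam s φ i (toStep lam q)) (fullLaw g) := by
  have := isProbabilityMeasure_unif
  have h1 : Integrable (fun q : (ℕ → ℝ × ℝ) × ℝ => L (q.1 i) ^ 2) (fullLaw g) :=
    (hL.integrable_pow_eval hg 2 i).comp_fst _
  have hm : Measurable fun q => Real.exp (-φ (state lam q.1)) *
      sqJump alg g lam s φ i (toStep lam q) := by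
    have := measurable_state lam
    have h := (hg.measurable_sqJump (alg := alg) lam s hφ i).comp (measurable_toStep lam)
    simp only [Function.comp_def] at h
    fun_prop
  refine (h1.const_mul (Real.exp (-M) * (s ^ 2 * 4))).mono' hm.aestronglyMeasurable
    (ae_of_all _ fun q => ?_)
  have hnn : 0 ≤ sqJump alg g lam s φ i (toStep lam q) := sq_nonneg _
  rw [Real.norm_of_nonneg (mul_nonneg (Real.exp_pos _).le hnn), mul_assoc (Real.exp (-M))]
  gcongr
  · exact hM _
  · rw [sqJump_toStep hlam hs]
    have h2 := hL.sq_jump_le hs hs1 (q.1 i)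
    have h3 : (Set.Iic (seqAccept alg g lam s φ q.1)).indicator (1 : ℝ → ℝ) q.2 ≤ 1 :=
      Set.indicator_le_self' (fun _ _ => zero_le_one) _
    have h4 : 0 ≤ (Set.Iic (seqAccept alg g lam s φ q.1)).indicator (1 : ℝ → ℝ) q.2 :=
      Set.indicator_nonneg (fun _ _ => zero_le_one) _
    calc _ ≤ s ^ 2 * (4 * L (q.1 i) ^ 2) * 1 := by gcongr
      _ = _ := by ring

lemma RegularPotential.integrable_sqJump (hg : RegularPotential g) {L : ℝ × ℝ → ℝ}
    (hL : Dominates alg g L) {lam : Fin n → ℝ} (hlam : ∀ i, 0 < lam i) {s : ℝ} (hs : 0 < s)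
    (hs1 : s ≤ 1) {φ : (Fin n → ℝ) → ℝ} (hφ : Measurable φ) {M : ℝ} (hM : ∀ x, M ≤ φ x)
    (i : Fin n) : Integrable (sqJump alg g lam s φ i) (stepLaw g lam φ) :=
  (hg.integrable_stepLaw_iff hlam hφ (hg.measurable_sqJump lam s hφ i)).2
    (hg.integrable_mul_sqJump hL hlam hs hs1 hφ hM i)

/-- Integrating out the uniform variable replaces the indicator of acceptance by the acceptance
probability. -/
lemma RegularPotential.meanSqJump_eq (hg : RegularPotential g) {L : ℝ × ℝ → ℝ}
    (hL : Dominates alg g L) {lam : Fin n → ℝ} (hlam : ∀ i, 0 < lam i) {s : ℝ} (hs : 0 < s)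
    (hs1 : s ≤ 1) {φ : (Fin n → ℝ) → ℝ} (hφ : Measurable φ) {M : ℝ} (hM : ∀ x, M ≤ φ x)
    {j : ℕ} (hj : j < n) :
    meanSqJump alg g lam s φ j = s ^ 2 *
      ∫ w, Real.exp (-φ (state lam w)) * ((w j).2 + s * drift alg g (w j).1) ^ 2 *
        seqAccept alg g lam s φ w ∂(seqLaw g) := by
  have := hg.isProbabilityMeasure_seqLaw
  rw [meanSqJump, dif_pos hj, hg.integral_stepLaw hlam hφ (hg.measurable_sqJump lam s hφ _), fullLaw,
    integral_prod _ (hg.integrable_mul_sqJump hL hlam hs hs1 hφ hM _), ← integral_const_mul]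
  refine integral_congr_ae (ae_of_all _ fun w => ?_)
  simp only [sqJump_toStep hlam hs]
  have h0 := seqAccept_nonneg (alg := alg) (g := g) lam s φ w
  have h1 := seqAccept_le_one (alg := alg) (g := g) lam s φ w
  rw [integral_const_mul, integral_const_mul, integral_indicator_one measurableSet_Iic,
    Measure.real, Measure.restrict_apply measurableSet_Iic]
  have : Set.Iic (seqAccept alg g lam s φ w) ∩ Set.Icc 0 1 =
      Set.Icc 0 (seqAccept alg g lam s φ w) := by
    ext x
    simp only [Set.mem_inter_iff, Set.mem_Iic, Set.mem_Icc]
    constructor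
    · rintro ⟨h, h', -⟩; exact ⟨h', h⟩
    · rintro ⟨h', h⟩; exact ⟨h, h', h.trans h1⟩
  rw [this, Real.volume_Icc, sub_zero, ENNReal.toReal_ofReal h0]
  ring

end

/-! ### Weighted norms and the control of the change of measure. -/

section

variable {g : ℝ → ℝ} {alg : Algorithm} {n : ℕ}

/-- The weights of the squared rescaled coordinates in a weighted norm. -/
def coef (κ β : ℝ) (i : ℕ) : ℝ := ((i : ℝ) + 1) ^ (2 * β - 2 * κ)

lemma coef_pos (κ β : ℝ) (i : ℕ) : 0 < coef κ β i := by unfold coef; positivity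

lemma summable_coef {κ β : ℝ} (h : β < κ - 1 / 2) : Summable (coef κ β) := by
  have := (Real.summable_nat_rpow (p := 2 * β - 2 * κ)).2 (by linarith)
  have h2 := (summable_nat_add_iff 1).2 this
  refine h2.congr fun i => ?_
  simp [coef]

/-- Scales comparable to `i ^ (-κ)` from above. -/
def ScalesBelow (κ Cp : ℝ) (lam : (n : ℕ) → Fin n → ℝ) : Prop :=
  0 < Cp ∧ ∀ (n : ℕ) (i : Fin n), 0 < lam n i ∧ lam n i ≤ Cp * ((i : ℝ) + 1) ^ (-κ)

lemma ScalesLike.exists_scalesBelow {κ : ℝ} {lam : (n : ℕ) → Fin n → ℝ} (h : ScalesLike κ lam) :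
    ∃ Cp, ScalesBelow κ Cp lam := by
  obtain ⟨Cm, Cp, hm, hp, h⟩ := h
  refine ⟨Cp, hp, fun n i => ⟨lt_of_lt_of_le ?_ (h n i).1, (h n i).2⟩⟩
  positivity

lemma wnorm_nonneg {s : ℝ} (x : Fin n → ℝ) : 0 ≤ wnorm s x := Real.sqrt_nonneg _

/-- The decay `i^(-κ)` of the scales compensates the weights `i^(2s)`. One exponent `β` above all
those in the hypotheses suffices, since the bases `i + 1` are at least one. -/
lemma wnorm_rescale_le {κ β s Cp : ℝ} {lam : (n : ℕ) → Fin n → ℝ} (hlam : ScalesBelow κ Cp lam)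
    (hs : s ≤ β) {n : ℕ} (v : Fin n → ℝ) {a : ℕ → ℝ} (hv : ∀ i : Fin n, |v i| ≤ a i) {T : ℝ}
    (hT : ∑ i ∈ Finset.range n, coef κ β i * a i ^ 2 ≤ T) :
    wnorm s (rescale (lam n) v) ≤ Cp * √T := by
  obtain ⟨hCp, hl⟩ := hlam
  have h1 : ∑ i : Fin n, ((i : ℝ) + 1) ^ (2 * s) * rescale (lam n) v i ^ 2 ≤ Cp ^ 2 * T := by
    refine le_trans ?_ (mul_le_mul_of_nonneg_left hT (sq_nonneg Cp))
    rw [Finset.sum_range, Finset.mul_sum]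
    refine Finset.sum_le_sum fun i _ => ?_
    have hi : (0 : ℝ) < (i : ℝ) + 1 := by positivity
    have hi1 : (1 : ℝ) ≤ (i : ℝ) + 1 := by simp
    have e1 : rescale (lam n) v i ^ 2 ≤ (Cp * ((i : ℝ) + 1) ^ (-κ) * a i) ^ 2 := by
      rw [← sq_abs]
      have h := abs_mul_le_mul (a := lam n i) (b := v i) (A := Cp * ((i : ℝ) + 1) ^ (-κ))
        (by rw [abs_of_pos (hl n i).1]; exact (hl n i).2) (hv i)
      unfold rescale
      gcongr
    have e2 : ((i : ℝ) + 1) ^ (2 * β) * (((i : ℝ) + 1) ^ (-κ)) ^ 2 = coef κ β i := by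
      rw [coef, ← Real.rpow_natCast (((i : ℝ) + 1) ^ (-κ)) 2, ← Real.rpow_mul hi.le,
        ← Real.rpow_add hi]
      congr 1
      push_cast
      ring
    calc ((i : ℝ) + 1) ^ (2 * s) * rescale (lam n) v i ^ 2
        ≤ ((i : ℝ) + 1) ^ (2 * β) * (Cp * ((i : ℝ) + 1) ^ (-κ) * a i) ^ 2 := by
          gcongr
      _ = Cp ^ 2 * ((((i : ℝ) + 1) ^ (2 * β) * (((i : ℝ) + 1) ^ (-κ)) ^ 2) * a i ^ 2) := by ring
      _ = _ := by rw [e2]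
  unfold wnorm
  refine (Real.sqrt_le_sqrt h1).trans_eq ?_
  rw [Real.sqrt_mul (sq_nonneg Cp), Real.sqrt_sq hCp.le]

/-- By Tonelli the expected sum is a multiple of `∑ i^(2β - 2κ)`, which is finite exactly because of
the strict bound on `β`. The value of the series bounds the weighted norms of states and proposals
in all dimensions at once. -/
lemma ae_summable_coef (hg : RegularPotential g) {L : ℝ × ℝ → ℝ} (hL : Dominates alg g L)
    {κ β : ℝ} (hβ : β < κ - 1 / 2) :
    ∀ᵐ w ∂(seqLaw g), Summable fun i => coef κ β i * L (w i) ^ 2 := by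
  have := hL.measurable
  have hm : ∀ i, Measurable fun w : ℕ → ℝ × ℝ => ENNReal.ofReal (coef κ β i * L (w i) ^ 2) :=
    fun i => by fun_prop
  have hnn : ∀ (i : ℕ) (p : ℝ × ℝ), 0 ≤ coef κ β i * L p ^ 2 := fun i p =>
    mul_nonneg (coef_pos κ β i).le (sq_nonneg _)
  have hfin : ∫⁻ w, ∑' i, ENNReal.ofReal (coef κ β i * L (w i) ^ 2) ∂(seqLaw g) ≠ ⊤ := by
    rw [lintegral_tsum fun i => (hm i).aemeasurable]
    have h1 : ∀ i, ∫⁻ w, ENNReal.ofReal (coef κ β i * L (w i) ^ 2) ∂(seqLaw g) =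
        ENNReal.ofReal (coef κ β i * ∫ p, L p ^ 2 ∂(pairLaw g)) := fun i => by
      rw [← ofReal_integral_eq_lintegral_ofReal ((hL.integrable_pow_eval hg 2 i).const_mul _)
        (ae_of_all _ fun w => hnn i _), integral_const_mul, hL.integral_pow_eval hg]
    simp_rw [h1]
    exact ((summable_coef hβ).mul_right _).tsum_ofReal_ne_top
  filter_upwards [ae_lt_top (Measurable.tsum hm) hfin] with w hw
  have h2 := ENNReal.summable_toReal hw.ne
  refine h2.congr fun i => ?_
  rw [ENNReal.toReal_ofReal (hnn i _)]

section Control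

variable {L : ℝ × ℝ → ℝ} {κ β Cp : ℝ} {lam : (n : ℕ) → Fin n → ℝ} {φ : (n : ℕ) → (Fin n → ℝ) → ℝ}
  {δ : ℝ → ℝ → ℝ} {s s' : ℝ}

/-- The state with all coordinates from number `k` on set to zero. -/
def truncState (k : ℕ) (lam : Fin n → ℝ) (w : ℕ → ℝ × ℝ) : Fin n → ℝ :=
  rescale lam fun i => if (i : ℕ) < k then (w i).1 else 0

lemma rescale_sub_rescale (lam u v : Fin n → ℝ) :
    rescale lam u - rescale lam v = rescale lam fun i => u i - v i := by
  funext i; simp [rescale, mul_sub]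

lemma abs_sub_le_of_control (hδ0 : ∀ a b : ℝ, 0 ≤ a → 0 ≤ b → 0 ≤ δ a b) {B r t : ℝ} (hr : 0 ≤ r)
    (hB : ∀ a b : ℝ, 0 ≤ a → a ≤ r → 0 ≤ b → b ≤ r → δ a b ≤ B) {n : ℕ}
    (hctl : ∀ x y : Fin n → ℝ,
        |φ n y - φ n x| ≤ δ (wnorm s x) (wnorm s y) * wnorm s' (y - x))
    {x y : Fin n → ℝ} (hx : wnorm s x ≤ r) (hy : wnorm s y ≤ r) (hxy : wnorm s' (y - x) ≤ t) :
    |φ n y - φ n x| ≤ B * t := by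
  have hB0 : 0 ≤ B := (hδ0 0 0 le_rfl le_rfl).trans (hB 0 0 le_rfl hr le_rfl hr)
  refine (hctl x y).trans ?_
  exact mul_le_mul (hB _ _ (wnorm_nonneg x) hx (wnorm_nonneg y) hy) hxy (wnorm_nonneg _) hB0

lemma sum_coef_const_mul_le {c A : ℝ} {w : ℕ → ℝ × ℝ} {n : ℕ}
    (hA : ∑ i ∈ Finset.range n, coef κ β i * L (w i) ^ 2 ≤ A) :
    ∑ i ∈ Finset.range n, coef κ β i * (c * L (w i)) ^ 2 ≤ c ^ 2 * A := by
  have : ∑ i ∈ Finset.range n, coef κ β i * (c * L (w i)) ^ 2 =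
      c ^ 2 * ∑ i ∈ Finset.range n, coef κ β i * L (w i) ^ 2 := by
    rw [Finset.mul_sum]
    exact Finset.sum_congr rfl fun i _ => by ring
  rw [this]
  gcongr

lemma wnorm_state_le (hL : Dominates alg g L) (hlam : ScalesBelow κ Cp lam) (hs : s ≤ β)
    {w : ℕ → ℝ × ℝ} {A : ℝ} {n : ℕ}
    (hA : ∑ i ∈ Finset.range n, coef κ β i * L (w i) ^ 2 ≤ A) :
    wnorm s (state (lam n) w) ≤ Cp * √A :=
  wnorm_rescale_le hlam hs _ (a := fun i => L (w i)) (fun i => hL.fst_le (w i)) hA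

lemma wnorm_movedState_le (hL : Dominates alg g L) (hlam : ScalesBelow κ Cp lam) (hs : s ≤ β)
    {w : ℕ → ℝ × ℝ} {A σ : ℝ} (hσ : 0 < σ) (hσ1 : σ ≤ 1) {n : ℕ}
    (hA : ∑ i ∈ Finset.range n, coef κ β i * L (w i) ^ 2 ≤ A) :
    wnorm s (movedState alg g (lam n) σ w) ≤ 3 * (Cp * √A) := by
  have := wnorm_rescale_le hlam hs (fun i : Fin n => move alg g σ (w i))
    (a := fun i => 3 * L (w i)) (fun i => hL.abs_move_le hσ hσ1 (w i)) (sum_coef_const_mul_le hA)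
  rw [Real.sqrt_mul (by positivity), Real.sqrt_sq (by norm_num)] at this
  unfold movedState
  linarith

lemma wnorm_movedState_sub_le (hL : Dominates alg g L) (hlam : ScalesBelow κ Cp lam) (hs : s ≤ β)
    {w : ℕ → ℝ × ℝ} {A σ : ℝ} (hσ : 0 < σ) (hσ1 : σ ≤ 1) {n : ℕ}
    (hA : ∑ i ∈ Finset.range n, coef κ β i * L (w i) ^ 2 ≤ A) :
    wnorm s (movedState alg g (lam n) σ w - state (lam n) w) ≤ 2 * σ * (Cp * √A) := by
  have := wnorm_rescale_le hlam hs (fun i : Fin n => move alg g σ (w i) - (w i).1)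
    (a := fun i => 2 * σ * L (w i)) (fun i => hL.abs_move_sub_le hσ hσ1 (w i))
    (sum_coef_const_mul_le hA)
  rw [Real.sqrt_mul (by positivity), Real.sqrt_sq (by positivity)] at this
  unfold movedState state
  rw [rescale_sub_rescale]
  linarith

/-- The change of measure does not affect the acceptance ratio in the limit. -/
lemma tendsto_phi_moved (hL : Dominates alg g L) (hlam : ScalesBelow κ Cp lam)
    (hs : s ≤ β) (hs' : s' ≤ β) (hδ0 : ∀ a b : ℝ, 0 ≤ a → 0 ≤ b → 0 ≤ δ a b)
    (hδ : LocallyBoundedOnQuadrant δ)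
    (hctl : ∀ᶠ n in atTop, ∀ x y : Fin n → ℝ,
        |φ n y - φ n x| ≤ δ (wnorm s x) (wnorm s y) * wnorm s' (y - x))
    {σ : ℕ → ℝ} (hσ : ∀ᶠ n in atTop, 0 < σ n) (hσ0 : Tendsto σ atTop (𝓝 0))
    {w : ℕ → ℝ × ℝ} (hw : Summable fun i => coef κ β i * L (w i) ^ 2) :
    Tendsto (fun n => φ n (state (lam n) w) - φ n (movedState alg g (lam n) (σ n) w)) atTop
      (𝓝 0) := by
  have hA : ∀ n, ∑ i ∈ Finset.range n, coef κ β i * L (w i) ^ 2 ≤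
      ∑' i, coef κ β i * L (w i) ^ 2 := fun n =>
    hw.sum_le_tsum _ fun i _ => mul_nonneg (coef_pos κ β i).le (sq_nonneg _)
  set A := ∑' i, coef κ β i * L (w i) ^ 2
  have hCp := hlam.1
  -- The radius depends on the sample point but not on `n`; the factor 3 accounts for the proposal,
  -- the displacement carries a factor `σ n`.
  obtain ⟨B, hB⟩ := hδ (3 * (Cp * √A))
  have hz : Tendsto (fun n => B * (2 * σ n * (Cp * √A))) atTop (𝓝 0) := by
    simpa using ((hσ0.const_mul 2).mul_const (Cp * √A)).const_mul B
  refine squeeze_zero_norm' ?_ hz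
  filter_upwards [hctl, hσ, hσ0.eventually_le_const zero_lt_one] with n hn h0 h1
  have hr : 0 ≤ Cp * √A := by positivity
  rw [Real.norm_eq_abs, abs_sub_comm]
  exact abs_sub_le_of_control hδ0 (by positivity) hB hn
    ((wnorm_state_le hL hlam hs (hA n)).trans (by linarith))
    (wnorm_movedState_le hL hlam hs h0 h1 (hA n))
    (wnorm_movedState_sub_le hL hlam hs' h0 h1 (hA n))

/-- The change of measure depends essentially on finitely many coordinates. -/
lemma tendsto_phi_trunc (hL : Dominates alg g L) (hlam : ScalesBelow κ Cp lam)
    (hs : s ≤ β) (hs' : s' ≤ β) (hδ0 : ∀ a b : ℝ, 0 ≤ a → 0 ≤ b → 0 ≤ δ a b)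
    (hδ : LocallyBoundedOnQuadrant δ)
    (hctl : ∀ᶠ n in atTop, ∀ x y : Fin n → ℝ,
        |φ n y - φ n x| ≤ δ (wnorm s x) (wnorm s y) * wnorm s' (y - x))
    {w : ℕ → ℝ × ℝ} (hw : Summable fun i => coef κ β i * L (w i) ^ 2) :
    Tendsto (fun q : ℕ × ℕ => φ q.2 (state (lam q.2) w) - φ q.2 (truncState q.1 (lam q.2) w))
      (atTop ×ˢ atTop) (𝓝 0) := by
  have hnn : ∀ i, 0 ≤ coef κ β i * L (w i) ^ 2 := fun i =>
    mul_nonneg (coef_pos κ β i).le (sq_nonneg _)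
  have hA : ∀ n, ∑ i ∈ Finset.range n, coef κ β i * L (w i) ^ 2 ≤
      ∑' i, coef κ β i * L (w i) ^ 2 := fun n => hw.sum_le_tsum _ fun i _ => hnn i
  have htail := tendsto_sum_nat_add fun i => coef κ β i * L (w i) ^ 2
  set A := ∑' i, coef κ β i * L (w i) ^ 2
  set tail : ℕ → ℝ := fun k => ∑' i, coef κ β (i + k) * L (w (i + k)) ^ 2
  have hCp := hlam.1
  obtain ⟨B, hB⟩ := hδ (Cp * √A)
  have hz : Tendsto (fun q : ℕ × ℕ => B * (Cp * √(tail q.1))) (atTop ×ˢ atTop) (𝓝 0) := by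
    have : Tendsto (fun k => B * (Cp * √(tail k))) atTop (𝓝 0) := by
      simpa using (htail.sqrt.const_mul Cp).const_mul B
    exact this.comp tendsto_fst
  refine squeeze_zero_norm' ?_ hz
  filter_upwards [tendsto_snd.eventually hctl] with q hq
  obtain ⟨k, n⟩ := q
  simp only at hq ⊢
  have hr : 0 ≤ Cp * √A := by positivity
  rw [Real.norm_eq_abs]
  refine abs_sub_le_of_control hδ0 hr hB hq ?_ (wnorm_state_le hL hlam hs (hA n)) ?_
  · refine wnorm_rescale_le hlam hs _ (a := fun i => L (w i)) (fun i => ?_) (hA n)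
    split_ifs
    · exact hL.fst_le _
    · have := hL.one_le (w i)
      simpa using by linarith
  · unfold state truncState
    rw [rescale_sub_rescale]
    -- The truncation error lives on the coordinates from `k` on, so a tail of the convergent series
    -- bounds it uniformly in `n`.
    refine wnorm_rescale_le hlam hs' _ (a := fun i => if i < k then 0 else L (w i))
      (fun i => ?_) ?_
    · by_cases h : (i : ℕ) < k
      · simp [h]
      · simpa [h] using hL.fst_le _
    · have h1 : ∀ i ∈ Finset.range n, coef κ β i * (if i < k then 0 else L (w i)) ^ 2 =
          if i < k then 0 else coef κ β i * L (w i) ^ 2 := fun i _ => by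
        split_ifs <;> simp
      rw [Finset.sum_congr rfl h1]
      have h2 : Summable fun i => if i < k then 0 else coef κ β i * L (w i) ^ 2 := by
        refine Summable.of_nonneg_of_le (fun i => ?_) (fun i => ?_) hw
        · split_ifs
          · exact le_rfl
          · exact hnn i
        · split_ifs
          · exact hnn i
          · exact le_rfl
      refine (h2.sum_le_tsum _ fun i _ => ?_).trans_eq ?_
      · split_ifs
        · exact le_rfl
        · exact hnn i
      · rw [← h2.sum_add_tsum_nat_add k, Finset.sum_eq_zero, zero_add]
        · refine tsum_congr fun i => ?_
          rw [if_neg (by omega)]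
        · intro i hi
          rw [if_pos (Finset.mem_range.1 hi)]

/-- Polynomial control of the change of measure when all coordinates are bounded by `t`. -/
lemma exists_phi_bound (hL : Dominates alg g L) (hlam : ScalesBelow κ Cp lam)
    (hβ : β < κ - 1 / 2) (hs : s ≤ β) {C p : ℝ} (hC : 0 < C) (hp : 0 < p)
    (hgrow : ∀ᶠ n in atTop, ∀ x : Fin n → ℝ, |φ n x| ≤ C * (1 + wnorm s x ^ p))
    {σ : ℕ → ℝ} (hσ : ∀ᶠ n in atTop, 0 < σ n) (hσ0 : Tendsto σ atTop (𝓝 0)) :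
    ∃ C' : ℝ, ∀ᶠ n in atTop, ∀ (t : ℝ) (w : ℕ → ℝ × ℝ), 1 ≤ t → (∀ i < n, L (w i) ≤ t) →
      φ n (state (lam n) w) - φ n (movedState alg g (lam n) (σ n) w) ≤ C' * t ^ p := by
  set S := ∑' i, coef κ β i
  have hCp := hlam.1
  -- Two values of `φ` are bounded separately; `1 ≤ t ^ p` absorbs the additive constant of the
  -- growth condition.
  refine ⟨2 * (C * (1 + (3 * (Cp * √S)) ^ p)), ?_⟩
  filter_upwards [hgrow, hσ, hσ0.eventually_le_const zero_lt_one] with n hn h0 h1 t w ht hwt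
  have hA : ∑ i ∈ Finset.range n, coef κ β i * L (w i) ^ 2 ≤ S * t ^ 2 := by
    calc ∑ i ∈ Finset.range n, coef κ β i * L (w i) ^ 2
        ≤ ∑ i ∈ Finset.range n, coef κ β i * t ^ 2 := by
          refine Finset.sum_le_sum fun i hi => ?_
          have := (coef_pos κ β i).le
          have := hwt i (Finset.mem_range.1 hi)
          have := hL.one_le (w i)
          gcongr
      _ = (∑ i ∈ Finset.range n, coef κ β i) * t ^ 2 := by rw [Finset.sum_mul]
      _ ≤ S * t ^ 2 := by
        gcongr
        exact (summable_coef hβ).sum_le_tsum _ fun i _ => (coef_pos κ β i).le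
  have hS : 0 ≤ S := tsum_nonneg fun i => (coef_pos κ β i).le
  have hsq : √(S * t ^ 2) = √S * t := by
    rw [Real.sqrt_mul hS, Real.sqrt_sq (by linarith)]
  have t0 : 0 ≤ t := by linarith
  have b : ∀ x : Fin n → ℝ, wnorm s x ≤ 3 * (Cp * √(S * t ^ 2)) →
      |φ n x| ≤ C * (1 + (3 * (Cp * √S)) ^ p) * t ^ p := fun x hx => by
    refine (hn x).trans ?_
    rw [mul_assoc]
    refine mul_le_mul_of_nonneg_left ?_ hC.le
    have h2 : wnorm s x ^ p ≤ (3 * (Cp * √S)) ^ p * t ^ p := by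
      rw [← Real.mul_rpow (by positivity) t0]
      refine Real.rpow_le_rpow (wnorm_nonneg x) (hx.trans_eq ?_) hp.le
      rw [hsq]; ring
    have h3 : 1 ≤ t ^ p := Real.one_le_rpow ht hp.le
    rw [add_mul, one_mul]
    linarith
  have hpos : 0 ≤ Cp * √(S * t ^ 2) := by positivity
  have b1 := b _ ((wnorm_state_le hL hlam hs hA).trans (by linarith))
  have b2 := b _ (wnorm_movedState_le hL hlam hs h0 h1 hA)
  rw [abs_le] at b1 b2
  linarith [b1.2, b2.1]

end Control

end

/-! ### Limits of the acceptance rate and of the squared jumps for `ρ ≥ I`. -/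

section

variable {g : ℝ → ℝ} {alg : Algorithm}

lemma abs_exp_neg_sub_le {M a b : ℝ} (ha : M ≤ a) (hb : M ≤ b) :
    |Real.exp (-a) - Real.exp (-b)| ≤ Real.exp (-M) * |a - b| := by
  wlog hab : a ≤ b generalizing a b
  · rw [abs_sub_comm, abs_sub_comm a]
    exact this hb ha (not_le.1 hab).le
  rw [abs_of_nonneg (sub_nonneg.2 (Real.exp_le_exp.2 (neg_le_neg hab))),
    abs_of_nonpos (sub_nonpos.2 hab)]
  have h1 : Real.exp (-b) = Real.exp (-a) * Real.exp (a - b) := by rw [← Real.exp_add]; ring_nf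
  have h2 := Real.add_one_le_exp (a - b)
  have h3 : Real.exp (-a) ≤ Real.exp (-M) := Real.exp_le_exp.2 (neg_le_neg ha)
  have h4 := Real.exp_pos (-a)
  calc Real.exp (-a) - Real.exp (-b) = Real.exp (-a) * (1 - Real.exp (a - b)) := by rw [h1]; ring
    _ ≤ Real.exp (-a) * -(a - b) := by gcongr; linarith
    _ ≤ Real.exp (-M) * -(a - b) := by gcongr; linarith

/-- The noise is independent of the state, and the weight has mean one because the target is a
probability measure. -/
lemma RegularPotential.integral_weight_mul_noise (hg : RegularPotential g) {n : ℕ}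
    {lam : Fin n → ℝ} (hlam : ∀ i, 0 < lam i) {φ : (Fin n → ℝ) → ℝ} (hφ : Measurable φ)
    (hprob : IsProbabilityMeasure (target g lam φ)) {ψ : (Fin n → ℝ) → ℝ} (hψ : Measurable ψ) :
    ∫ w, Real.exp (-φ (state lam w)) * ψ (noise n w) ∂(seqLaw g) =
      ∫ z, ψ z ∂(Measure.pi fun _ : Fin n => gaussianReal 0 1) := by
  have hsf : SFinite (refMeasure g lam) := by unfold refMeasure; infer_instance
  have hone : ∫ x, Real.exp (-φ x) ∂(refMeasure g lam) = 1 := by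
    have h := hprob.measure_univ
    rw [target, withDensity_apply _ MeasurableSet.univ, Measure.restrict_univ] at h
    rw [integral_eq_lintegral_of_nonneg_ae (ae_of_all _ fun x => (Real.exp_pos _).le)
      (Measurable.aestronglyMeasurable (by fun_prop)), h, ENNReal.toReal_one]
  have h1 := integral_map (μ := seqLaw g) (φ := fun w => (state lam w, noise n w))
    ((measurable_state lam).prodMk measurable_noise).aemeasurable
    (f := fun p : (Fin n → ℝ) × (Fin n → ℝ) => Real.exp (-φ p.1) * ψ p.2)
    (Measurable.aestronglyMeasurable (by fun_prop))
  rw [← h1, hg.map_state_noise hlam,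
    integral_prod_mul (fun x => Real.exp (-φ x)) ψ, hone, one_mul]

/-- The setting of the theorem, with the exponents of the weighted norms made explicit. -/
structure Setting (alg : Algorithm) (g : ℝ → ℝ) (L : ℝ × ℝ → ℝ) (β κ Cp M : ℝ)
    (lam : (n : ℕ) → Fin n → ℝ) (φ : (n : ℕ) → (Fin n → ℝ) → ℝ) (σ : ℕ → ℝ) : Prop where
  regular : RegularPotential g
  dominates : Dominates alg g L
  scales : ScalesBelow κ Cp lam
  exponent : β < κ - 1 / 2
  measurable : ∀ n, Measurable (φ n)
  below : ∀ᶠ n in atTop, ∀ x, M ≤ φ n x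
  step_pos : ∀ᶠ n in atTop, 0 < σ n
  step_zero : Tendsto σ atTop (𝓝 0)

namespace Setting

variable {L : ℝ × ℝ → ℝ} {β κ Cp M : ℝ} {lam : (n : ℕ) → Fin n → ℝ}
  {φ : (n : ℕ) → (Fin n → ℝ) → ℝ} {σ : ℕ → ℝ}

lemma scales_pos (S : Setting alg g L β κ Cp M lam φ σ) (n : ℕ) (i : Fin n) : 0 < lam n i :=
  (S.scales.2 n i).1

/-- The common core of both limits: `v = h = 1` gives the acceptance rate, and `v = z^2` with `h =
(z + σ drift)^2` gives the jump. Three limits are added: the contributions of `h - v` and of the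
increment of `φ` vanish by domination, the weight decouples from the sum, and the central limit
theorem gives the value. -/
lemma tendsto_integral_weight_mul (S : Setting alg g L β κ Cp M lam φ σ) {δ : ℝ → ℝ → ℝ} {s s' : ℝ}
    (hs : s ≤ β) (hs' : s' ≤ β) (hδ0 : ∀ a b : ℝ, 0 ≤ a → 0 ≤ b → 0 ≤ δ a b)
    (hδ : LocallyBoundedOnQuadrant δ)
    (hctl : ∀ᶠ n in atTop, ∀ x y : Fin n → ℝ,
        |φ n y - φ n x| ≤ δ (wnorm s x) (wnorm s y) * wnorm s' (y - x))
    {τ : ℝ} (hτ0 : 0 ≤ τ) (hτ : Tendsto (fun n : ℕ => n * σ n ^ (2 * alg.order)) atTop (𝓝 τ))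
    {v : ℝ × ℝ → ℝ} {h : ℕ → ℝ × ℝ → ℝ} {c : ℝ} (hvm : Measurable v) (hhm : ∀ n, Measurable (h n))
    (hvL : ∀ p, |v p| ≤ c * L p ^ 2) (hhL : ∀ᶠ n in atTop, ∀ p, |h n p| ≤ c * L p ^ 2)
    (hhv : ∀ p, Tendsto (fun n => h n p) atTop (𝓝 (v p))) {j : ℕ}
    (hone : ∀ᶠ n in atTop, ∫ w, Real.exp (-φ n (state (lam n) w)) * v (w j) ∂(seqLaw g) = 1) :
    Tendsto (fun n => ∫ w, Real.exp (-φ n (state (lam n) w)) * h n (w j) *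
        seqAccept alg g (lam n) (σ n) (φ n) w ∂(seqLaw g)) atTop
      (𝓝 (2 * cdf (gaussianReal 0 1) (-(√(τ * roughness alg g) / 2)))) := by
  have hg := S.regular
  have hL := S.dominates
  have hLm := hL.measurable
  have := hg.isProbabilityMeasure_pairLaw
  have := hg.isProbabilityMeasure_seqLaw
  obtain ⟨N, hN⟩ := eventually_atTop.1 S.below
  have hφm := S.measurable
  have hst := fun n => measurable_state (lam n)
  have hDm : ∀ n, Measurable fun w : ℕ → ℝ × ℝ => Real.exp (-φ n (state (lam n) w)) :=
    fun n => by fun_prop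
  have hsum := ae_summable_coef hg hL S.exponent
  have hvi : Integrable v (pairLaw g) :=
    ((hL.integrable_pow 2).const_mul c).mono' hvm.aestronglyMeasurable (ae_of_all _ hvL)
  have hexp : ∀ n ≥ N, ∀ x, |Real.exp (-φ n x)| ≤ Real.exp (-M) := fun n hn x => by
    rw [Real.abs_exp]
    exact Real.exp_le_exp.2 (neg_le_neg (hN n hn x))
  have hdec := tendsto_integral_decouple (pairLaw g)
    (D := fun n w => Real.exp (-φ n (state (lam n) w)))
    (D' := fun k n x => Real.exp (-φ n (rescale (lam n) fun i =>
      if h : (i : ℕ) < k then (x ⟨i, Finset.mem_range.2 h⟩).1 else 0)))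
    (B := Real.exp (-M)) (N := N) hDm (fun k n => by
      have : Measurable fun (x : Finset.range k → ℝ × ℝ) => rescale (lam n) fun i =>
          if h : (i : ℕ) < k then (x ⟨i, Finset.mem_range.2 h⟩).1 else 0 := by
        unfold rescale
        refine measurable_pi_lambda _ fun i => Measurable.const_mul ?_ _
        by_cases h : (i : ℕ) < k
        · simp only [h, dif_pos]; fun_prop
        · simp only [h, dif_neg, not_false_eq_true]; fun_prop
      have := (hφm n).comp this
      exact Real.measurable_exp.comp this.neg) (fun n hn w => hexp n hn _)
    (fun k n hn x => hexp n hn _) (by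
      filter_upwards [hsum] with w hw
      have h1 := tendsto_phi_trunc hL S.scales hs hs' hδ0 hδ hctl hw
      have h2 : Tendsto (fun q : ℕ × ℕ => Real.exp (-M) *
          |φ q.2 (state (lam q.2) w) - φ q.2 (truncState q.1 (lam q.2) w)|)
          (atTop ×ˢ atTop) (𝓝 0) := by simpa using h1.abs.const_mul (Real.exp (-M))
      refine squeeze_zero_norm' ?_ h2
      filter_upwards [tendsto_snd.eventually S.below] with q hq
      rw [Real.norm_eq_abs]
      exact abs_exp_neg_sub_le (hq _) (hq _))
    (r := fun n => logRatio alg g (σ n)) (fun n => (hg.continuous_logRatio (σ n)).measurable)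
    (fun p => tendsto_logRatio_zero hg S.step_pos S.step_zero p) hvm hvi j
  change Tendsto (fun n => ∫ w, Real.exp (-φ n (state (lam n) w)) * v (w j) *
      capExp (sumLogRatio alg g (σ n) n w) ∂(seqLaw g) -
    (∫ w, Real.exp (-φ n (state (lam n) w)) * v (w j) ∂(seqLaw g)) *
      ∫ w, capExp (sumLogRatio alg g (σ n) n w) ∂(seqLaw g)) atTop (𝓝 0) at hdec
  have hcap := tendsto_integral_capExp (alg := alg) hg S.step_pos S.step_zero hτ0 hτ
  have hSm := fun n => hg.measurable_sumLogRatio (alg := alg) (σ n) n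
  have hcm : ∀ n, Measurable fun w => capExp (sumLogRatio alg g (σ n) n w) := fun n =>
    continuous_capExp.measurable.comp (hSm n)
  have ham := fun n => hg.measurable_seqAccept (alg := alg) (lam n) (σ n) (hφm n)
  have hLi := (hL.integrable_pow_eval hg 2 j).const_mul (Real.exp (-M) * c)
  have hbd : ∀ n ≥ N, ∀ (w : ℕ → ℝ × ℝ) (x a : ℝ), |x| ≤ c * L (w j) ^ 2 → |a| ≤ 1 →
      ‖Real.exp (-φ n (state (lam n) w)) * x * a‖ ≤ Real.exp (-M) * c * L (w j) ^ 2 :=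
    fun n hn w x a hx ha => by
      have := abs_mul_le_mul (abs_mul_le_mul (hexp n hn (state (lam n) w)) hx) ha
      rw [Real.norm_eq_abs]
      linarith
  have habs : ∀ n w, |seqAccept alg g (lam n) (σ n) (φ n) w| ≤ 1 := fun n w => by
    rw [abs_of_nonneg (seqAccept_nonneg ..)]; exact seqAccept_le_one ..
  have hdiff : Tendsto (fun n => ∫ w, (Real.exp (-φ n (state (lam n) w)) * h n (w j) *
        seqAccept alg g (lam n) (σ n) (φ n) w - Real.exp (-φ n (state (lam n) w)) * v (w j) *
        capExp (sumLogRatio alg g (σ n) n w)) ∂(seqLaw g)) atTop (𝓝 0) := by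
    have key := tendsto_integral_filter_of_dominated_convergence (μ := seqLaw g) (l := atTop)
      (F := fun (n : ℕ) w => Real.exp (-φ n (state (lam n) w)) * h n (w j) *
        seqAccept alg g (lam n) (σ n) (φ n) w - Real.exp (-φ n (state (lam n) w)) * v (w j) *
        capExp (sumLogRatio alg g (σ n) n w)) (f := fun _ => (0 : ℝ))
      (fun w => 2 * (Real.exp (-M) * c * L (w j) ^ 2)) ?_ ?_ (hLi.const_mul 2) ?_
    · simpa using key
    · refine Eventually.of_forall fun n => Measurable.aestronglyMeasurable ?_
      have := hDm n; have := hhm n; have := ham n; have := hcm n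
      fun_prop
    · filter_upwards [eventually_ge_atTop N, hhL] with n hn hh
      refine ae_of_all _ fun w => ?_
      refine (norm_sub_le _ _).trans ?_
      have h1 := hbd n hn w _ _ (hh (w j)) (habs n w)
      have h2 := hbd n hn w _ _ (hvL (w j)) (abs_capExp_le (sumLogRatio alg g (σ n) n w))
      linarith
    · filter_upwards [hsum] with w hw
      have h1 := (tendsto_phi_moved hL S.scales hs hs' hδ0 hδ hctl S.step_pos S.step_zero hw).abs
      have h2 : Tendsto (fun n => Real.exp (-M) * (|h n (w j) - v (w j)| + |v (w j)| *
          |φ n (state (lam n) w) - φ n (movedState alg g (lam n) (σ n) w)|)) atTop (𝓝 0) := by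
        have h3 := ((hhv (w j)).sub_const (v (w j))).abs
        simpa using (h3.add (h1.const_mul |v (w j)|)).const_mul (Real.exp (-M))
      refine squeeze_zero_norm' ?_ h2
      filter_upwards [eventually_ge_atTop N] with n hn
      have e : Real.exp (-φ n (state (lam n) w)) * h n (w j) *
          seqAccept alg g (lam n) (σ n) (φ n) w - Real.exp (-φ n (state (lam n) w)) * v (w j) *
          capExp (sumLogRatio alg g (σ n) n w) = Real.exp (-φ n (state (lam n) w)) *
          ((h n (w j) - v (w j)) * seqAccept alg g (lam n) (σ n) (φ n) w + v (w j) *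
            (seqAccept alg g (lam n) (σ n) (φ n) w - capExp (sumLogRatio alg g (σ n) n w))) := by
        ring
      rw [e, Real.norm_eq_abs]
      refine abs_mul_le_mul (hexp n hn _) ((abs_add_le _ _).trans (add_le_add ?_ ?_))
      · simpa using abs_mul_le_mul (le_refl |h n (w j) - v (w j)|) (habs n w)
      · refine abs_mul_le_mul le_rfl ((abs_capExp_sub_le _ _).trans_eq ?_)
        congr 1; ring
  have hlim := (hdiff.add hdec).add hcap
  rw [zero_add, zero_add] at hlim
  refine hlim.congr' ?_
  filter_upwards [eventually_ge_atTop N, hhL, hone] with n hn hh h1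
  have := hDm n; have := hhm n; have := ham n; have := hcm n
  rw [h1, one_mul, integral_sub]
  · ring
  · exact hLi.mono' (Measurable.aestronglyMeasurable (by fun_prop))
      (ae_of_all _ fun w => hbd n hn w _ _ (hh (w j)) (habs n w))
  · exact hLi.mono' (Measurable.aestronglyMeasurable (by fun_prop))
      (ae_of_all _ fun w => hbd n hn w _ _ (hvL (w j)) (abs_capExp_le _))

/-- Convergence of the acceptance rate and of the squared jumps. -/
theorem tendsto_meanAccept_and_sqJump (S : Setting alg g L β κ Cp M lam φ σ) {δ : ℝ → ℝ → ℝ}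
    {s s' : ℝ} (hs : s ≤ β) (hs' : s' ≤ β) (hδ0 : ∀ a b : ℝ, 0 ≤ a → 0 ≤ b → 0 ≤ δ a b)
    (hδ : LocallyBoundedOnQuadrant δ)
    (hctl : ∀ᶠ n in atTop, ∀ x y : Fin n → ℝ,
        |φ n y - φ n x| ≤ δ (wnorm s x) (wnorm s y) * wnorm s' (y - x))
    (hprob : ∀ n, 1 ≤ n → IsProbabilityMeasure (target g (lam n) (φ n)))
    {τ : ℝ} (hτ0 : 0 ≤ τ) (hτ : Tendsto (fun n : ℕ => n * σ n ^ (2 * alg.order)) atTop (𝓝 τ))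
    {a : ℝ} (ha : a = 2 * cdf (gaussianReal 0 1) (-(√(τ * roughness alg g) / 2))) :
    Tendsto (fun n => meanAccept alg g (lam n) (σ n) (φ n)) atTop (𝓝 a) ∧
      ∀ j : ℕ, (fun n => meanSqJump alg g (lam n) (σ n) (φ n) j - σ n ^ 2 * a)
        =o[atTop] fun n => σ n ^ 2 := by
  have hg := S.regular
  have hL := S.dominates
  have hdr := (hg.continuous_drift (alg := alg)).measurable
  have hL2 : ∀ p, 1 ≤ L p ^ 2 := fun p => one_le_pow₀ (hL.one_le p)
  constructor
  · have h := S.tendsto_integral_weight_mul hs hs' hδ0 hδ hctl hτ0 hτ (v := fun _ => 1)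
      (h := fun _ _ => 1) (c := 1) measurable_const (fun _ => measurable_const)
      (fun p => by simpa using hL2 p) (Eventually.of_forall fun n p => by simpa using hL2 p)
      (fun p => tendsto_const_nhds) (j := 0) (by
        filter_upwards [eventually_ge_atTop 1] with n hn
        have := hg.integral_weight_mul_noise (S.scales_pos n) (S.measurable n) (hprob n hn)
          (ψ := fun _ => 1) measurable_const
        simpa using this)
    rw [← ha] at h
    refine h.congr' ?_
    filter_upwards [S.step_pos] with n hn
    rw [hg.meanAccept_eq (S.scales_pos n) hn (S.measurable n)]
    simp
  · intro j
    have h := S.tendsto_integral_weight_mul hs hs' hδ0 hδ hctl hτ0 hτ (v := fun p => p.2 ^ 2)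
      (h := fun n p => (p.2 + σ n * drift alg g p.1) ^ 2) (c := 4) (by fun_prop)
      (fun n => by fun_prop)
      (fun p => by
        have h1 := hL.snd_le p
        have h2 : |p.2| ^ 2 ≤ L p ^ 2 := by gcongr
        have h3 := hL2 p
        rw [abs_pow]; linarith)
      (by
        filter_upwards [S.step_pos, S.step_zero.eventually_le_const zero_lt_one] with n h0 h1 p
        rw [abs_of_nonneg (sq_nonneg _)]
        exact hL.sq_jump_le h0 h1 p)
      (fun p => by
        have := ((S.step_zero.mul_const (drift alg g p.1)).const_add p.2).pow 2
        simpa using this) (j := j) (by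
        filter_upwards [eventually_gt_atTop j] with n hn
        have := hg.integral_weight_mul_noise (S.scales_pos n) (S.measurable n)
          (hprob n (by omega)) (ψ := fun z => z ⟨j, hn⟩ ^ 2) (by fun_prop)
        have he := measurePreserving_eval (fun _ : Fin n => gaussianReal 0 1) ⟨j, hn⟩
        have h2 : ∫ z : Fin n → ℝ, z ⟨j, hn⟩ ^ 2 ∂(Measure.pi fun _ : Fin n => gaussianReal 0 1) =
            1 := by
          have h3 := integral_map (μ := Measure.pi fun _ : Fin n => gaussianReal 0 1)
            he.measurable.aemeasurable (f := fun z : ℝ => z ^ 2) (by fun_prop)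
          rw [he.map_eq, integral_sq_gaussianReal] at h3
          exact h3.symm
        rw [h2] at this
        exact this)
    rw [← ha] at h
    rw [isLittleO_iff]
    intro c hc
    have h0 : Tendsto (fun n => ∫ w, Real.exp (-φ n (state (lam n) w)) *
        ((w j).2 + σ n * drift alg g (w j).1) ^ 2 *
        seqAccept alg g (lam n) (σ n) (φ n) w ∂(seqLaw g) - a) atTop (𝓝 0) := by
      simpa using h.sub_const a
    filter_upwards [S.step_pos, S.step_zero.eventually_le_const zero_lt_one, S.below,
      eventually_gt_atTop j, (Metric.tendsto_nhds.1 h0) c hc] with n h1 h2 h3 h4 h5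
    rw [hg.meanSqJump_eq hL (S.scales_pos n) h1 h2 (S.measurable n) h3 h4, ← mul_sub, norm_mul,
      mul_comm]
    rw [Real.dist_eq, sub_zero] at h5
    exact mul_le_mul_of_nonneg_right h5.le (norm_nonneg _)

end Setting

end

/-! ### Superpolynomial decay for `ρ < I`. -/

section

variable {g : ℝ → ℝ} {alg : Algorithm}

lemma order_mul_index (alg : Algorithm) : (alg.order : ℝ) * alg.index = 1 := by
  cases alg <;> norm_num [Algorithm.order, Algorithm.index]

lemma order_pos (alg : Algorithm) : (0 : ℝ) < alg.order := by
  cases alg <;> norm_num [Algorithm.order]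

lemma tendsto_natCast_rpow_neg {a : ℝ} (ha : 0 < a) :
    Tendsto (fun n : ℕ => (n : ℝ) ^ (-a)) atTop (𝓝 0) :=
  (tendsto_rpow_neg_atTop ha).comp tendsto_natCast_atTop_atTop

lemma exp_sub_isBigO {A B θ : ℝ} (hB : 0 < B) (hθ : 0 < θ) (P : ℝ) :
    (fun n : ℕ => Real.exp (A * (n : ℝ) ^ (θ / 2) - B * (n : ℝ) ^ θ))
      =O[atTop] fun n : ℕ => (n : ℝ) ^ (-P) := by
  have hx : Tendsto (fun n : ℕ => (n : ℝ) ^ (θ / 2)) atTop atTop :=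
    (tendsto_rpow_atTop (by positivity)).comp tendsto_natCast_atTop_atTop
  have h1 : (fun n : ℕ => Real.exp (A * (n : ℝ) ^ (θ / 2) - B * (n : ℝ) ^ θ))
      =O[atTop] fun n : ℕ => Real.exp (-1 * (n : ℝ) ^ (θ / 2)) := by
    refine IsBigO.of_bound 1 ?_
    filter_upwards [hx.eventually_ge_atTop ((A + 1) / B)] with n hn
    rw [Real.norm_of_nonneg (Real.exp_pos _).le, Real.norm_of_nonneg (Real.exp_pos _).le, one_mul,
      Real.exp_le_exp]
    have hsq : (n : ℝ) ^ θ = (n : ℝ) ^ (θ / 2) * (n : ℝ) ^ (θ / 2) := by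
      rw [← Real.rpow_add_of_nonneg (by positivity) (by positivity) (by positivity), add_halves]
    have h2 : A + 1 ≤ (n : ℝ) ^ (θ / 2) * B := (div_le_iff₀ hB).1 hn
    have h3 : 0 ≤ (n : ℝ) ^ (θ / 2) := by positivity
    rw [hsq]
    nlinarith [mul_le_mul_of_nonneg_right h2 h3]
  refine h1.trans ?_
  -- In the variable `n^(θ/2)` the target power `n^(-P)` has exponent `-2P/θ`.
  have h2 := ((isLittleO_exp_neg_mul_rpow_atTop (a := 1) one_pos (-(2 * P / θ))).comp_tendsto
    hx).isBigO
  refine h2.congr_right fun n => ?_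
  simp only [Function.comp_def]
  rw [← Real.rpow_mul (by positivity)]
  congr 1
  field_simp

namespace Setting

variable {L : ℝ × ℝ → ℝ} {β κ Cp M : ℝ} {lam : (n : ℕ) → Fin n → ℝ}
  {φ : (n : ℕ) → (Fin n → ℝ) → ℝ} {σ : ℕ → ℝ}

lemma integrable_seqAccept (S : Setting alg g L β κ Cp M lam φ σ) (n : ℕ) :
    Integrable (seqAccept alg g (lam n) (σ n) (φ n)) (seqLaw g) := by
  have := S.regular.isProbabilityMeasure_seqLaw
  refine (integrable_const (1 : ℝ)).mono'
    (S.regular.measurable_seqAccept _ _ (S.measurable n)).aestronglyMeasurable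
    (ae_of_all _ fun w => ?_)
  rw [Real.norm_of_nonneg (seqAccept_nonneg ..)]
  exact seqAccept_le_one ..

/-- The acceptance rate under the product law decays faster than any power if the steps are too
large. -/
lemma integral_seqAccept_isBigO (S : Setting alg g L β κ Cp M lam φ σ) {s C p : ℝ} (hs : s ≤ β)
    (hC : 0 < C) (hp : 0 < p)
    (hgrow : ∀ᶠ n in atTop, ∀ x : Fin n → ℝ, |φ n x| ≤ C * (1 + wnorm s x ^ p))
    {A θ : ℝ} (hA : 0 < A) (hθ : 0 < θ)
    (hσ : ∀ᶠ n : ℕ in atTop, n * σ n ^ (2 * alg.order) = A * (n : ℝ) ^ θ) (P : ℝ) :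
    (fun n => ∫ w, seqAccept alg g (lam n) (σ n) (φ n) w ∂(seqLaw g))
      =O[atTop] fun n : ℕ => (n : ℝ) ^ (-P) := by
  have hg := S.regular
  have hL := S.dominates
  have hK := hg.roughness_pos (alg := alg)
  obtain ⟨C', hC'⟩ := exists_phi_bound hL S.scales S.exponent hs hC hp hgrow S.step_pos S.step_zero
  -- With the threshold `t = n^ε`, the bound `t^p` on the increment of `φ` is `n^(θ/2)`, negligible
  -- against `n^θ`.
  set ε : ℝ := θ / (2 * p) with hε
  have hε0 : 0 < ε := by positivity
  -- The moment order is large enough for Markov's inequality to beat the union bound over `n`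
  -- coordinates: `n · n^(-ε q) ≤ n^(-P)`.
  obtain ⟨q, hq⟩ := exists_nat_ge ((P + 1) / ε)
  rw [div_le_iff₀ hε0] at hq
  set m : ℝ := ∫ x, L x ^ q ∂(pairLaw g)
  have hm : 0 ≤ m := integral_nonneg fun x => pow_nonneg (zero_le_one.trans (hL.one_le x)) q
  have hbound : ∀ᶠ n : ℕ in atTop, ∫ w, seqAccept alg g (lam n) (σ n) (φ n) w ∂(seqLaw g) ≤
      Real.exp (C' / 2 * (n : ℝ) ^ (θ / 2) - roughness alg g / 64 * A * (n : ℝ) ^ θ) +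
        m * (n : ℝ) ^ (-P) := by
    filter_upwards [hC', hσ, eventually_ge_atTop 1,
      eventually_integral_exp_half_sum_le (alg := alg) hg S.step_pos S.step_zero]
      with n hn hsn hn1 hexp
    have hn1' : (1 : ℝ) ≤ n := by exact_mod_cast hn1
    have hn0 : (0 : ℝ) < n := by linarith
    set t : ℝ := (n : ℝ) ^ ε with ht
    have ht1 : 1 ≤ t := Real.one_le_rpow hn1' hε0.le
    have ht0 : 0 < t := by linarith
    have htp : t ^ p = (n : ℝ) ^ (θ / 2) := by
      rw [ht, ← Real.rpow_mul hn0.le, hε]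
      congr 1
      field_simp
    -- Either all coordinates are below the threshold and the first term bounds the acceptance
    -- probability, or one exceeds it and the sum alone is at least one.
    have hpt : ∀ w, seqAccept alg g (lam n) (σ n) (φ n) w ≤
        Real.exp (C' / 2 * (n : ℝ) ^ (θ / 2)) * Real.exp (sumLogRatio alg g (σ n) n w / 2) +
          ∑ i ∈ Finset.range n, (t ^ q)⁻¹ * L (w i) ^ q := fun w => by
      have hnn : ∀ i ∈ Finset.range n, 0 ≤ (t ^ q)⁻¹ * L (w i) ^ q := fun i _ => by
        have := hL.one_le (w i)
        positivity
      by_cases h : ∀ i < n, L (w i) ≤ t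
      · have h1 := hn t w ht1 h
        rw [htp] at h1
        have h2 : seqAccept alg g (lam n) (σ n) (φ n) w ≤
            Real.exp (C' / 2 * (n : ℝ) ^ (θ / 2)) * Real.exp (sumLogRatio alg g (σ n) n w / 2) := by
          refine (capExp_le_exp_half _).trans ?_
          rw [← Real.exp_add, Real.exp_le_exp]
          linarith
        linarith [Finset.sum_nonneg hnn]
      · push Not at h
        obtain ⟨i, hi, hti⟩ := h
        have h1 : (1 : ℝ) ≤ (t ^ q)⁻¹ * L (w i) ^ q := by
          rw [← div_eq_inv_mul, one_le_div (by positivity)]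
          gcongr
        have h2 := Finset.single_le_sum hnn (Finset.mem_range.2 hi)
        have h3 := seqAccept_le_one (alg := alg) (g := g) (lam n) (σ n) (φ n) w
        have h4 : 0 < Real.exp (C' / 2 * (n : ℝ) ^ (θ / 2)) *
          Real.exp (sumLogRatio alg g (σ n) n w / 2) := by positivity
        linarith
    have hi1 := hexp.2.const_mul (Real.exp (C' / 2 * (n : ℝ) ^ (θ / 2)))
    have hi2 : ∀ i ∈ Finset.range n, Integrable
        (fun w : ℕ → ℝ × ℝ => (t ^ q)⁻¹ * L (w i) ^ q) (seqLaw g) := fun i _ =>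
      (hL.integrable_pow_eval hg q i).const_mul _
    refine (integral_mono (S.integrable_seqAccept n)
      (hi1.fun_add (integrable_finsetSum _ hi2)) hpt).trans ?_
    rw [integral_add hi1 (integrable_finsetSum _ hi2), integral_finsetSum _ hi2,
      integral_const_mul]
    refine add_le_add ?_ ?_
    · refine (mul_le_mul_of_nonneg_left hexp.1 (Real.exp_pos _).le).trans_eq ?_
      rw [← Real.exp_add, hsn]
      congr 1
      ring
    · simp_rw [integral_const_mul, hL.integral_pow_eval hg]
      rw [Finset.sum_const, Finset.card_range, nsmul_eq_mul]
      have h1 : (n : ℝ) * (t ^ q)⁻¹ = (n : ℝ) ^ (1 - ε * q) := by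
        rw [ht, ← Real.rpow_natCast, ← Real.rpow_mul hn0.le, ← Real.rpow_neg hn0.le, sub_eq_add_neg,
          Real.rpow_add hn0, Real.rpow_one]
      rw [← mul_assoc, h1, mul_comm]
      gcongr
      linarith
  have hO := (exp_sub_isBigO (A := C' / 2) (B := roughness alg g / 64 * A) (by positivity) hθ P).add
    ((isBigO_refl (fun n : ℕ => (n : ℝ) ^ (-P)) atTop).const_mul_left m)
  refine IsBigO.trans (IsBigO.of_bound 1 ?_) hO
  filter_upwards [hbound] with n hn
  rw [one_mul, Real.norm_of_nonneg (integral_nonneg fun w => seqAccept_nonneg ..)]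
  exact hn.trans (le_abs_self _)

/-- Superpolynomial decay of the acceptance rate and of the squared jumps. -/
theorem meanAccept_and_sqJump_isBigO (S : Setting alg g L β κ Cp M lam φ σ)
    (hdecay : ∀ P : ℝ, (fun n => ∫ w, seqAccept alg g (lam n) (σ n) (φ n) w ∂(seqLaw g))
      =O[atTop] fun n : ℕ => (n : ℝ) ^ (-P)) (P : ℝ) :
    ((fun n => meanAccept alg g (lam n) (σ n) (φ n)) =O[atTop] fun n : ℕ => (n : ℝ) ^ (-P)) ∧
      ∀ j : ℕ, (fun n => meanSqJump alg g (lam n) (σ n) (φ n) j)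
        =O[atTop] fun n : ℕ => (n : ℝ) ^ (-P) := by
  have hg := S.regular
  have hL := S.dominates
  have hφm := S.measurable
  have hst := fun n => measurable_state (lam n)
  have hdr := (hg.continuous_drift (alg := alg)).measurable
  constructor
  · refine IsBigO.trans (IsBigO.of_bound (Real.exp (-M)) ?_) (hdecay P)
    filter_upwards [S.below, S.step_pos] with n hn h0
    rw [hg.meanAccept_eq (S.scales_pos n) h0 (hφm n)]
    rw [Real.norm_of_nonneg (integral_nonneg fun w =>
        mul_nonneg (Real.exp_pos _).le (seqAccept_nonneg ..)),
      Real.norm_of_nonneg (integral_nonneg fun w => seqAccept_nonneg ..), ← integral_const_mul]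
    refine integral_mono_of_nonneg (ae_of_all _ fun w =>
      mul_nonneg (Real.exp_pos _).le (seqAccept_nonneg ..))
      ((S.integrable_seqAccept n).const_mul _) (ae_of_all _ fun w => ?_)
    exact mul_le_mul_of_nonneg_right (Real.exp_le_exp.2 (neg_le_neg (hn _)))
      (seqAccept_nonneg ..)
  · intro j
    set m : ℝ := ∫ x, L x ^ 4 ∂(pairLaw g)
    -- The decay is used with exponent `2P`, since the splitting below costs a factor `n^P`.
    have hO1 : (fun n : ℕ => (n : ℝ) ^ P *
        ∫ w, seqAccept alg g (lam n) (σ n) (φ n) w ∂(seqLaw g)) =O[atTop]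
        fun n : ℕ => (n : ℝ) ^ (-P) := by
      refine ((isBigO_refl (fun n : ℕ => (n : ℝ) ^ P) atTop).mul (hdecay (2 * P))).congr'
        EventuallyEq.rfl ?_
      filter_upwards [eventually_gt_atTop 0] with n hn
      rw [← Real.rpow_add (by exact_mod_cast hn)]
      congr 1; ring
    have hO := (hO1.add ((isBigO_refl (fun n : ℕ => (n : ℝ) ^ (-P)) atTop).const_mul_left m))
    refine IsBigO.trans (IsBigO.of_bound (Real.exp (-M) * 4) ?_) hO
    filter_upwards [S.below, S.step_pos, S.step_zero.eventually_le_const zero_lt_one,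
      eventually_gt_atTop j, eventually_gt_atTop 0] with n hn h0 h1 hj hn0
    have hn0' : (0 : ℝ) < n := by exact_mod_cast hn0
    have hnP : (0 : ℝ) < (n : ℝ) ^ P := by positivity
    have hnn : ∀ w, 0 ≤ Real.exp (-φ n (state (lam n) w)) *
        ((w j).2 + σ n * drift alg g (w j).1) ^ 2 *
        seqAccept alg g (lam n) (σ n) (φ n) w := fun w =>
      mul_nonneg (by positivity) (seqAccept_nonneg ..)
    have hi1 := (S.integrable_seqAccept n).const_mul ((n : ℝ) ^ P)
    have hi2 := (hL.integrable_pow_eval hg 4 j).const_mul ((n : ℝ) ^ (-P))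
    have hI : ∫ w, Real.exp (-φ n (state (lam n) w)) *
        ((w j).2 + σ n * drift alg g (w j).1) ^ 2 *
        seqAccept alg g (lam n) (σ n) (φ n) w ∂(seqLaw g) ≤ Real.exp (-M) * 4 *
        ((n : ℝ) ^ P * ∫ w, seqAccept alg g (lam n) (σ n) (φ n) w ∂(seqLaw g) +
          m * (n : ℝ) ^ (-P)) := by
      have e : Real.exp (-M) * 4 *
        ((n : ℝ) ^ P * ∫ w, seqAccept alg g (lam n) (σ n) (φ n) w ∂(seqLaw g) +
          m * (n : ℝ) ^ (-P)) = ∫ w, Real.exp (-M) * 4 *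
          ((n : ℝ) ^ P * seqAccept alg g (lam n) (σ n) (φ n) w +
            (n : ℝ) ^ (-P) * L (w j) ^ 4) ∂(seqLaw g) := by
        rw [integral_const_mul, integral_add hi1 hi2, integral_const_mul, integral_const_mul,
          hL.integral_pow_eval hg, mul_comm m]
      rw [e]
      refine integral_mono_of_nonneg (ae_of_all _ hnn) ((hi1.fun_add hi2).const_mul _)
        (ae_of_all _ fun w => ?_)
      have ha0 := seqAccept_nonneg (alg := alg) (g := g) (lam n) (σ n) (φ n) w
      have ha1 := seqAccept_le_one (alg := alg) (g := g) (lam n) (σ n) (φ n) w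
      have hsq := hL.sq_jump_le h0 h1 (w j)
      set a := seqAccept alg g (lam n) (σ n) (φ n) w
      -- The squared jump is unbounded, so it is separated from the acceptance probability `a` by a
      -- weighted arithmetic–geometric mean inequality, together with `a^2 ≤ a`.
      have key : L (w j) ^ 2 * a ≤ (n : ℝ) ^ P * a + (n : ℝ) ^ (-P) * L (w j) ^ 4 := by
        rw [Real.rpow_neg hn0'.le]
        set x := (n : ℝ) ^ P
        have h2 : L (w j) ^ 2 * a = (x * a) * (x⁻¹ * L (w j) ^ 2) := by field_simp
        have h3 : x * a ^ 2 ≤ x * a := by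
          have : a ^ 2 ≤ a := by nlinarith
          gcongr
        have h4 : 0 ≤ x⁻¹ * (x * a - L (w j) ^ 2) ^ 2 := by positivity
        have h5 : x⁻¹ * (x * a - L (w j) ^ 2) ^ 2 =
            x * a ^ 2 - 2 * (L (w j) ^ 2 * a) + x⁻¹ * L (w j) ^ 4 := by field_simp; ring
        have h6 : 0 ≤ L (w j) ^ 2 * a := by positivity
        linarith
      have hexp : Real.exp (-φ n (state (lam n) w)) ≤ Real.exp (-M) :=
        Real.exp_le_exp.2 (neg_le_neg (hn _))
      have hM4 : 0 ≤ Real.exp (-M) * 4 := by positivity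
      calc _ ≤ Real.exp (-M) * (4 * L (w j) ^ 2) * a :=
            mul_le_mul_of_nonneg_right
              (mul_le_mul hexp hsq (sq_nonneg _) (Real.exp_pos _).le) ha0
        _ = Real.exp (-M) * 4 * (L (w j) ^ 2 * a) := by ring
        _ ≤ _ := mul_le_mul_of_nonneg_left key hM4
    rw [hg.meanSqJump_eq hL (S.scales_pos n) h0 h1 (hφm n) hn hj,
      Real.norm_of_nonneg (mul_nonneg (sq_nonneg _) (integral_nonneg hnn))]
    calc _ ≤ 1 * ∫ w, Real.exp (-φ n (state (lam n) w)) *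
        ((w j).2 + σ n * drift alg g (w j).1) ^ 2 *
        seqAccept alg g (lam n) (σ n) (φ n) w ∂(seqLaw g) := by
          refine mul_le_mul_of_nonneg_right ?_ (integral_nonneg hnn)
          exact pow_le_one₀ h0.le h1
      _ ≤ _ := by
        rw [one_mul]
        refine hI.trans ?_
        gcongr
        exact le_abs_self _

end Setting

/-- The limiting acceptance probability in terms of the limit of `n * σ n ^ (2 * alg.order)`. -/
lemma limitAccept_one_eq {l : ℝ} (hl : 0 < l) :
    limitAccept alg g 1 l = 2 * cdf (gaussianReal 0 1)
      (-(√((l ^ 2) ^ alg.order * roughness alg g) / 2)) := by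
  have e : (l ^ 2) ^ alg.order * roughness alg g = (l ^ alg.order) ^ 2 * roughness alg g := by ring
  rw [e, Real.sqrt_mul (by positivity), Real.sqrt_sq (by positivity)]
  cases alg
  · simp only [limitAccept, Algorithm.order, div_one, pow_one]
    congr 2; ring
  · simp only [limitAccept, Algorithm.order, div_one]
    congr 2; ring

/-- The degenerate case of the Gaussian computation; it supplies the limit one for `ρ > I`. -/
lemma two_mul_cdf_gaussianReal_zero : 2 * cdf (gaussianReal 0 1) 0 = 1 := by
  have := integral_capExp_gaussianReal (v := 0) le_rfl
  simpa [capExp] using this.symm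

end

end PrecMCMC

end

/-! ### The three regimes. -/

theorem corollary2 (alg : PrecMCMC.Algorithm) (g : ℝ → ℝ) (hg : PrecMCMC.RegularPotential g)
    (κ : ℝ) (hκ : 0 ≤ κ) (lam : (n : ℕ) → Fin n → ℝ) (hlam : PrecMCMC.ScalesLike κ lam)
    (φ : (n : ℕ) → (Fin n → ℝ) → ℝ) (hφmeas : ∀ n, Measurable (φ n))
    (hprob : ∀ n, 1 ≤ n → IsProbabilityMeasure (PrecMCMC.target g (lam n) (φ n)))
    (hbelow : PrecMCMC.BoundedBelow φ) (hlocal : PrecMCMC.LocalControl κ φ)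
    (l ρ : ℝ) (hl : 0 < l) (hρ : 0 < ρ) (σ : ℕ → ℝ)
    (hσ : ∀ n, 1 ≤ n → 0 < σ n ∧ σ n ^ 2 = l ^ 2 * (n : ℝ) ^ (-ρ)) :
    -- the constant in the limiting acceptance probability is positive
    0 < PrecMCMC.roughness alg g ∧
    -- the expectations below are those of integrable random variables, for large `n`
    (∀ᶠ n in atTop, Integrable (PrecMCMC.stepAccept alg g (lam n) (σ n) (φ n))
      (PrecMCMC.stepLaw g (lam n) (φ n))) ∧
    (∀ j : ℕ, ∀ᶠ n in atTop, ∀ h : j < n,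
      Integrable (PrecMCMC.sqJump alg g (lam n) (σ n) (φ n) ⟨j, h⟩)
        (PrecMCMC.stepLaw g (lam n) (φ n))) ∧
    (ρ = alg.index →
      Tendsto (fun n => PrecMCMC.meanAccept alg g (lam n) (σ n) (φ n)) atTop
        (𝓝 (PrecMCMC.limitAccept alg g 1 l)) ∧
      ∀ j : ℕ,
        (fun n : ℕ => PrecMCMC.meanSqJump alg g (lam n) (σ n) (φ n) j
            - l ^ 2 * PrecMCMC.limitAccept alg g 1 l * (n : ℝ) ^ (-alg.index))
          =o[atTop] fun n : ℕ => (n : ℝ) ^ (-alg.index)) ∧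
    (alg.index < ρ →
      Tendsto (fun n => PrecMCMC.meanAccept alg g (lam n) (σ n) (φ n)) atTop (𝓝 1) ∧
      ∀ j : ℕ,
        (fun n : ℕ => PrecMCMC.meanSqJump alg g (lam n) (σ n) (φ n) j
            - l ^ 2 * (n : ℝ) ^ (-ρ))
          =o[atTop] fun n : ℕ => (n : ℝ) ^ (-ρ)) ∧
    (ρ < alg.index →
      ∀ p : ℝ, 0 ≤ p →
        ((fun n => PrecMCMC.meanAccept alg g (lam n) (σ n) (φ n))
          =O[atTop] fun n : ℕ => (n : ℝ) ^ (-p)) ∧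
        ∀ j : ℕ,
          (fun n => PrecMCMC.meanSqJump alg g (lam n) (σ n) (φ n) j)
            =O[atTop] fun n : ℕ => (n : ℝ) ^ (-p)) := by
  open PrecMCMC in
  obtain ⟨δ, C, p, s, s', s'', hδ0, hδ, hC, hp, hs, hs', hs'', hctl⟩ := hlocal
  obtain ⟨M, hM⟩ := hbelow
  obtain ⟨L, hL⟩ := hg.exists_dominates alg
  obtain ⟨Cp, hCp⟩ := hlam.exists_scalesBelow
  have hσpos : ∀ᶠ n in atTop, 0 < σ n := by
    filter_upwards [eventually_ge_atTop 1] with n hn using (hσ n hn).1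
  have hσsq : ∀ᶠ n : ℕ in atTop, l ^ 2 * (n : ℝ) ^ (-ρ) = σ n ^ 2 := by
    filter_upwards [eventually_ge_atTop 1] with n hn using (hσ n hn).2.symm
  have hσ0 : Tendsto σ atTop (𝓝 0) := by
    have h1 : Tendsto (fun n => √(σ n ^ 2)) atTop (𝓝 0) := by
      have h2 := ((tendsto_natCast_rpow_neg hρ).const_mul (l ^ 2)).congr' hσsq
      simpa using h2.sqrt
    refine h1.congr' ?_
    filter_upwards [hσpos] with n hn using Real.sqrt_sq hn.le
  have hσ1 := hσ0.eventually_le_const zero_lt_one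
  have S : Setting alg g L (max s (max s' s'')) κ Cp M lam φ σ :=
    ⟨hg, hL, hCp, max_lt hs (max_lt hs' hs''), hφmeas, hM, hσpos, hσ0⟩
  have hs1 : s ≤ max s (max s' s'') := le_max_left _ _
  have hs2 : s' ≤ max s (max s' s'') := (le_max_left _ _).trans (le_max_right _ _)
  have hs3 : s'' ≤ max s (max s' s'') := (le_max_right _ _).trans (le_max_right _ _)
  -- The exponent `1 - mρ` decides the regime, because `m I = 1`; in the last regime it is the `θ`
  -- of the decay estimate.
  have hrate : ∀ᶠ n : ℕ in atTop, n * σ n ^ (2 * alg.order) =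
      (l ^ 2) ^ alg.order * (n : ℝ) ^ (1 - alg.order * ρ) := by
    filter_upwards [hσsq, eventually_gt_atTop 0] with n hn hn0
    have hn0' : (0 : ℝ) < n := by exact_mod_cast hn0
    rw [pow_mul, ← hn, mul_pow, ← Real.rpow_natCast ((n : ℝ) ^ (-ρ)), ← Real.rpow_mul hn0'.le,
      sub_eq_add_neg, Real.rpow_add hn0', Real.rpow_one, neg_mul, mul_comm ρ]
    ring
  have hone := order_mul_index alg
  have hord := order_pos alg
  have hlittle : ∀ {a : ℝ} {f : ℕ → ℝ}, (fun n => f n - σ n ^ 2 * a) =o[atTop] (fun n => σ n ^ 2) →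
      (fun n : ℕ => f n - l ^ 2 * a * (n : ℝ) ^ (-ρ)) =o[atTop] fun n : ℕ => (n : ℝ) ^ (-ρ) := by
    intro a f h
    have h1 : (fun n => σ n ^ 2) =O[atTop] fun n : ℕ => (n : ℝ) ^ (-ρ) :=
      ((isBigO_refl (fun n : ℕ => (n : ℝ) ^ (-ρ)) atTop).const_mul_left (l ^ 2)).congr' hσsq
        EventuallyEq.rfl
    refine (h.trans_isBigO h1).congr' ?_ EventuallyEq.rfl
    filter_upwards [hσsq] with n hn
    rw [← hn]; ring
  refine ⟨hg.roughness_pos, ?_, ?_, ?_, ?_, ?_⟩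
  · filter_upwards [hM, hσpos] with n h1 h2
    exact hg.integrable_stepAccept (S.scales_pos n) h2 (hφmeas n) h1
  · intro j
    filter_upwards [hM, hσpos, hσ1] with n h1 h2 h3 hj
    exact hg.integrable_sqJump hL (S.scales_pos n) h2 h3 (hφmeas n) h1 _
  · intro hI
    have hτ : Tendsto (fun n : ℕ => n * σ n ^ (2 * alg.order)) atTop (𝓝 ((l ^ 2) ^ alg.order)) := by
      refine tendsto_const_nhds.congr' ?_
      filter_upwards [hrate] with n hn
      rw [hn, hI, hone, sub_self, Real.rpow_zero, mul_one]
    obtain ⟨h1, h2⟩ := S.tendsto_meanAccept_and_sqJump hs1 hs2 hδ0 hδ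
      (hctl.mono fun n h => h.1) hprob (by positivity) hτ (limitAccept_one_eq hl)
    refine ⟨h1, fun j => ?_⟩
    rw [← hI]
    exact hlittle (h2 j)
  · intro hI
    have hneg : 0 < alg.order * ρ - 1 := by nlinarith
    have hτ : Tendsto (fun n : ℕ => n * σ n ^ (2 * alg.order)) atTop (𝓝 0) := by
      have h1 := (tendsto_natCast_rpow_neg hneg).const_mul ((l ^ 2) ^ alg.order)
      rw [mul_zero] at h1
      refine h1.congr' ?_
      filter_upwards [hrate] with n hn
      rw [hn, neg_sub]
    obtain ⟨h1, h2⟩ := S.tendsto_meanAccept_and_sqJump hs1 hs2 hδ0 hδ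
      (hctl.mono fun n h => h.1) hprob le_rfl hτ (a := 1) (by
        simpa using two_mul_cdf_gaussianReal_zero.symm)
    refine ⟨h1, fun j => ?_⟩
    simpa using hlittle (h2 j)
  · intro hI P _
    exact S.meanAccept_and_sqJump_isBigO (fun Q => S.integral_seqAccept_isBigO hs3 hC hp
      (hctl.mono fun n h => h.2) (by positivity) (by nlinarith) hrate Q) P
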